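/- **Conventions.** Manifolds are smooth, connected, orientable, Hausdorff, second countable and without boundary. For a continuous Riemannian metric $g$, $\operatorname{dist}_g$ is the infimum of lengths of $C^1$ curves, and $R(g)$ is the scalar curvature where $g$ is smooth. For $n<p\le\infty$ and a closed set $S\subset M$ we say that $(M^n,g)$ *has singular set $S$ with exponent $p$* if $g\in W^{1,p}_{\mathrm{loc}}(M)\cap C^\infty(M\setminus S)$ and $\mathcal H^{\,n-\frac p{p-1}}_{\mathrm{loc}}(S)<\infty$ if $p<\infty$, respectively $\mathcal H^{n-1}(S)=0$ if $p=\infty$. **Proposition (Lohkamp compactification).** Let $n\ge 3$, $n<p\le\infty$, let $M^n$ be a manifold with a complete continuous Riemannian metric $g$, and let $\mathcal E\subset M$ be an asymptotically flat end: there are smooth coordinates $x:\mathcal E\to\mathbb R^n\setminus\overline{B_1(0)}$, a diffeomorphism, such that, with $r=|x|$, the sets $\{r\ge s\}$, $s>1$, are closed in $M$; $g$ is smooth on $\mathcal E$ with $|g_{ij}-\delta_{ij}|+r|\partial g_{ij}|+r^2|\partial^2g_{ij}|\le Cr^{-\sigma}$ for some $C$ and some $\sigma>\frac{n-2}2$;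 and $R(g)\in L^1(\mathcal E)$. Suppose that * $(M,g)$ has singular set $S$ with exponent $p$, where $S$ is closed and $S\cap\mathcal E=\emptyset$, and $R(g)\ge0$ on $M\setminus S$; * near infinity of $\mathcal E$, $g=u^{\frac4{n-2}}g_{\mathrm{euc}}$ for a positive function $u$, and $R(g)\equiv 0$; * the ADM mass $m=\lim_{r\to\infty}\frac1{2(n-1)|\mathbb S^{n-1}|}\int_{\{|x|=r\}}(g_{ij,j}-g_{jj,i})\nu^i$ of $\mathcal E$ is negative. Then the end $\mathcal E$ can be closed up: there are a manifold $\hat M^n$ with a complete continuous Riemannian metric $\hat g$, a number $s>1$, and a smooth isometric embedding $\Phi:M\setminus\{r\ge s\}\to\hat M$ onto an open set with compact complement, and there are bounded open sets $U_0\subset U_1\subset U_2$ in $\hat M$, such that, with $\hat S=\Phi(S)$, 1. $\hat S$ is closed in $\hat M$ and disjoint from $\overline{U_2}$, and $(\hat M,\hat g)$ has singular set $\hat S$ with exponent $p$; 2. $R(\hat g)\ge0$ on $\hat M\setminus\hat S$; 3. $U_0$ is diffeomorphic to $\mathbb T^n\setminus B$, where $B$ is a closed ball in $\mathbb T^n=\mathbb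 R^n/\mathbb Z^n$; 4. $\partial U_2\neq\emptyset$ and $\operatorname{dist}_{\hat g}(\partial U_2,U_1)>0$; 5. $R(\hat g)>0$ on $\overline{U_2}\setminus U_1$. -/

import Mathlib

open Set Filter Topology MeasureTheory Manifold Bundle
open scoped ContDiff NNReal

universe u

noncomputable section

namespace SingularAF

/-- Euclidean space `ℝⁿ`. -/
abbrev Euc (n : ℕ) : Type := EuclideanSpace ℝ (Fin n)

/-- The `i`-th standard basis vector of `ℝⁿ`. -/
def basisVec (n : ℕ) (i : Fin n) : Euc n := EuclideanSpace.single i 1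

/-! ### Scalar curvature of a metric given in coordinates -/

/-- The partial derivative `∂ᵢ f` at `y`. -/
def pderiv {n : ℕ} (i : Fin n) (f : Euc n → ℝ) (y : Euc n) : ℝ :=
  fderiv ℝ f y (basisVec n i)

/-- The Christoffel symbol `Γᵏᵢⱼ = ½ gᵏˡ (∂ᵢ gⱼₗ + ∂ⱼ gᵢₗ - ∂ₗ gᵢⱼ)`. -/
def christoffel {n : ℕ} (G : Euc n → Matrix (Fin n) (Fin n) ℝ) (k i j : Fin n) (y : Euc n) : ℝ :=
  (1 / 2) * ∑ l, (G y)⁻¹ k l *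
    (pderiv i (fun z => G z j l) y + pderiv j (fun z => G z i l) y
      - pderiv l (fun z => G z i j) y)

/-- The Ricci curvature
`Rᵢⱼ = ∂ₖ Γᵏᵢⱼ - ∂ⱼ Γᵏᵢₖ + Γᵏₖₗ Γˡᵢⱼ - Γᵏⱼₗ Γˡᵢₖ`. -/
def ricciCoord {n : ℕ} (G : Euc n → Matrix (Fin n) (Fin n) ℝ) (i j : Fin n) (y : Euc n) : ℝ :=
  ∑ k, (pderiv k (christoffel G k i j) y - pderiv j (christoffel G k i k) y)
    + ∑ k, ∑ l, (christoffel G k k l y * christoffel G l i j y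
        - christoffel G k j l y * christoffel G l i k y)

/-- The scalar curvature `R = gⁱʲ Rᵢⱼ`. -/
def scalarCoord {n : ℕ} (G : Euc n → Matrix (Fin n) (Fin n) ℝ) (y : Euc n) : ℝ :=
  ∑ i, ∑ j, (G y)⁻¹ i j * ricciCoord G i j y

/-! ### Sobolev functions -/

/-- `u ∈ W^{1,p}(V)` for an open set `V ⊆ ℝⁿ`. -/
def MemW1p {n : ℕ} (p : ENNReal) (u : Euc n → ℝ) (V : Set (Euc n)) : Prop :=
  MemLp u p (volume.restrict V) ∧
  ∀ k : Fin n, ∃ v : Euc n → ℝ, MemLp v p (volume.restrict V) ∧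
    ∀ ψ : Euc n → ℝ, ContDiff ℝ ∞ ψ → HasCompactSupport ψ → tsupport ψ ⊆ V →
      ∫ y in V, u y * pderiv k ψ y = - ∫ y in V, v y * ψ y

/-- `u ∈ W^{1,p}_loc(Ω)` for an open set `Ω ⊆ ℝⁿ`. -/
def MemW1pLoc {n : ℕ} (p : ENNReal) (u : Euc n → ℝ) (Ω : Set (Euc n)) : Prop :=
  ∀ y ∈ Ω, ∃ V : Set (Euc n), IsOpen V ∧ y ∈ V ∧ V ⊆ Ω ∧ MemW1p p u V

section Manifolds

variable {n : ℕ} {M : Type*} [TopologicalSpace M] [ChartedSpace (Euc n) M]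

/-- Orientability: there is a smooth atlas all of whose transition maps have positive Jacobian
determinant. -/
def IsOrientable (n : ℕ) (M : Type*) [TopologicalSpace M] [ChartedSpace (Euc n) M] : Prop :=
  ∃ A : Set (OpenPartialHomeomorph M (Euc n)),
    A ⊆ IsManifold.maximalAtlas (𝓡 n) ∞ M ∧ (∀ x : M, ∃ e ∈ A, x ∈ e.source) ∧
    ∀ e ∈ A, ∀ e' ∈ A, ∀ x ∈ e.source ∩ e'.source,
      0 < (fderiv ℝ (e' ∘ e.symm) (e x)).det

variable [IsManifold (𝓡 n) ∞ M]

/-- A continuous (`C⁰`) Riemannian metric on the smooth manifold `M`. -/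
abbrev C0Metric (n : ℕ) (M : Type*) [TopologicalSpace M] [ChartedSpace (Euc n) M]
    [IsManifold (𝓡 n) ∞ M] :=
  ContinuousRiemannianMetric (Euc n) (fun x : M => TangentSpace (𝓡 n) x)

/-- The distance induced by `g`: the infimum of the `g`-lengths of `C¹` curves. -/
def gDist (g : C0Metric n M) (x y : M) : ENNReal :=
  letI : RiemannianBundle (fun x : M => TangentSpace (𝓡 n) x) := ⟨g.toRiemannianMetric⟩
  riemannianEDist (𝓡 n) x y

/-- `g` is complete: every Cauchy sequence for the induced distance converges in `M`. -/
def IsCompleteMetric (g : C0Metric n M) : Prop :=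
  ∀ u : ℕ → M, (∀ ε : ENNReal, 0 < ε → ∃ N, ∀ a ≥ N, ∀ b ≥ N, gDist g (u a) (u b) < ε) →
    ∃ x, Tendsto u atTop (𝓝 x)

/-- `U` is bounded for the distance induced by `g`. -/
def IsBoundedFor (g : C0Metric n M) (U : Set M) : Prop :=
  ∃ C : ℝ≥0, ∀ x ∈ U, ∀ y ∈ U, gDist g x y ≤ C

/-- `dist_g(A, B)`. -/
def setDist (g : C0Metric n M) (A B : Set M) : ENNReal :=
  ⨅ x ∈ A, ⨅ y ∈ B, gDist g x y

/-- The matrix `gᵢⱼ = g(∂ᵢ, ∂ⱼ)` of the metric in the chart `e`, as a function on `e.target`. -/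
def coordMetric (g : C0Metric n M) (e : OpenPartialHomeomorph M (Euc n)) (y : Euc n) :
    Matrix (Fin n) (Fin n) ℝ :=
  fun i j => g.inner (e.symm y)
    (mfderiv (𝓡 n) (𝓡 n) e.symm y (basisVec n i)) (mfderiv (𝓡 n) (𝓡 n) e.symm y (basisVec n j))

/-- The scalar curvature `R(g)` at `x` (meaningful where `g` is smooth), computed in the preferred
chart at `x`; the value does not depend on the chart. -/
def scalarCurv (g : C0Metric n M) (x : M) : ℝ :=
  scalarCoord (coordMetric g (chartAt (Euc n) x)) (chartAt (Euc n) x x)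

/-- `g` is smooth on the open set `U`: its components in every smooth chart are. -/
def IsSmoothOn (g : C0Metric n M) (U : Set M) : Prop :=
  ∀ e ∈ IsManifold.maximalAtlas (𝓡 n) ∞ M, ∀ i j,
    ContDiffOn ℝ ∞ (fun y => coordMetric g e y i j) (e.target ∩ e.symm ⁻¹' U)

/-- `g ∈ W^{1,p}_loc(M)`: its components in every smooth chart are in `W^{1,p}_loc`. -/
def IsW1pLoc (p : ENNReal) (g : C0Metric n M) : Prop :=
  ∀ e ∈ IsManifold.maximalAtlas (𝓡 n) ∞ M, ∀ i j,
    MemW1pLoc p (fun y => coordMetric g e y i j) e.target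

/-- `𝓗^d_loc(S) < ∞`, i.e. `𝓗^d(S ∩ K) < ∞` for compact `K`. As a continuous metric is locally
bi-Lipschitz to the Euclidean metric of a chart, this is tested on compact sets inside charts. -/
def HausdorffLocFinite (n : ℕ) {M : Type*} [TopologicalSpace M] [ChartedSpace (Euc n) M]
    (d : ℝ) (S : Set M) : Prop :=
  ∀ e ∈ IsManifold.maximalAtlas (𝓡 n) ∞ M, ∀ K : Set (Euc n), IsCompact K → K ⊆ e.target →
    μH[d] (K ∩ e.symm ⁻¹' S) < ⊤

/-- `𝓗^d(S) = 0`, tested in charts. -/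
def HausdorffNull (n : ℕ) {M : Type*} [TopologicalSpace M] [ChartedSpace (Euc n) M]
    (d : ℝ) (S : Set M) : Prop :=
  ∀ e ∈ IsManifold.maximalAtlas (𝓡 n) ∞ M, μH[d] (e.target ∩ e.symm ⁻¹' S) = 0

/-- The metric `g` is in `W^{1,p}_loc(M) ∩ C^∞(M - S)`, where `S` is closed with
`𝓗^{n - p/(p-1)}_loc(S) < ∞` if `p < ∞`, and `𝓗^{n-1}(S) = 0` if `p = ∞`. -/
structure HasSingularSet (p : ENNReal) (g : C0Metric n M) (S : Set M) : Prop where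
  isClosed : IsClosed S
  sobolev : IsW1pLoc p g
  smooth : IsSmoothOn g Sᶜ
  hausdorff_of_lt_top : p < ⊤ → HausdorffLocFinite n ((n : ℝ) - p.toReal / (p.toReal - 1)) S
  hausdorff_of_eq_top : p = ⊤ → HausdorffNull n ((n : ℝ) - 1) S

/-! ### Asymptotically flat ends -/

/-- The part `{r ≥ s}` of an end with coordinates `φ`, where `r = |x|`. -/
def endRegion (φ : OpenPartialHomeomorph M (Euc n)) (s : ℝ) : Set M :=
  {x | x ∈ φ.source ∧ s ≤ ‖φ x‖}

/-- The smooth coordinates `φ` identify `𝓔 = φ.source` with `ℝⁿ ∖ closedBall 0 1` and exhibit it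
as an asymptotically flat end of `(M, g)`. That `𝓔` is an end of `M` (with infinity of `𝓔` at
`r → ∞`) means that the sets `{r ≥ s}` with `s > 1` are closed in `M`, so that `{r > s}` is a
component of the complement of the compact set `{r = s}`. The scalar curvature of `g` on `𝓔` and
the volume element `√(det g) dx` are computed in the coordinates `φ`. -/
structure IsAFEnd (g : C0Metric n M) (φ : OpenPartialHomeomorph M (Euc n)) : Prop where
  mem_atlas : φ ∈ IsManifold.maximalAtlas (𝓡 n) ∞ M
  target_eq : φ.target = {y : Euc n | 1 < ‖y‖}
  isClosed_endRegion : ∀ s : ℝ, 1 < s → IsClosed (endRegion φ s)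
  smooth : IsSmoothOn g φ.source
  decay : ∃ C σ : ℝ, ((n : ℝ) - 2) / 2 < σ ∧ ∀ y : Euc n, 1 < ‖y‖ → ∀ i j,
    |coordMetric g φ y i j - (1 : Matrix (Fin n) (Fin n) ℝ) i j|
      + ‖y‖ * ‖fderiv ℝ (fun z => coordMetric g φ z i j) y‖
      + ‖y‖ ^ 2 * ‖iteratedFDeriv ℝ 2 (fun z => coordMetric g φ z i j) y‖ ≤ C * ‖y‖ ^ (-σ)
  integrable : IntegrableOn
    (fun y => scalarCoord (coordMetric g φ) y * √((coordMetric g φ y).det)) {y | 1 < ‖y‖}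

/-- The surface integral `(2(n-1)|𝕊ⁿ⁻¹|)⁻¹ ∫_{|x| = r} (gᵢⱼ,ⱼ - gⱼⱼ,ᵢ) νⁱ`, with `x = r w`,
`w ∈ 𝕊ⁿ⁻¹`, `ν = w`. -/
def admFlux (g : C0Metric n M) (φ : OpenPartialHomeomorph M (Euc n)) (r : ℝ) : ℝ :=
  (2 * ((n : ℝ) - 1) * ((volume : Measure (Euc n)).toSphere univ).toReal)⁻¹ *
    (r ^ (n - 1) * ∫ w : Metric.sphere (0 : Euc n) 1,
      (∑ i, ∑ j, (pderiv j (fun z => coordMetric g φ z i j) (r • (w : Euc n))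
        - pderiv i (fun z => coordMetric g φ z j j) (r • (w : Euc n))) * (w : Euc n) i)
      ∂((volume : Measure (Euc n)).toSphere))

/-- The ADM mass of the end with coordinates `φ` is `m`. -/
def HasADMMass (g : C0Metric n M) (φ : OpenPartialHomeomorph M (Euc n)) (m : ℝ) : Prop :=
  Tendsto (admFlux g φ) atTop (𝓝 m)

/-- Near infinity of the end, `g = u^{4/(n-2)} g_euc` with `u > 0`, and `R(g) = 0`. -/
def IsConformallyFlatScalarFlatNearInfinity (g : C0Metric n M)
    (φ : OpenPartialHomeomorph M (Euc n)) : Prop :=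
  ∃ s : ℝ, 1 ≤ s ∧ ∃ u : Euc n → ℝ, ∀ y : Euc n, s < ‖y‖ →
    0 < u y ∧
    coordMetric g φ y = (u y ^ (4 / ((n : ℝ) - 2))) • (1 : Matrix (Fin n) (Fin n) ℝ) ∧
    scalarCoord (coordMetric g φ) y = 0

/-! ### The torus minus a ball -/

/-- The preimage in `ℝⁿ` of `𝕋ⁿ - B`, where `𝕋ⁿ = ℝⁿ/ℤⁿ` and `B` is the image of the closed ball
of radius `ρ` about `0`. -/
def perforatedSpace (n : ℕ) (ρ : ℝ) : Set (Euc n) :=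
  {x | ∀ k : Fin n → ℤ, ρ < ‖x - WithLp.toLp 2 (fun i => (k i : ℝ))‖}

/-- `U` is diffeomorphic to `𝕋ⁿ - B` for a closed ball `B` in `𝕋ⁿ = ℝⁿ/ℤⁿ` (embedded, i.e. of
radius `< 1/2`). The diffeomorphism is given by its composition `F` with the projection
`ℝⁿ → ℝⁿ/ℤⁿ`: a local diffeomorphism onto `U` whose fibres are the `ℤⁿ`-orbits. -/
def IsTorusMinusBall (n : ℕ) {N : Type*} [TopologicalSpace N] [ChartedSpace (Euc n) N]
    (U : Set N) : Prop :=
  ∃ ρ : ℝ, 0 < ρ ∧ ρ < 1 / 2 ∧ ∃ F : Euc n → N,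
    IsLocalDiffeomorphOn (𝓡 n) (𝓡 n) ∞ F (perforatedSpace n ρ) ∧
    F '' perforatedSpace n ρ = U ∧
    ∀ x ∈ perforatedSpace n ρ, ∀ y ∈ perforatedSpace n ρ,
      (F x = F y ↔ ∃ k : Fin n → ℤ, x - y = WithLp.toLp 2 (fun i => (k i : ℝ)))

/-- `(N, h)` arises from `(M, g)` by closing up the end with coordinates `φ`, keeping the singular
set: for some `s > 1` the open set `M - {r ≥ s}` embeds smoothly and isometrically in `N` with
compact complement, and `T` is the image of the set `S`. -/
def IsClosingUp {N : Type*} [TopologicalSpace N] [ChartedSpace (Euc n) N]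
    [IsManifold (𝓡 n) ∞ N] (g : C0Metric n M) (φ : OpenPartialHomeomorph M (Euc n)) (S : Set M)
    (h : C0Metric n N) (T : Set N) : Prop :=
  ∃ s : ℝ, 1 < s ∧ ∃ Φ : M → N,
    ContMDiffOn (𝓡 n) (𝓡 n) ∞ Φ (endRegion φ s)ᶜ ∧
    InjOn Φ (endRegion φ s)ᶜ ∧
    (∀ x ∈ (endRegion φ s)ᶜ, ∀ v w : TangentSpace (𝓡 n) x,
      h.inner (Φ x) (mfderiv (𝓡 n) (𝓡 n) Φ x v) (mfderiv (𝓡 n) (𝓡 n) Φ x w) = g.inner x v w) ∧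
    IsCompact (Φ '' (endRegion φ s)ᶜ)ᶜ ∧
    T = Φ '' S

end Manifolds

end SingularAF

end

/-! Near infinity `g = u^{4/(n-2)} δ`, and `R(g) = 0` means that `u` is harmonic, with limit `1`.
The scalar curvature of `v^{4/(n-2)} δ` is a positive multiple of `-Δv` (`scalarCoord_conformal`).
So `R ≥ 0` survives if `u` is replaced far out by a positive superharmonic `v`, and the end becomes
flat where `v` is constant.

Negative mass is what permits such a `v`. The mass is a negative multiple of the limiting flux of
`u^{4/(n-2)}` through large spheres (`admFlux_eq_of_conformal`), so this flux is positive and the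
spherical means of `u^{4/(n-2)}` lie below `1` by at least a multiple of `r^{2-n}`
(`sphereInt_le_of_flux`). The oscillation of `u` on a sphere is only `O(r^{1-n})`
(`exists_oscillation_le`), hence `u < 1` on every large sphere (`eventually_lt_one_of_flux`). Take a
smoothed minimum of `u` and a barrier whose values lie strictly between the maximum of `u` on one
such sphere and `1`: it equals `u` near that sphere, is constant farther out, and is superharmonic,
strictly so in a collar before it becomes constant (`exists_superharmonic_flattening`).

The metric is now a constant multiple of the Euclidean one for `r ≥ s₃`. Take a lattice `L ℤⁿ` with
`L > 2 s₃`, remove the closed balls of radius `s₃` about its nonzero points, and identify points of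
the end that differ by a lattice vector. The quotient is the core of `M` with a torus minus a ball
attached along the sphere `r = s₃`. The quotient map is a local diffeomorphism whose identifications
are translations, that is isometries, so the metric descends (`exists_descended_metric`).
Smoothness, Sobolev class, Hausdorff bounds and scalar curvature are local and are read off
upstairs. Hausdorffness, connectedness, orientability and completeness are global and are treated
separately. The sets `U₂` and `U₁` are images of `{r > t}` for two radii in the strictly
superharmonic collar, and `U₀` is the torus minus a slightly larger ball. -/

noncomputable section

namespace SingularAF

/-! ### Partial derivatives -/

section PartialDerivatives

variable {n : ℕ} {f g : Euc n → ℝ} {y : Euc n}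

/-- The flat Laplacian `∑ ∂ᵢ∂ᵢ f`. -/
def lap (f : Euc n → ℝ) (y : Euc n) : ℝ := ∑ i, pderiv i (pderiv i f) y

/-- The squared length `∑ (∂ᵢ f)²` of the flat gradient. -/
def gradSq (f : Euc n → ℝ) (y : Euc n) : ℝ := ∑ i, pderiv i f y ^ 2

lemma gradSq_nonneg (f : Euc n → ℝ) (y : Euc n) : 0 ≤ gradSq f y :=
  Finset.sum_nonneg fun _ _ => sq_nonneg _

lemma pderiv_congr {i : Fin n} (h : f =ᶠ[𝓝 y] g) : pderiv i f y = pderiv i g y := by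
  simp [pderiv, h.fderiv_eq]

lemma contDiffAt_pderiv {i : Fin n} (hf : ContDiffAt ℝ 2 f y) : ContDiffAt ℝ 1 (pderiv i f) y :=
  (hf.fderiv_right (m := 1) (by norm_num)).clm_apply contDiffAt_const

lemma differentiableAt_of_contDiffAt (hf : ContDiffAt ℝ 2 f y) : DifferentiableAt ℝ f y :=
  hf.differentiableAt (by simp)

lemma differentiableAt_pderiv {i : Fin n} (hf : ContDiffAt ℝ 2 f y) :
    DifferentiableAt ℝ (pderiv i f) y :=
  (contDiffAt_pderiv hf).differentiableAt (by simp)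

lemma eventually_contDiffAt (hf : ContDiffAt ℝ 2 f y) : ∀ᶠ z in 𝓝 y, ContDiffAt ℝ 2 f z :=
  hf.eventually (by simp)

lemma pderiv_const (i : Fin n) (c : ℝ) : pderiv i (fun _ : Euc n => c) y = 0 := by
  simp [pderiv]

lemma pderiv_add {i : Fin n} (hf : DifferentiableAt ℝ f y) (hg : DifferentiableAt ℝ g y) :
    pderiv i (fun z => f z + g z) y = pderiv i f y + pderiv i g y := by
  simp only [pderiv]; rw [fderiv_fun_add hf hg]; simp

lemma pderiv_sub {i : Fin n} (hf : DifferentiableAt ℝ f y) (hg : DifferentiableAt ℝ g y) :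
    pderiv i (fun z => f z - g z) y = pderiv i f y - pderiv i g y := by
  simp only [pderiv]; rw [fderiv_fun_sub hf hg]; simp

lemma pderiv_mul {i : Fin n} (hf : DifferentiableAt ℝ f y) (hg : DifferentiableAt ℝ g y) :
    pderiv i (fun z => f z * g z) y = f y * pderiv i g y + g y * pderiv i f y := by
  simp only [pderiv]; rw [fderiv_fun_mul hf hg]; simp

lemma pderiv_const_mul {i : Fin n} (c : ℝ) (hf : DifferentiableAt ℝ f y) :
    pderiv i (fun z => c * f z) y = c * pderiv i f y := by
  simp only [pderiv]; rw [fderiv_const_mul hf]; simp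

lemma pderiv_mul_const {i : Fin n} (c : ℝ) (hf : DifferentiableAt ℝ f y) :
    pderiv i (fun z => f z * c) y = pderiv i f y * c := by
  simp only [pderiv]; rw [fderiv_mul_const hf]; simp [mul_comm]

lemma pderiv_comp {i : Fin n} {φ : ℝ → ℝ} {φ' : ℝ} (hφ : HasDerivAt φ φ' (f y))
    (hf : DifferentiableAt ℝ f y) : pderiv i (fun z => φ (f z)) y = φ' * pderiv i f y := by
  have := hφ.comp_hasFDerivAt y hf.hasFDerivAt
  have h2 : fderiv ℝ (fun z => φ (f z)) y = φ' • fderiv ℝ f y := this.fderiv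
  simp [pderiv, h2]

lemma lap_add (hf : ContDiffAt ℝ 2 f y) (hg : ContDiffAt ℝ 2 g y) :
    lap (fun z => f z + g z) y = lap f y + lap g y := by
  simp only [lap, ← Finset.sum_add_distrib]
  refine Finset.sum_congr rfl fun i _ => ?_
  have h : pderiv i (fun z => f z + g z) =ᶠ[𝓝 y] fun z => pderiv i f z + pderiv i g z := by
    filter_upwards [eventually_contDiffAt hf, eventually_contDiffAt hg] with z h1 h2
    exact pderiv_add (differentiableAt_of_contDiffAt h1) (differentiableAt_of_contDiffAt h2)
  rw [pderiv_congr h, pderiv_add (differentiableAt_pderiv hf)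
    (differentiableAt_pderiv hg)]

lemma lap_const_mul (c : ℝ) (hf : ContDiffAt ℝ 2 f y) :
    lap (fun z => c * f z) y = c * lap f y := by
  simp only [lap, Finset.mul_sum]
  refine Finset.sum_congr rfl fun i _ => ?_
  have h : pderiv i (fun z => c * f z) =ᶠ[𝓝 y] fun z => c * pderiv i f z := by
    filter_upwards [eventually_contDiffAt hf] with z h1
    exact pderiv_const_mul c (differentiableAt_of_contDiffAt h1)
  rw [pderiv_congr h, pderiv_const_mul c (differentiableAt_pderiv hf)]

lemma lap_const (c : ℝ) : lap (fun _ : Euc n => c) y = 0 := by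
  refine Finset.sum_eq_zero fun i _ => ?_
  have h : pderiv i (fun _ : Euc n => c) = fun _ => 0 := funext fun z => pderiv_const i c
  rw [h, pderiv_const]

lemma lap_sub (hf : ContDiffAt ℝ 2 f y) (hg : ContDiffAt ℝ 2 g y) :
    lap (fun z => f z - g z) y = lap f y - lap g y := by
  have h := lap_add hf ((contDiffAt_const (c := (-1 : ℝ))).mul hg)
  rw [lap_const_mul _ hg] at h
  simp only [neg_one_mul, ← sub_eq_add_neg] at h
  exact h

lemma lap_mul (hf : ContDiffAt ℝ 2 f y) (hg : ContDiffAt ℝ 2 g y) :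
    lap (fun z => f z * g z) y
      = f y * lap g y + g y * lap f y + 2 * ∑ i, pderiv i f y * pderiv i g y := by
  simp only [lap, Finset.mul_sum, ← Finset.sum_add_distrib]
  refine Finset.sum_congr rfl fun i _ => ?_
  have h : pderiv i (fun z => f z * g z) =ᶠ[𝓝 y]
      fun z => f z * pderiv i g z + g z * pderiv i f z := by
    filter_upwards [eventually_contDiffAt hf, eventually_contDiffAt hg] with z h1 h2
    exact pderiv_mul (differentiableAt_of_contDiffAt h1) (differentiableAt_of_contDiffAt h2)
  have hf' := differentiableAt_of_contDiffAt hf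
  have hg' := differentiableAt_of_contDiffAt hg
  have hfi := differentiableAt_pderiv (i := i) hf
  have hgi := differentiableAt_pderiv (i := i) hg
  rw [pderiv_congr h, pderiv_add (hf'.fun_mul hgi) (hg'.fun_mul hfi), pderiv_mul hf' hgi,
    pderiv_mul hg' hfi]
  ring

lemma lap_comp {φ φ' : ℝ → ℝ} {φ'' : ℝ} (hφ : ∀ᶠ t in 𝓝 (f y), HasDerivAt φ (φ' t) t)
    (hφ' : HasDerivAt φ' φ'' (f y)) (hf : ContDiffAt ℝ 2 f y) :
    lap (fun z => φ (f z)) y = φ' (f y) * lap f y + φ'' * gradSq f y := by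
  simp only [lap, gradSq, Finset.mul_sum, ← Finset.sum_add_distrib]
  refine Finset.sum_congr rfl fun i _ => ?_
  have h : pderiv i (fun z => φ (f z)) =ᶠ[𝓝 y] fun z => φ' (f z) * pderiv i f z := by
    filter_upwards [eventually_contDiffAt hf, hf.continuousAt.eventually hφ] with z h1 h2
    exact pderiv_comp h2 (differentiableAt_of_contDiffAt h1)
  have hf' := differentiableAt_of_contDiffAt hf
  have hfi := differentiableAt_pderiv (i := i) hf
  have hc : DifferentiableAt ℝ (fun z => φ' (f z)) y :=
    hφ'.differentiableAt.comp y hf'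
  rw [pderiv_congr h, pderiv_mul hc hfi, pderiv_comp hφ' hf']
  ring

end PartialDerivatives

/-! ### Scalar curvature of conformally flat metrics -/

section ConformallyFlat

variable {n : ℕ} {G G' : Euc n → Matrix (Fin n) (Fin n) ℝ} {y : Euc n}

lemma christoffel_congr (h : G =ᶠ[𝓝 y] G') (k i j : Fin n) :
    christoffel G k i j y = christoffel G' k i j y := by
  have h' : ∀ a b, (fun z => G z a b) =ᶠ[𝓝 y] fun z => G' z a b := fun a b =>
    h.mono fun z hz => by simp [hz]
  simp only [christoffel, h.eq_of_nhds]
  congr 1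
  refine Finset.sum_congr rfl fun l _ => ?_
  rw [pderiv_congr (h' j l), pderiv_congr (h' i l), pderiv_congr (h' i j)]

lemma christoffel_eventuallyEq (h : G =ᶠ[𝓝 y] G') (k i j : Fin n) :
    christoffel G k i j =ᶠ[𝓝 y] christoffel G' k i j :=
  h.eventuallyEq_nhds.mono fun _ hz => christoffel_congr hz k i j

/-- The scalar curvature at a point depends only on the germ of the metric. -/
lemma scalarCoord_congr (h : G =ᶠ[𝓝 y] G') : scalarCoord G y = scalarCoord G' y := by
  simp only [scalarCoord, ricciCoord, h.eq_of_nhds, christoffel_congr h,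
    fun a k i j => pderiv_congr (i := a) (christoffel_eventuallyEq h k i j)]

/-- Kronecker's delta. -/
def kron (i j : Fin n) : ℝ := if i = j then 1 else 0

/-- The Christoffel symbols of `e^{2λ} δ`. -/
lemma christoffel_exp {l : Euc n → ℝ} (hl : DifferentiableAt ℝ l y)
    (hG : G =ᶠ[𝓝 y] fun z => Real.exp (2 * l z) • (1 : Matrix (Fin n) (Fin n) ℝ)) (k i j : Fin n) :
    christoffel G k i j y = kron j k * pderiv i l y
      + kron i k * pderiv j l y
      - kron i j * pderiv k l y := by
  rw [christoffel_congr hG]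
  have hd : ∀ a b c : Fin n, pderiv a
      (fun z => (Real.exp (2 * l z) • (1 : Matrix (Fin n) (Fin n) ℝ)) b c) y
      = 2 * Real.exp (2 * l y) * pderiv a l y * kron b c := by
    intro a b c
    have hφ : HasDerivAt (fun t => Real.exp (2 * t)) (Real.exp (2 * l y) * 2) (l y) := by
      simpa using ((hasDerivAt_id (l y)).const_mul 2).exp
    have h1 := pderiv_comp (i := a) hφ hl
    have h2 : DifferentiableAt ℝ (fun z => Real.exp (2 * l z)) y :=
      hφ.differentiableAt.comp y hl
    have := pderiv_mul_const (i := a) (kron b c) h2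
    simp only [Matrix.smul_apply, smul_eq_mul, Matrix.one_apply]
    simp only [kron] at this ⊢
    rw [this, h1]; ring
  have hinv : (Real.exp (2 * l y) • (1 : Matrix (Fin n) (Fin n) ℝ))⁻¹
      = (Real.exp (2 * l y))⁻¹ • (1 : Matrix (Fin n) (Fin n) ℝ) := by
    apply Matrix.inv_eq_right_inv
    rw [smul_mul_smul_comm, mul_inv_cancel₀ (Real.exp_pos _).ne']; simp
  simp only [christoffel, hd]
  simp only [hinv, Matrix.smul_apply, smul_eq_mul]
  rw [Finset.sum_eq_single k]
  · rw [Matrix.one_apply_eq]; field_simp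
  · intro b _ hb
    rw [Matrix.one_apply_ne hb.symm]; ring
  · simp

/-- The scalar curvature of `e^{2λ} δ`. -/
lemma scalarCoord_exp {l : Euc n → ℝ} (hl : ContDiffAt ℝ 2 l y)
    (hG : G =ᶠ[𝓝 y] fun z => Real.exp (2 * l z) • (1 : Matrix (Fin n) (Fin n) ℝ)) :
    scalarCoord G y = (Real.exp (2 * l y))⁻¹ *
      (-(2 * ((n : ℝ) - 1)) * lap l y - ((n : ℝ) - 2) * ((n : ℝ) - 1) * gradSq l y) := by
  have hΓ : ∀ k i j, christoffel G k i j =ᶠ[𝓝 y] fun z =>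
      kron j k * pderiv i l z
      + kron i k * pderiv j l z
      - kron i j * pderiv k l z := by
    intro k i j
    filter_upwards [eventually_contDiffAt hl, hG.eventuallyEq_nhds] with z h1 h2
    exact christoffel_exp (differentiableAt_of_contDiffAt h1) h2 k i j
  have hdl : ∀ i, DifferentiableAt ℝ (pderiv i l) y := fun i =>
    differentiableAt_pderiv hl
  have hdΓ : ∀ a k i j, pderiv a (christoffel G k i j) y =
      kron j k * pderiv a (pderiv i l) y
      + kron i k * pderiv a (pderiv j l) y
      - kron i j * pderiv a (pderiv k l) y := by
    intro a k i j
    rw [pderiv_congr (hΓ k i j), pderiv_sub (((hdl i).const_mul _).fun_add ((hdl j).const_mul _))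
      ((hdl k).const_mul _), pderiv_add ((hdl i).const_mul _) ((hdl j).const_mul _),
      pderiv_const_mul _ (hdl i), pderiv_const_mul _ (hdl j), pderiv_const_mul _ (hdl k)]
  have hinv : (G y)⁻¹ = (Real.exp (2 * l y))⁻¹ • (1 : Matrix (Fin n) (Fin n) ℝ) := by
    rw [hG.eq_of_nhds]
    apply Matrix.inv_eq_right_inv
    rw [smul_mul_smul_comm, mul_inv_cancel₀ (Real.exp_pos _).ne']; simp
  have htr : scalarCoord G y = (Real.exp (2 * l y))⁻¹ * ∑ i, ricciCoord G i i y := by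
    simp only [scalarCoord, hinv, Matrix.smul_apply, smul_eq_mul, Finset.mul_sum]
    refine Finset.sum_congr rfl fun i _ => ?_
    rw [Finset.sum_eq_single i]
    · simp
    · intro b _ hb; rw [Matrix.one_apply_ne hb.symm]; ring
    · simp
  rw [htr]
  congr 1
  simp only [ricciCoord, hdΓ, fun k i j => (hΓ k i j).eq_of_nhds]
  rw [Finset.sum_add_distrib]
  -- The trace of Ricci splits into a part linear in second derivatives, computed here, and a part
  -- quadratic in first derivatives, computed in `h2`.
  have h1 : ∑ i, ∑ k, (kron i k * pderiv k (pderiv i l) y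
      + kron i k * pderiv k (pderiv i l) y
      - kron i i * pderiv k (pderiv k l) y
      - (kron k k * pderiv i (pderiv i l) y
        + kron i k * pderiv i (pderiv k l) y
        - kron i k * pderiv i (pderiv k l) y))
      = -(2 * ((n : ℝ) - 1)) * lap l y := by
    simp only [kron, Finset.sum_add_distrib, Finset.sum_sub_distrib, ite_mul,
      one_mul, zero_mul, Finset.sum_ite_eq, Finset.mem_univ, if_true, Finset.sum_const,
      Finset.card_univ, Fintype.card_fin, nsmul_eq_mul, lap, ← Finset.mul_sum]
    ring
  have h2 : ∑ i, ∑ k, ∑ m, ((kron m k * pderiv k l y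
      + kron k k * pderiv m l y
      - kron k m * pderiv k l y)
      * (kron i m * pderiv i l y
      + kron i m * pderiv i l y
      - kron i i * pderiv m l y)
      - (kron m k * pderiv i l y
      + kron i k * pderiv m l y
      - kron i m * pderiv k l y)
      * (kron k m * pderiv i l y
      + kron i m * pderiv k l y
      - kron i k * pderiv m l y))
      = -(((n : ℝ) - 2) * ((n : ℝ) - 1) * gradSq l y) := by
    have hexp : ∀ i k m : Fin n, ((kron m k * pderiv k l y
      + kron k k * pderiv m l y
      - kron k m * pderiv k l y)
      * (kron i m * pderiv i l y
      + kron i m * pderiv i l y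
      - kron i i * pderiv m l y)
      - (kron m k * pderiv i l y
      + kron i k * pderiv m l y
      - kron i m * pderiv k l y)
      * (kron k m * pderiv i l y
      + kron i m * pderiv k l y
      - kron i k * pderiv m l y))
      = 2 * (if i = m then pderiv m l y ^ 2 else 0) - pderiv m l y ^ 2
        - (if k = m then pderiv i l y ^ 2 else 0)
        + (if i = k then pderiv m l y ^ 2 else 0) + (if i = m then pderiv k l y ^ 2 else 0)
        - 2 * (if i = k then (if i = m then pderiv m l y ^ 2 else 0) else 0) := by
      intro i k m
      simp only [kron, eq_comm (a := m) (b := k)]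
      by_cases h1 : k = m
      · subst h1
        by_cases h2 : i = k
        · subst h2; simp
        · simp [h2]; ring
      · by_cases h2 : i = k
        · subst h2; simp [h1]
        · by_cases h3 : i = m
          · subst h3; simp [h1, h2]; ring
          · simp [h1, h2, h3]; ring
    simp only [hexp]
    simp only [Finset.sum_add_distrib, Finset.sum_sub_distrib, ← Finset.mul_sum,
      Finset.sum_ite_eq, Finset.mem_univ, if_true, Finset.sum_const,
      Finset.card_univ, Fintype.card_fin, nsmul_eq_mul, gradSq]
    have e1 : ∀ i k : Fin n, (∑ m, if i = k then pderiv m l y ^ 2 else 0)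
        = if i = k then ∑ m, pderiv m l y ^ 2 else 0 := by
      intro i k; split_ifs <;> simp
    have e2 : ∀ i k : Fin n,
        (∑ m, if i = k then (if i = m then pderiv m l y ^ 2 else 0) else 0)
        = if i = k then pderiv i l y ^ 2 else 0 := by
      intro i k; split_ifs <;> simp
    simp only [e1, e2, Finset.sum_ite_eq, Finset.mem_univ, if_true, Finset.sum_const,
      Finset.card_univ, Fintype.card_fin, nsmul_eq_mul]
    ring
  rw [sub_eq_add_neg, ← h1, ← h2]

/-- The scalar curvature of `u^{4/(n-2)} δ` is `-(4(n-1)/(n-2)) u^{-(n+2)/(n-2)} Δu`. -/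
lemma scalarCoord_conformal (hn : 3 ≤ n) {u : Euc n → ℝ} (hu : ContDiffAt ℝ 2 u y) (h0 : 0 < u y)
    (hG : G =ᶠ[𝓝 y] fun z => (u z ^ (4 / ((n : ℝ) - 2))) • (1 : Matrix (Fin n) (Fin n) ℝ)) :
    scalarCoord G y = -((u y ^ (4 / ((n : ℝ) - 2)))⁻¹ *
      (4 * ((n : ℝ) - 1) / ((n : ℝ) - 2)) * (u y)⁻¹ * lap u y) := by
  have hn2 : (0 : ℝ) < (n : ℝ) - 2 := by
    have : (3 : ℝ) ≤ n := by exact_mod_cast hn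
    linarith
  have hpos : ∀ᶠ z in 𝓝 y, 0 < u z := hu.continuousAt.eventually (lt_mem_nhds h0)
  -- With this logarithm, the term `|∇u|²` coming from `Δ log u` cancels against the one coming from
  -- `|∇l|²`; only `Δu` remains.
  set l : Euc n → ℝ := fun z => (2 / ((n : ℝ) - 2)) * Real.log (u z) with hl_def
  have hlog : ContDiffAt ℝ 2 (fun z => Real.log (u z)) y := hu.log h0.ne'
  have hl : ContDiffAt ℝ 2 l y := contDiffAt_const.mul hlog
  have hexp : ∀ z, 0 < u z → Real.exp (2 * l z) = u z ^ (4 / ((n : ℝ) - 2)) := by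
    intro z hz
    rw [Real.rpow_def_of_pos hz]; congr 1; simp only [hl_def]; ring
  have hG' : G =ᶠ[𝓝 y] fun z => Real.exp (2 * l z) • (1 : Matrix (Fin n) (Fin n) ℝ) := by
    filter_upwards [hG, hpos] with z h1 h2
    rw [h1, hexp z h2]
  have hlap : lap (fun z => Real.log (u z)) y
      = (u y)⁻¹ * lap u y + (-(u y ^ 2)⁻¹) * gradSq u y :=
    lap_comp (φ := Real.log) (φ' := fun t => t⁻¹)
      ((lt_mem_nhds h0).mono fun t ht => Real.hasDerivAt_log (ne_of_gt ht))
      (hasDerivAt_inv h0.ne') hu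
  have hgrad : gradSq l y = (2 / ((n : ℝ) - 2)) ^ 2 * (u y ^ 2)⁻¹ * gradSq u y := by
    simp only [gradSq, Finset.mul_sum]
    refine Finset.sum_congr rfl fun i _ => ?_
    rw [pderiv_const_mul _ (differentiableAt_of_contDiffAt hlog),
      pderiv_comp (Real.hasDerivAt_log h0.ne') (differentiableAt_of_contDiffAt hu)]
    field_simp
  rw [scalarCoord_exp hl hG', lap_const_mul _ hlog, hlap, hgrad, hexp y h0]
  field_simp
  ring

end ConformallyFlat

/-! ### Harmonic functions in an exterior domain -/

section Harmonic

variable {n : ℕ} {f : Euc n → ℝ} {y : Euc n}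

/-- Restrict to the coordinate line through `y`. A positive second derivative would make the local
maximum also a local minimum, so the restriction would be locally constant and its second derivative
zero. -/
lemma pderiv_pderiv_nonpos_of_isLocalMax (hf : ContDiffAt ℝ 2 f y) (h : IsLocalMax f y)
    (i : Fin n) : pderiv i (pderiv i f) y ≤ 0 := by
  set e := basisVec n i
  have hline : ∀ t : ℝ, HasDerivAt (fun t : ℝ => y + t • e) e t := fun t => by
    simpa using ((hasDerivAt_id t).smul_const e).const_add y
  have hc : ContinuousAt (fun t : ℝ => y + t • e) 0 := (hline 0).continuousAt
  have htend : Tendsto (fun t : ℝ => y + t • e) (𝓝 0) (𝓝 y) := by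
    simpa using hc.tendsto
  set γ : ℝ → ℝ := fun t => f (y + t • e) with hγ
  have hd : ∀ᶠ t in 𝓝 (0 : ℝ), HasDerivAt γ (pderiv i f (y + t • e)) t := by
    filter_upwards [htend.eventually (eventually_contDiffAt hf)] with t ht
    exact (differentiableAt_of_contDiffAt ht).hasFDerivAt.comp_hasDerivAt t (hline t)
  have hd1 : deriv γ =ᶠ[𝓝 0] fun t => pderiv i f (y + t • e) := hd.mono fun t ht => ht.deriv
  have hd2 : deriv (deriv γ) 0 = pderiv i (pderiv i f) y := by
    rw [hd1.deriv_eq]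
    have hg : HasFDerivAt (pderiv i f) (fderiv ℝ (pderiv i f) y) (y + (0 : ℝ) • e) := by
      simpa using (differentiableAt_pderiv (i := i) hf).hasFDerivAt
    exact (hg.comp_hasDerivAt 0 (hline 0)).deriv
  have hmax : IsLocalMax γ 0 := by
    have : ∀ᶠ t in 𝓝 (0 : ℝ), f (y + t • e) ≤ f y := htend.eventually h
    simpa [IsLocalMax, IsMaxFilter, hγ] using this
  by_contra! hpos
  have hmin : IsLocalMin γ 0 :=
    isLocalMin_of_deriv_deriv_pos (by rw [hd2]; exact hpos) hmax.deriv_eq_zero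
      hd.self_of_nhds.continuousAt
  have hcst : γ =ᶠ[𝓝 0] fun _ => γ 0 := by
    filter_upwards [hmax, hmin] with t h1 h2 using le_antisymm h1 h2
  have h3 : deriv γ =ᶠ[𝓝 0] fun _ => 0 :=
    hcst.eventuallyEq_nhds.mono fun t ht => by rw [ht.deriv_eq]; simp
  rw [← hd2, h3.deriv_eq] at hpos
  simp at hpos

lemma lap_nonpos_of_isLocalMax (hf : ContDiffAt ℝ 2 f y) (h : IsLocalMax f y) : lap f y ≤ 0 :=
  Finset.sum_nonpos fun i _ => pderiv_pderiv_nonpos_of_isLocalMax hf h i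

lemma pderiv_inner (i : Fin n) (e : Euc n) :
    pderiv i (fun z => inner ℝ e z) y = e i := by
  have h : HasFDerivAt (fun z => inner ℝ e z) (innerSL ℝ e) y := (innerSL ℝ e).hasFDerivAt
  simp only [pderiv, h.fderiv, basisVec]
  simp [EuclideanSpace.inner_single_right]

lemma pderiv_normSq (i : Fin n) : pderiv i (fun z : Euc n => ‖z‖ ^ 2) y = 2 * y i := by
  have h : HasFDerivAt (fun z : Euc n => ‖z‖ ^ 2) (2 • innerSL ℝ y) y :=
    (hasStrictFDerivAt_norm_sq y).hasFDerivAt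
  simp only [pderiv, h.fderiv, basisVec]
  simp [EuclideanSpace.inner_single_right]

lemma contDiff_normSq : ContDiff ℝ ∞ (fun z : Euc n => ‖z‖ ^ 2) := contDiff_norm_sq ℝ

lemma lap_inner (e : Euc n) : lap (fun z => inner ℝ e z) y = 0 := by
  refine Finset.sum_eq_zero fun i _ => ?_
  have : pderiv i (fun z : Euc n => inner ℝ e z) = fun _ => e i := funext fun z => pderiv_inner i e
  rw [this, pderiv_const]

lemma lap_normSq : lap (fun z : Euc n => ‖z‖ ^ 2) y = 2 * n := by
  have h : ∀ i : Fin n, pderiv i (pderiv i (fun z : Euc n => ‖z‖ ^ 2)) y = 2 := by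
    intro i
    have : pderiv i (fun z : Euc n => ‖z‖ ^ 2) = fun z => 2 * inner ℝ (basisVec n i) z := by
      funext z
      rw [pderiv_normSq, basisVec]; simp [EuclideanSpace.inner_single_left]
    have hd : DifferentiableAt ℝ (fun z => inner ℝ (basisVec n i) z) y :=
      (innerSL ℝ (basisVec n i)).differentiableAt
    rw [this, pderiv_const_mul _ hd, pderiv_inner]
    simp [basisVec]
  simp [lap, h, mul_comm]

lemma gradSq_normSq : gradSq (fun z : Euc n => ‖z‖ ^ 2) y = 4 * ‖y‖ ^ 2 := by
  simp only [gradSq, pderiv_normSq]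
  rw [EuclideanSpace.real_norm_sq_eq, Finset.mul_sum]
  exact Finset.sum_congr rfl fun i _ => by ring

/-- The Laplacian is invariant under linear isometries. -/
lemma lap_comp_isometry (R : Euc n ≃ₗᵢ[ℝ] Euc n) (hf : ContDiffAt ℝ 2 f (R y)) :
    lap (fun z => f (R z)) y = lap f (R y) := by
  have key : ∀ (A : Euc n ≃ₗᵢ[ℝ] Euc n) (x : Euc n), ContDiffAt ℝ 2 f (A x) →
      lap (fun z => f (A z)) x = ∑ i, fderiv ℝ (fderiv ℝ f) (A x) (A (basisVec n i))
        (A (basisVec n i)) := by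
    intro A x hA
    refine Finset.sum_congr rfl fun i _ => ?_
    have h1 : pderiv i (fun z => f (A z)) = fun z => fderiv ℝ f (A z) (A (basisVec n i)) := by
      funext z
      have := A.toContinuousLinearEquiv.comp_right_fderiv (f := f) (x := z)
      have h2 : fderiv ℝ (fun z => f (A z)) z
        = (fderiv ℝ f (A z)).comp (A.toContinuousLinearEquiv : Euc n →L[ℝ] Euc n) := this
      simp [pderiv, h2]
    rw [h1]
    have h2 : DifferentiableAt ℝ (fderiv ℝ f) (A x) :=
      (hA.fderiv_right (m := 1) (by norm_num)).differentiableAt (by simp)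
    have h3 : HasFDerivAt (fun z => fderiv ℝ f (A z)) ((fderiv ℝ (fderiv ℝ f) (A x)).comp
        (A.toContinuousLinearEquiv : Euc n →L[ℝ] Euc n)) x :=
      h2.hasFDerivAt.comp x A.toContinuousLinearEquiv.hasFDerivAt
    have h4 := h3.clm_apply (hasFDerivAt_const (A (basisVec n i)) x)
    simp only [pderiv, h4.fderiv]
    simp
  -- The trace of the Hessian may be taken in any orthonormal basis; it is compared in the standard
  -- basis and in its image under `R`.
  have hΔ : ∀ b : OrthonormalBasis (Fin n) ℝ (Euc n), Laplacian.laplacian f (R y)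
      = ∑ i, fderiv ℝ (fderiv ℝ f) (R y) (b i) (b i) := by
    intro b
    rw [InnerProductSpace.laplacian_eq_iteratedFDeriv_orthonormalBasis f b]
    simp [iteratedFDeriv_two_apply]
  have e1 := hΔ ((EuclideanSpace.basisFun (Fin n) ℝ).map R)
  have e2 := hΔ (EuclideanSpace.basisFun (Fin n) ℝ)
  have k1 := key R y hf
  have k2 := key (LinearIsometryEquiv.refl ℝ _) (R y) (by simpa using hf)
  simp only [OrthonormalBasis.map_apply, EuclideanSpace.basisFun_apply] at e1 e2
  simp only [basisVec, LinearIsometryEquiv.coe_refl, id] at k1 k2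
  rw [k1, ← e1, e2, ← k2]

/-- The function `⟨e, y⟩ |y|⁻ⁿ` is harmonic. -/
lemma lap_dipole (e : Euc n) (hy : y ≠ 0) :
    lap (fun z => inner ℝ e z * (‖z‖ ^ 2) ^ (-(n : ℝ) / 2)) y = 0 := by
  have hpos : 0 < ‖y‖ ^ 2 := by positivity
  have hN : ContDiffAt ℝ 2 (fun z : Euc n => ‖z‖ ^ 2) y := (contDiff_norm_sq ℝ).contDiffAt
  have hg : ContDiffAt ℝ 2 (fun z : Euc n => (‖z‖ ^ 2) ^ (-(n : ℝ) / 2)) y :=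
    hN.rpow_const_of_ne hpos.ne'
  have hi : ContDiffAt ℝ 2 (fun z : Euc n => inner ℝ e z) y := (innerSL ℝ e).contDiff.contDiffAt
  -- For a general exponent `a` the Laplacian is `a (2n + 4a) ⟨e, y⟩ |y|^{2(a-1)}`, which vanishes
  -- for this value.
  set a : ℝ := -(n : ℝ) / 2 with ha
  have hφ : ∀ t : ℝ, 0 < t → HasDerivAt (fun t : ℝ => t ^ a) (a * t ^ (a - 1)) t :=
    fun t ht => Real.hasDerivAt_rpow_const (Or.inl ht.ne')
  have hφ' : HasDerivAt (fun t : ℝ => a * t ^ (a - 1))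
      (a * ((a - 1) * (‖y‖ ^ 2) ^ (a - 1 - 1))) (‖y‖ ^ 2) :=
    (Real.hasDerivAt_rpow_const (Or.inl hpos.ne')).const_mul a
  have hl := lap_comp (f := fun z : Euc n => ‖z‖ ^ 2) (φ := fun t => t ^ a)
    ((lt_mem_nhds hpos).mono fun t ht => hφ t ht) hφ' hN
  rw [lap_mul hi hg, hl, lap_inner, lap_normSq, gradSq_normSq]
  have hsum : ∑ i, pderiv i (fun z : Euc n => inner ℝ e z) y *
      pderiv i (fun z : Euc n => (‖z‖ ^ 2) ^ a) y
      = 2 * (a * (‖y‖ ^ 2) ^ (a - 1)) * inner ℝ e y := by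
    simp only [pderiv_inner, fun i => pderiv_comp (i := i) (f := fun z : Euc n => ‖z‖ ^ 2)
      (hφ _ hpos) (differentiableAt_of_contDiffAt hN), pderiv_normSq]
    rw [PiLp.inner_apply, Finset.mul_sum]
    refine Finset.sum_congr rfl fun i _ => ?_
    simp; ring
  have hmul : (‖y‖ ^ 2) ^ (a - 1 - 1) * ‖y‖ ^ 2 = (‖y‖ ^ 2) ^ (a - 1) := by
    conv_lhs => rw [← Real.rpow_one (‖y‖ ^ 2), ← Real.rpow_mul hpos.le, one_mul]
    rw [← Real.rpow_add hpos]; congr 1; ring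
  rw [hsum]
  have : a * ((a - 1) * (‖y‖ ^ 2) ^ (a - 1 - 1)) * (4 * ‖y‖ ^ 2)
      = 4 * a * (a - 1) * (‖y‖ ^ 2) ^ (a - 1) := by rw [← hmul]; ring
  rw [this, ha]
  ring

/-- The weak maximum principle: a subharmonic function on `Ω` which is below every `δ > 0` off some
compact subset of `Ω` is nonpositive. -/
lemma nonpos_of_lap_nonneg (hn : 0 < n) {Ω : Set (Euc n)} (hΩ : IsOpen Ω)
    (hf : ∀ y ∈ Ω, ContDiffAt ℝ 2 f y) (hlap : ∀ y ∈ Ω, 0 ≤ lap f y)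
    (hK : ∀ δ > 0, ∃ K ⊆ Ω, IsCompact K ∧ ∀ y ∈ Ω \ K, f y < δ) : ∀ y ∈ Ω, f y ≤ 0 := by
  intro y₀ hy₀
  by_contra! hpos
  obtain ⟨K, hKΩ, hKc, hout⟩ := hK (f y₀ / 2) (by linarith)
  have hy₀K : y₀ ∈ K := by
    by_contra h
    have := hout y₀ ⟨hy₀, h⟩
    linarith
  obtain ⟨R, hR⟩ := hKc.isBounded.exists_norm_le
  have hR0 : 0 ≤ R := (norm_nonneg _).trans (hR y₀ hy₀K)
  -- Adding `ε|y|²` makes `f` strictly subharmonic. The choice keeps this term below `f y₀ / 4` on a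
  -- neighbourhood of `K`, whereas `f < f y₀ / 2` off `K`; a maximum over `K` is therefore a local
  -- maximum in `Ω`.
  set ε := f y₀ / (4 * (R + 1) ^ 2) with hε
  have hεpos : 0 < ε := by positivity
  have hεR : ε * (R + 1) ^ 2 = f y₀ / 4 := by rw [hε]; field_simp
  have hcont : ContinuousOn (fun y => f y + ε * ‖y‖ ^ 2) K := fun y hy =>
    (((hf y (hKΩ hy)).continuousAt).add (by fun_prop)).continuousWithinAt
  obtain ⟨x, hxK, hx⟩ := hKc.exists_isMaxOn ⟨y₀, hy₀K⟩ hcont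
  have hx' : ∀ y ∈ K, f y + ε * ‖y‖ ^ 2 ≤ f x + ε * ‖x‖ ^ 2 := fun y hy => hx hy
  have hN : ContDiffAt ℝ 2 (fun z : Euc n => ‖z‖ ^ 2) x := (contDiff_norm_sq ℝ).contDiffAt
  have hmax : IsLocalMax (fun y => f y + ε * ‖y‖ ^ 2) x := by
    have hlt : ‖x‖ < R + 1 := by linarith [hR x hxK]
    filter_upwards [hΩ.mem_nhds (hKΩ hxK), (continuous_norm.tendsto x).eventually
      (gt_mem_nhds hlt)] with y hyΩ hyR
    by_cases hyK : y ∈ K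
    · exact hx' y hyK
    · have h1 := hout y ⟨hyΩ, hyK⟩
      have h2 := hx' y₀ hy₀K
      have h3 : ε * ‖y‖ ^ 2 ≤ ε * (R + 1) ^ 2 := by gcongr
      have h4 : 0 ≤ ε * ‖y₀‖ ^ 2 := by positivity
      linarith
  have h1 := lap_nonpos_of_isLocalMax ((hf x (hKΩ hxK)).add (contDiffAt_const.mul hN)) hmax
  rw [lap_add (hf x (hKΩ hxK)) (contDiffAt_const.mul hN), lap_const_mul _ hN, lap_normSq] at h1
  have h2 := hlap x (hKΩ hxK)
  have h3 : 0 < ε * (2 * n) := by positivity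
  linarith

/-- A harmonic function in an exterior domain with a limit at infinity oscillates on the sphere of
radius `r` by at most `O(r^{1-n})`: compare `u - u ∘ R`, with `R` the reflection exchanging the two
points, with a multiple of the dipole on the half-space where the latter is positive. -/
lemma exists_oscillation_le (hn : 0 < n) {u : Euc n → ℝ} {s₀ s a : ℝ} (hs₀ : 0 < s₀) (hs : s₀ < s)
    (hu : ∀ y : Euc n, s₀ < ‖y‖ → ContDiffAt ℝ 2 u y) (hlap : ∀ y : Euc n, s₀ < ‖y‖ → lap u y = 0)
    (hlim : Tendsto u (Bornology.cobounded (Euc n)) (𝓝 a)) :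
    ∃ K : ℝ, 0 ≤ K ∧ ∀ x y : Euc n, ‖x‖ = ‖y‖ → s < ‖x‖ →
      u x - u y ≤ K * (‖x‖ * (‖x‖ ^ 2) ^ (-(n : ℝ) / 2)) := by
  have hspos : 0 < s := hs₀.trans hs
  obtain ⟨C, hC⟩ : ∃ C : ℝ≥0, LipschitzOnWith C u (Metric.sphere (0 : Euc n) s) := by
    refine LocallyLipschitzOn.exists_lipschitzOnWith_of_compact (isCompact_sphere _ _) ?_
    intro x hx
    have hx' : ‖x‖ = s := by simpa using hx
    obtain ⟨K, t, ht, hK⟩ := ((hu x (by linarith)).of_le one_le_two).exists_lipschitzOnWith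
    exact ⟨K, t, mem_nhdsWithin_of_mem_nhds ht, hK⟩
  have hcs : 0 < (s ^ 2) ^ (-(n : ℝ) / 2) := by positivity
  -- On the sphere of radius `s`, the Lipschitz bound `C |z - Rz| = 2C ⟨e, z⟩ / |e|` is then exactly
  -- `(K / |e|)` times the dipole.
  set K : ℝ := 2 * C / (s ^ 2) ^ (-(n : ℝ) / 2) with hK
  refine ⟨K, by positivity, fun x y hxy hx => ?_⟩
  rcases eq_or_ne x y with rfl | hne
  · simp only [sub_self]; positivity
  set e : Euc n := x - y with he
  have he0 : 0 < ‖e‖ := norm_pos_iff.2 (sub_ne_zero.2 hne)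
  set R : Euc n ≃ₗᵢ[ℝ] Euc n := (ℝ ∙ e)ᗮ.reflection with hR
  have hRx : R x = y := Submodule.reflection_sub hxy
  have hRz : ∀ z, z - R z = (2 * (inner ℝ e z / ‖e‖ ^ 2)) • e := by
    intro z
    rw [hR, Submodule.reflection_orthogonal_apply, Submodule.reflection_singleton_apply]
    simp only [two_smul, two_mul, add_smul, RCLike.ofReal_real_eq_id, id]
    module
  have hRn : ∀ z, ‖z - R z‖ = 2 * |inner ℝ e z| / ‖e‖ := by
    intro z
    rw [hRz, norm_smul]
    simp only [Real.norm_eq_abs, abs_mul, abs_div, abs_two, abs_pow, abs_norm]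
    field_simp
  set Ω : Set (Euc n) := {z | s < ‖z‖ ∧ 0 < inner ℝ e z} with hΩ
  set D : Euc n → ℝ := fun z => inner ℝ e z * (‖z‖ ^ 2) ^ (-(n : ℝ) / 2) with hD
  set F : Euc n → ℝ := fun z => (u z - u (R z)) - (K / ‖e‖) * D z with hF
  have hD2 : ∀ z : Euc n, z ≠ 0 → ContDiffAt ℝ 2 D z := by
    intro z hz
    have h0 : ‖z‖ ^ 2 ≠ 0 := by positivity
    have h1 : ContDiffAt ℝ 2 (fun z : Euc n => ‖z‖ ^ 2) z := (contDiff_norm_sq ℝ).contDiffAt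
    exact ((innerSL ℝ e).contDiff.contDiffAt).mul (h1.rpow_const_of_ne h0)
  have hz0 : ∀ z : Euc n, s₀ < ‖z‖ → z ≠ 0 := fun z hz h => by
    rw [h, norm_zero] at hz; linarith
  have huR : ∀ z : Euc n, s₀ < ‖z‖ → ContDiffAt ℝ 2 (fun z => u (R z)) z := by
    intro z hz
    exact (hu (R z) (by simpa using hz)).comp z R.contDiff.contDiffAt
  have hF2 : ∀ z : Euc n, s₀ < ‖z‖ → ContDiffAt ℝ 2 F z := fun z hz =>
    ((hu z hz).sub (huR z hz)).sub (contDiffAt_const.mul (hD2 z (hz0 z hz)))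
  have hFlap : ∀ z : Euc n, s₀ < ‖z‖ → lap F z = 0 := by
    intro z hz
    rw [hF, lap_sub ((hu z hz).sub (huR z hz)) (contDiffAt_const.mul (hD2 z (hz0 z hz))),
      lap_sub (hu z hz) (huR z hz), lap_const_mul _ (hD2 z (hz0 z hz)),
      lap_comp_isometry R (hu (R z) (by simpa using hz)), hlap z hz,
      hlap (R z) (by simpa using hz), hD, lap_dipole e (hz0 z hz)]
    ring
  -- The boundary of `Ω` has two parts: on the sphere the Lipschitz bound applies, and on the
  -- hyperplane `R z = z` and the dipole vanishes.
  have hFbd : ∀ z : Euc n, s ≤ ‖z‖ → 0 ≤ inner ℝ e z → (‖z‖ = s ∨ inner ℝ e z = 0) → F z ≤ 0 := by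
    intro z hz1 hz2 hz3
    rcases hz3 with h | h
    · have h1 := hC.dist_le_mul z (by simpa using h) (R z) (by simpa using h)
      rw [dist_eq_norm z, hRn, abs_of_nonneg hz2, Real.dist_eq] at h1
      have h2 : K / ‖e‖ * D z = C * (2 * inner ℝ e z / ‖e‖) := by
        rw [hK, hD]; simp only [h]; field_simp
      simp only [hF, h2]
      linarith [le_abs_self (u z - u (R z))]
    · have h1 : z = R z := by
        have := hRz z
        rw [h] at this
        simpa [sub_eq_zero] using this
      simp [hF, hD, h, ← h1]
  have hmain : ∀ z ∈ Ω, F z ≤ 0 := by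
    refine nonpos_of_lap_nonneg hn ?_ (fun z hz => hF2 z (hs.trans hz.1))
      (fun z hz => (hFlap z (hs.trans hz.1)).ge) ?_
    · exact (isOpen_lt continuous_const continuous_norm).inter
        (isOpen_lt continuous_const (innerSL ℝ e).continuous)
    intro δ hδ
    -- At infinity `u` and `u ∘ R` have the same limit and the dipole is nonnegative on `Ω`, so `F <
    -- δ` there.
    have hev : ∀ᶠ z in Bornology.cobounded (Euc n), |u z - a| < δ / 2 := by
      have := hlim.eventually (Metric.ball_mem_nhds a (half_pos hδ))
      simpa [Real.dist_eq] using this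
    rw [← comap_norm_atTop, eventually_comap] at hev
    obtain ⟨T, hT⟩ := eventually_atTop.1 hev
    have hT' : ∀ z : Euc n, T ≤ ‖z‖ → |u z - a| < δ / 2 := fun z hz => hT _ hz z rfl
    set A : Set (Euc n) := {z | s ≤ ‖z‖ ∧ ‖z‖ ≤ T ∧ 0 ≤ inner ℝ e z} with hA
    have hAc : IsCompact A := by
      refine (isCompact_closedBall (0 : Euc n) T).of_isClosed_subset ?_ ?_
      · exact (isClosed_le continuous_const continuous_norm).inter
          ((isClosed_le continuous_norm continuous_const).inter
            (isClosed_le continuous_const (innerSL ℝ e).continuous))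
      · intro z hz; simpa using hz.2.1
    refine ⟨A ∩ {z | δ ≤ F z}, ?_, ?_, ?_⟩
    · rintro z ⟨hz, hzδ⟩
      have hzδ' : δ ≤ F z := hzδ
      have hnot : ¬ (‖z‖ = s ∨ inner ℝ e z = 0) := fun h => by
        have := hFbd z hz.1 hz.2.2 h; linarith
      push Not at hnot
      exact ⟨lt_of_le_of_ne hz.1 hnot.1.symm, lt_of_le_of_ne hz.2.2 hnot.2.symm⟩
    · have hFc : ContinuousOn F A := fun z hz =>
        (hF2 z (hs.trans_le hz.1)).continuousAt.continuousWithinAt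
      exact hAc.of_isClosed_subset (hFc.preimage_isClosed_of_isClosed hAc.isClosed isClosed_Ici)
        inter_subset_left
    · rintro z ⟨hz, hzK⟩
      by_cases hzT : ‖z‖ ≤ T
      · by_contra! h
        exact hzK ⟨⟨hz.1.le, hzT, hz.2.le⟩, h⟩
      · push Not at hzT
        have h1 := hT' z hzT.le
        have h2 := hT' (R z) (by simpa using hzT.le)
        have h3 : 0 ≤ K / ‖e‖ * D z := by
          have : 0 ≤ D z := mul_nonneg hz.2.le (by positivity)
          positivity
        simp only [hF]
        rw [abs_lt] at h1 h2
        linarith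
  -- Since `|x| = |y|`, the point `x` lies on the positive side of the hyperplane, and the
  -- comparison may be evaluated at `x`, where `R x = y`.
  have hex : inner ℝ e x = ‖e‖ ^ 2 / 2 := by
    have h1 : ‖y‖ ^ 2 = ‖x‖ ^ 2 - 2 * inner ℝ x e + ‖e‖ ^ 2 := by
      have := norm_sub_sq_real x e
      rwa [he, sub_sub_cancel] at this
    rw [real_inner_comm]
    rw [hxy] at h1
    linarith
  have hfin := hmain x ⟨hx, by rw [hex]; positivity⟩
  simp only [hF, hRx, hD] at hfin
  have hCS : inner ℝ e x ≤ ‖e‖ * ‖x‖ := real_inner_le_norm e x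
  have h5 : K / ‖e‖ * (inner ℝ e x * (‖x‖ ^ 2) ^ (-(n : ℝ) / 2))
      ≤ K / ‖e‖ * ((‖e‖ * ‖x‖) * (‖x‖ ^ 2) ^ (-(n : ℝ) / 2)) := by gcongr
  have h6 : K / ‖e‖ * ((‖e‖ * ‖x‖) * (‖x‖ ^ 2) ^ (-(n : ℝ) / 2))
      = K * (‖x‖ * (‖x‖ ^ 2) ^ (-(n : ℝ) / 2)) := by field_simp
  linarith

end Harmonic

/-! ### Spherical means and the mass -/

section Flux

variable {n : ℕ}

/-- The rotation invariant measure on the unit sphere. -/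
abbrev sphereMeasure (n : ℕ) : Measure (Metric.sphere (0 : Euc n) 1) :=
  (volume : Measure (Euc n)).toSphere

/-- The integral of `f` over the sphere of radius `r`, in the measure of the unit sphere. -/
def sphereInt (f : Euc n → ℝ) (r : ℝ) : ℝ :=
  ∫ w : Metric.sphere (0 : Euc n) 1, f (r • (w : Euc n)) ∂(sphereMeasure n)

lemma norm_smul_sphere {r : ℝ} (hr : 0 ≤ r) (w : Metric.sphere (0 : Euc n) 1) :
    ‖r • (w : Euc n)‖ = r := by
  have : ‖(w : Euc n)‖ = 1 := by simp
  rw [norm_smul, this, Real.norm_of_nonneg hr, mul_one]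

lemma continuous_comp_smul_sphere {f : Euc n → ℝ} {s₀ r : ℝ} (hs₀ : 0 < s₀) (hr : s₀ < r)
    (hf : ∀ y : Euc n, s₀ < ‖y‖ → ContinuousAt f y) :
    Continuous fun w : Metric.sphere (0 : Euc n) 1 => f (r • (w : Euc n)) := by
  rw [continuous_iff_continuousAt]
  intro w
  exact (hf _ (by rwa [norm_smul_sphere (hs₀.trans hr).le])).comp
    (f := fun w : Metric.sphere (0 : Euc n) 1 => r • (w : Euc n)) (by fun_prop)

lemma integrable_of_continuous_sphere {f : Metric.sphere (0 : Euc n) 1 → ℝ} (hf : Continuous f) :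
    Integrable f (sphereMeasure n) :=
  hf.integrable_of_hasCompactSupport (HasCompactSupport.of_compactSpace f)

/-- Differentiation under the integral: `fderiv ℝ f` is bounded on a compact annulus around the
sphere of radius `r`, and this constant dominates. -/
lemma hasDerivAt_sphereInt {f : Euc n → ℝ} {s₀ r : ℝ} (hs₀ : 0 < s₀) (hr : s₀ < r)
    (hf : ∀ y : Euc n, s₀ < ‖y‖ → ContDiffAt ℝ 1 f y) :
    HasDerivAt (sphereInt f)
      (∫ w : Metric.sphere (0 : Euc n) 1, fderiv ℝ f (r • (w : Euc n)) (w : Euc n)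
        ∂(sphereMeasure n)) r := by
  obtain ⟨a, ha0, har⟩ := exists_between hr
  have hf' : ∀ y : Euc n, s₀ < ‖y‖ → ContinuousAt (fderiv ℝ f) y := fun y hy =>
    ((hf y hy).fderiv_right (m := 0) (by norm_num)).continuousAt
  have hannulus : IsCompact {y : Euc n | a ≤ ‖y‖ ∧ ‖y‖ ≤ r + 1} := by
    refine (isCompact_closedBall (0 : Euc n) (r + 1)).of_isClosed_subset
      ((isClosed_le continuous_const continuous_norm).inter
        (isClosed_le continuous_norm continuous_const)) ?_
    intro z hz; simpa using hz.2
  obtain ⟨B, hB⟩ := hannulus.exists_bound_of_continuousOn (f := fderiv ℝ f) fun y hy =>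
    (hf' y (ha0.trans_le hy.1)).continuousWithinAt
  have hpos : 0 < r := hs₀.trans hr
  refine (hasDerivAt_integral_of_dominated_loc_of_deriv_le (μ := sphereMeasure n)
    (s := Ioo a (r + 1)) (bound := fun _ => B)
    (F := fun r w => f (r • (w : Euc n)))
    (F' := fun r w => fderiv ℝ f (r • (w : Euc n)) (w : Euc n))
    (Ioo_mem_nhds har (by linarith)) ?_ ?_ ?_ ?_ (integrable_const _) ?_).2
  · filter_upwards [lt_mem_nhds hr] with t ht
    exact (continuous_comp_smul_sphere hs₀ ht fun y hy =>
      (hf y hy).continuousAt).aestronglyMeasurable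
  · exact integrable_of_continuous_sphere
      (continuous_comp_smul_sphere hs₀ hr fun y hy => (hf y hy).continuousAt)
  · refine Continuous.aestronglyMeasurable ?_
    refine Continuous.clm_apply ?_ continuous_subtype_val
    rw [continuous_iff_continuousAt]
    intro w
    exact (hf' _ (by rwa [norm_smul_sphere hpos.le])).comp
      (f := fun w : Metric.sphere (0 : Euc n) 1 => r • (w : Euc n)) (by fun_prop)
  · refine Eventually.of_forall fun w t ht => ?_
    have ht0 : 0 ≤ t := (hs₀.trans (ha0.trans ht.1)).le
    have h1 := (fderiv ℝ f (t • (w : Euc n))).le_opNorm (w : Euc n)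
    have h2 : ‖(w : Euc n)‖ = 1 := by simp
    rw [h2, mul_one] at h1
    refine h1.trans (hB _ ?_)
    rw [mem_ofPred_eq, norm_smul_sphere ht0]
    exact ⟨ht.1.le, ht.2.le⟩
  · refine Eventually.of_forall fun w t ht => ?_
    have ht0 : 0 ≤ t := (hs₀.trans (ha0.trans ht.1)).le
    have h1 : HasFDerivAt f (fderiv ℝ f (t • (w : Euc n))) (t • (w : Euc n)) :=
      ((hf _ (by rw [norm_smul_sphere ht0]; exact ha0.trans ht.1)).differentiableAt
        (by simp)).hasFDerivAt
    have h2 : HasDerivAt (fun t : ℝ => t • (w : Euc n)) (w : Euc n) t := by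
      simpa using (hasDerivAt_id t).smul_const (w : Euc n)
    exact h1.comp_hasDerivAt t h2

lemma tendsto_sphereInt {f : Euc n → ℝ} {s₀ a : ℝ} (hs₀ : 0 < s₀)
    (hf : ∀ y : Euc n, s₀ < ‖y‖ → ContinuousAt f y)
    (hlim : Tendsto f (Bornology.cobounded (Euc n)) (𝓝 a)) :
    Tendsto (sphereInt f) atTop (𝓝 (a * (sphereMeasure n).real univ)) := by
  set A := (sphereMeasure n).real univ
  have hA : 0 ≤ A := measureReal_nonneg
  rw [Metric.tendsto_atTop]
  intro ε hε
  have hev := hlim.eventually (Metric.ball_mem_nhds a (ε := ε / (A + 1)) (by positivity))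
  rw [← comap_norm_atTop, eventually_comap] at hev
  obtain ⟨T, hT⟩ := eventually_atTop.1 hev
  refine ⟨max T (s₀ + 1), fun r hr => ?_⟩
  have hr1 : T ≤ r := (le_max_left _ _).trans hr
  have hr2 : s₀ < r := by linarith [(le_max_right T (s₀ + 1)).trans hr]
  have hr0 : 0 ≤ r := (hs₀.trans hr2).le
  have hsub : sphereInt f r - a * A
      = ∫ w : Metric.sphere (0 : Euc n) 1, (f (r • (w : Euc n)) - a) ∂(sphereMeasure n) := by
    rw [integral_sub (integrable_of_continuous_sphere
      (continuous_comp_smul_sphere hs₀ hr2 hf)) (integrable_const _)]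
    simp [sphereInt, A, mul_comm]
  rw [Real.dist_eq, hsub, ← Real.norm_eq_abs]
  have hbd := norm_integral_le_of_norm_le_const (μ := sphereMeasure n) (C := ε / (A + 1))
    (f := fun w : Metric.sphere (0 : Euc n) 1 => f (r • (w : Euc n)) - a)
    (Eventually.of_forall fun w => by
      have := hT r hr1 (r • (w : Euc n)) (norm_smul_sphere hr0 w)
      rw [Real.dist_eq] at this
      exact this.le)
  refine hbd.trans_lt ?_
  have : ε / (A + 1) * A < ε / (A + 1) * (A + 1) := by
    have : 0 < ε / (A + 1) := by positivity
    nlinarith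
  rwa [div_mul_cancel₀ _ (by positivity)] at this

lemma rpow_natCast_sub_one (hn : 1 ≤ n) {r : ℝ} : r ^ (n - 1) = r ^ ((n : ℝ) - 1) := by
  rw [← Real.rpow_natCast, Nat.cast_sub hn, Nat.cast_one]

/-- If the flux of `f` through large spheres is bounded below by a positive constant, then the
spherical means of `f` lie below their limit by at least a multiple of `r^{2-n}`. -/
lemma sphereInt_le_of_flux (hn : 3 ≤ n) {f : Euc n → ℝ} {s₀ a ℓ : ℝ} (hs₀ : 0 < s₀)
    (hf : ∀ y : Euc n, s₀ < ‖y‖ → ContDiffAt ℝ 1 f y)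
    (hlim : Tendsto f (Bornology.cobounded (Euc n)) (𝓝 a))
    (hℓ : 0 < ℓ) (hflux : ∀ᶠ r in atTop, ℓ ≤ r ^ (n - 1) *
      ∫ w : Metric.sphere (0 : Euc n) 1, fderiv ℝ f (r • (w : Euc n)) (w : Euc n)
        ∂(sphereMeasure n)) :
    ∀ᶠ r in atTop, sphereInt f r ≤
      a * (sphereMeasure n).real univ - ℓ / ((n : ℝ) - 2) * r ^ (2 - (n : ℝ)) := by
  have hn2 : (0 : ℝ) < (n : ℝ) - 2 := by
    have : (3 : ℝ) ≤ n := by exact_mod_cast hn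
    linarith
  obtain ⟨T, hT⟩ := eventually_atTop.1 (hflux.and (eventually_gt_atTop s₀))
  -- The added term has derivative `-ℓ r^{1-n}`, which the flux bound compensates. So `Ψ` is
  -- nondecreasing for large `r` and lies below its limit, to which the added term contributes
  -- nothing.
  set Ψ : ℝ → ℝ := fun r => sphereInt f r + ℓ / ((n : ℝ) - 2) * r ^ (2 - (n : ℝ)) with hΨ
  have hder : ∀ r, T ≤ r → ∃ d, HasDerivAt Ψ d r ∧ 0 ≤ d := by
    intro r hr
    obtain ⟨h1, h2⟩ := hT r hr
    have hr0 : 0 < r := hs₀.trans h2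
    have h3 := hasDerivAt_sphereInt hs₀ h2 hf
    have h4 : HasDerivAt (fun r : ℝ => ℓ / ((n : ℝ) - 2) * r ^ (2 - (n : ℝ)))
        (ℓ / ((n : ℝ) - 2) * ((2 - (n : ℝ)) * r ^ (2 - (n : ℝ) - 1))) r :=
      (Real.hasDerivAt_rpow_const (Or.inl hr0.ne')).const_mul _
    refine ⟨_, h3.add h4, ?_⟩
    have h5 : ℓ / ((n : ℝ) - 2) * ((2 - (n : ℝ)) * r ^ (2 - (n : ℝ) - 1))
        = -(ℓ * (r ^ (n - 1))⁻¹) := by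
      rw [rpow_natCast_sub_one (by omega), ← Real.rpow_neg hr0.le,
        show (2 - (n : ℝ) - 1) = -((n : ℝ) - 1) by ring]
      field_simp
      ring
    rw [h5]
    have hp : 0 < r ^ (n - 1) := by positivity
    have h6 := (div_le_iff₀' hp).2 h1
    rw [div_eq_mul_inv] at h6
    linarith
  have hmono : MonotoneOn Ψ (Ici T) := by
    refine monotoneOn_of_deriv_nonneg (convex_Ici T) (fun r hr => ?_) (fun r hr => ?_) fun r hr => ?_
    · obtain ⟨d, h, -⟩ := hder r hr
      exact h.continuousAt.continuousWithinAt
    · obtain ⟨d, h, -⟩ := hder r (interior_subset hr)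
      exact h.differentiableAt.differentiableWithinAt
    · obtain ⟨d, h, h'⟩ := hder r (interior_subset hr)
      rwa [h.deriv]
  have hlimΨ : Tendsto Ψ atTop (𝓝 (a * (sphereMeasure n).real univ)) := by
    have h1 := tendsto_sphereInt hs₀ (fun y hy => (hf y hy).continuousAt) hlim
    have h2 : Tendsto (fun r : ℝ => r ^ (2 - (n : ℝ))) atTop (𝓝 0) := by
      have := tendsto_rpow_neg_atTop hn2
      simpa using this
    have h3 := h1.add (h2.const_mul (ℓ / ((n : ℝ) - 2)))
    simpa [hΨ] using h3
  filter_upwards [eventually_ge_atTop T] with r hr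
  have : Ψ r ≤ a * (sphereMeasure n).real univ := by
    refine ge_of_tendsto hlimΨ ?_
    filter_upwards [eventually_ge_atTop r] with R hR
    exact hmono hr (hr.trans hR : T ≤ R) hR
  simp only [hΨ] at this
  linarith

/-- Bernoulli's inequality for `p ≥ 1`, and `(1 - δ)^p ≥ 1 - δ` for `p ≤ 1`; the factor `p + 1`
covers both cases. -/
lemma one_sub_le_rpow {δ p : ℝ} (hδ0 : 0 ≤ δ) (hδ1 : δ < 1) (hp : 0 < p) :
    1 - (p + 1) * δ ≤ (1 - δ) ^ p := by
  rcases le_total 1 p with h | h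
  · have := one_add_mul_self_le_rpow_one_add (s := -δ) (by linarith) h
    rw [← sub_eq_add_neg] at this
    nlinarith
  · have := Real.rpow_le_rpow_of_exponent_ge (x := 1 - δ) (by linarith) (by linarith) h
    rw [Real.rpow_one] at this
    nlinarith

/-- A harmonic function near infinity with limit `1` such that `u^p` has positive flux at infinity
is `< 1` near infinity. -/
lemma eventually_lt_one_of_flux (hn : 3 ≤ n) {u : Euc n → ℝ} {s₀ ℓ p : ℝ} (hs₀ : 0 < s₀)
    (hp : 0 < p) (hpos : ∀ y : Euc n, s₀ < ‖y‖ → 0 < u y)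
    (hu : ∀ y : Euc n, s₀ < ‖y‖ → ContDiffAt ℝ 2 u y) (hlap : ∀ y : Euc n, s₀ < ‖y‖ → lap u y = 0)
    (hlim : Tendsto u (Bornology.cobounded (Euc n)) (𝓝 1))
    (hℓ : 0 < ℓ) (hflux : ∀ᶠ r in atTop, ℓ ≤ r ^ (n - 1) *
      ∫ w : Metric.sphere (0 : Euc n) 1, fderiv ℝ (fun y => u y ^ p) (r • (w : Euc n)) (w : Euc n)
        ∂(sphereMeasure n)) :
    ∀ᶠ r in atTop, ∀ x : Euc n, ‖x‖ = r → u x < 1 := by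
  have hn2 : (0 : ℝ) < (n : ℝ) - 2 := by
    have : (3 : ℝ) ≤ n := by exact_mod_cast hn
    linarith
  have hf : ∀ y : Euc n, s₀ < ‖y‖ → ContDiffAt ℝ 1 (fun y => u y ^ p) y := fun y hy =>
    ((hu y hy).of_le one_le_two).rpow_const_of_ne (hpos y hy).ne'
  have hflim : Tendsto (fun y => u y ^ p) (Bornology.cobounded (Euc n)) (𝓝 1) := by
    simpa using hlim.rpow_const (p := p) (Or.inl one_ne_zero)
  have hmean := sphereInt_le_of_flux hn hs₀ hf hflim hℓ hflux
  obtain ⟨K, hK0, hK⟩ := exists_oscillation_le (by omega) hs₀ (lt_add_one s₀) hu hlap hlim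
  set A := (sphereMeasure n).real univ
  have hA : 0 ≤ A := measureReal_nonneg
  have hδlim : Tendsto (fun r : ℝ => K * r ^ (1 - (n : ℝ))) atTop (𝓝 0) := by
    have := (tendsto_rpow_neg_atTop (y := (n : ℝ) - 1) (by linarith)).const_mul K
    simpa using this
  filter_upwards [hmean, hδlim.eventually (gt_mem_nhds one_pos), eventually_gt_atTop (s₀ + 1),
    eventually_gt_atTop ((p + 1) * K * A * ((n : ℝ) - 2) / ℓ)] with r h1 h2 h3 h4 x hx
  -- One value `u x ≥ 1` forces `u ≥ 1 - δ` on the whole sphere with `δ = K r^{1-n}`, so the mean of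
  -- `u^p` misses `1` by `O(r^{1-n})` only. This contradicts a deficit of order `r^{2-n}` once `r`
  -- exceeds the last threshold of the filter.
  by_contra! hx1
  have hr0 : 0 < r := by linarith
  set δ := K * r ^ (1 - (n : ℝ)) with hδ
  have hδ0 : 0 ≤ δ := by positivity
  have hlow : ∀ y : Euc n, ‖y‖ = r → 1 - (p + 1) * δ ≤ u y ^ p := by
    intro y hy
    have h5 := hK x y (by rw [hx, hy]) (by rw [hx]; exact h3)
    have h6 : ‖x‖ * (‖x‖ ^ 2) ^ (-(n : ℝ) / 2) = r ^ (1 - (n : ℝ)) := by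
      rw [hx, ← Real.rpow_natCast, ← Real.rpow_mul hr0.le]
      conv_lhs => rw [← Real.rpow_one r, ← Real.rpow_mul hr0.le, one_mul, ← Real.rpow_add hr0]
      congr 1; push_cast; ring
    rw [h6, ← hδ] at h5
    refine (one_sub_le_rpow hδ0 h2 hp).trans (Real.rpow_le_rpow (by linarith) (by linarith) hp.le)
  have hint : (1 - (p + 1) * δ) * A ≤ sphereInt (fun y => u y ^ p) r := by
    have h7 : ∫ _ : Metric.sphere (0 : Euc n) 1, (1 - (p + 1) * δ) ∂(sphereMeasure n)
        ≤ sphereInt (fun y => u y ^ p) r := by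
      refine integral_mono (integrable_const _) (integrable_of_continuous_sphere
        (continuous_comp_smul_sphere hs₀ (by linarith) fun y hy => (hf y hy).continuousAt)) ?_
      intro w
      exact hlow _ (norm_smul_sphere hr0.le w)
    simpa [A, mul_comm] using h7
  have h8 : ℓ / ((n : ℝ) - 2) * r ^ (2 - (n : ℝ)) ≤ (p + 1) * δ * A := by linarith
  have h9 : r ^ (2 - (n : ℝ)) = r * r ^ (1 - (n : ℝ)) := by
    conv_rhs => rw [← Real.rpow_one r, ← Real.rpow_mul hr0.le, one_mul, ← Real.rpow_add hr0]
    congr 1; ring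
  have hq : 0 < r ^ (1 - (n : ℝ)) := by positivity
  rw [h9, hδ] at h8
  have h10 : ℓ / ((n : ℝ) - 2) * r ≤ (p + 1) * K * A := by
    refine le_of_mul_le_mul_right ?_ hq
    linarith
  rw [div_lt_iff₀ hℓ] at h4
  rw [div_mul_eq_mul_div, div_le_iff₀ hn2] at h10
  linarith

end Flux

/-! ### Flattening a harmonic function below its limit -/

section Flattening

variable {n : ℕ}

lemma two_le_infty : (2 : WithTop ℕ∞) ≤ ∞ := WithTop.coe_le_coe.2 le_top

/-- A smooth concave function which is the identity on `(-∞, -η]` and constant on `[η, ∞)`. -/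
lemma exists_concave_cutoff {η : ℝ} (hη : 0 < η) :
    ∃ (χ χ' χ'' : ℝ → ℝ) (k : ℝ), ContDiff ℝ ∞ χ ∧ (∀ t, HasDerivAt χ (χ' t) t) ∧
      (∀ t, HasDerivAt χ' (χ'' t) t) ∧ (∀ t, 0 ≤ χ' t) ∧ (∀ t, χ' t ≤ 1) ∧ (∀ t, χ'' t ≤ 0) ∧
      (∀ t ≤ -η, χ t = t) ∧ (∀ t ≥ η, χ t = k) ∧ (∀ t ≥ η, χ' t = 0) ∧ ∀ t ≥ -η, -η ≤ χ t := by
  set θ : ℝ → ℝ := fun t => 1 - Real.smoothTransition ((t + η) / (2 * η)) with hθ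
  have hθs : ContDiff ℝ ∞ θ :=
    contDiff_const.sub (Real.smoothTransition.contDiff.comp (by fun_prop))
  have hθc : Continuous θ := hθs.continuous
  have hθ0 : ∀ t, 0 ≤ θ t := fun t => sub_nonneg.2 (Real.smoothTransition.le_one _)
  have hθ1 : ∀ t, θ t ≤ 1 := fun t => by
    have := Real.smoothTransition.nonneg ((t + η) / (2 * η))
    simp only [hθ]; linarith
  have hθanti : Antitone θ := fun a b hab => by
    have := Real.smoothTransition.monotone (show (a + η) / (2 * η) ≤ (b + η) / (2 * η) by gcongr)
    simp only [hθ]; linarith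
  have hθleft : ∀ t ≤ -η, θ t = 1 := fun t ht => by
    have : (t + η) / (2 * η) ≤ 0 := div_nonpos_of_nonpos_of_nonneg (by linarith) (by linarith)
    simp [hθ, Real.smoothTransition.zero_of_nonpos this]
  have hθright : ∀ t ≥ η, θ t = 0 := fun t ht => by
    have : 1 ≤ (t + η) / (2 * η) := by rw [le_div_iff₀ (by linarith)]; linarith
    simp [hθ, Real.smoothTransition.one_of_one_le this]
  -- The primitive of a slope falling from `1` to `0` across `[-η, η]`, normalised by `χ (-η) = -η`;
  -- it is concave because `θ` is antitone.
  set χ : ℝ → ℝ := fun t => (∫ τ in (-η)..t, θ τ) - η with hχ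
  have hχd : ∀ t, HasDerivAt χ (θ t) t := fun t =>
    (hθc.integral_hasStrictDerivAt (-η) t).hasDerivAt.sub_const η
  have hderiv : deriv χ = θ := funext fun t => (hχd t).deriv
  refine ⟨χ, θ, deriv θ, χ η, ?_, hχd, fun t => ?_, hθ0, hθ1, fun t => hθanti.deriv_nonpos, ?_, ?_,
    hθright, ?_⟩
  · rw [contDiff_infty_iff_deriv, hderiv]
    exact ⟨fun t => (hχd t).differentiableAt, hθs⟩
  · exact (hθs.differentiable (by simp) t).hasDerivAt
  · intro t ht
    have : ∫ τ in (-η)..t, θ τ = ∫ τ in (-η)..t, (1 : ℝ) := by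
      refine intervalIntegral.integral_congr fun τ hτ => ?_
      rw [uIcc_of_ge ht] at hτ
      exact hθleft τ hτ.2
    simp only [hχ, this]
    simp
  · intro t ht
    have h1 : ∫ τ in η..t, θ τ = 0 := by
      have : ∫ τ in η..t, θ τ = ∫ τ in η..t, (0 : ℝ) := by
        refine intervalIntegral.integral_congr fun τ hτ => ?_
        rw [uIcc_of_le ht] at hτ
        exact hθright τ hτ.1
      rw [this]; simp
    have h2 := intervalIntegral.integral_add_adjacent_intervals (hθc.intervalIntegrable (-η) η)
      (hθc.intervalIntegrable (μ := volume) η t)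
    simp only [hχ]
    rw [← h2, h1, add_zero]
  · intro t ht
    have := intervalIntegral.integral_nonneg (μ := volume) (f := θ) ht fun τ _ => hθ0 τ
    simp only [hχ]
    linarith

/-- A smooth radial function on `|y| > s₀`, vanishing exactly for `|y| ≥ s₃` and strictly
subharmonic for `|y| < s₃`. -/
lemma exists_radial_subharmonic {s₀ s₃ : ℝ} (hs₀ : 0 < s₀) (hs₃ : s₀ < s₃) :
    ∃ q : Euc n → ℝ, ContDiff ℝ ∞ q ∧ (∀ y, 0 ≤ q y) ∧ (∀ y, q y ≤ 1) ∧
      (∀ y, s₃ ≤ ‖y‖ → q y = 0) ∧ (∀ y, s₀ < ‖y‖ → 0 ≤ lap q y) ∧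
      ∀ y, s₀ < ‖y‖ → ‖y‖ < s₃ → 0 < lap q y := by
  have hs₃0 : 0 < s₃ := hs₀.trans hs₃
  -- The sign of the Laplacian of `exp (-1/T)` is that of `4|y|²(b - 2τ) - 2nτ²`, with `τ = s₃² -
  -- |y|²` in `[0, s₃²]`. The first term of `b` gives `b - 2τ ≥ b/2`, the second gives `b s₀² > n
  -- s₃⁴`.
  set b : ℝ := 4 * s₃ ^ 2 + (n * s₃ ^ 4 / s₀ ^ 2) + 1 with hb
  have hb0 : 0 < b := by positivity
  have hb1 : 4 * s₃ ^ 2 < b := by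
    have : (0 : ℝ) ≤ n * s₃ ^ 4 / s₀ ^ 2 := by positivity
    linarith
  have hb2 : n * s₃ ^ 4 < b * s₀ ^ 2 := by
    have : (n : ℝ) * s₃ ^ 4 / s₀ ^ 2 < b := by nlinarith [sq_nonneg s₃]
    rwa [div_lt_iff₀ (by positivity)] at this
  set T : Euc n → ℝ := fun y => (s₃ ^ 2 - ‖y‖ ^ 2) / b with hT
  have hTs : ContDiff ℝ ∞ T := (contDiff_const.sub contDiff_normSq).div_const b
  set E := expNegInvGlue with hE
  -- The formulas hold for all `t`: at `t ≤ 0` the factor `E t` is zero, whatever `t⁻¹` is.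
  have hE1 : ∀ t, HasDerivAt E ((t⁻¹) ^ 2 * E t) t := fun t => by
    have := expNegInvGlue.hasDerivAt_polynomial_eval_inv_mul 1 t
    simpa using this
  have hE2 : ∀ t, HasDerivAt (fun t => (t⁻¹) ^ 2 * E t)
      ((t⁻¹) ^ 2 * ((t⁻¹) ^ 2 - 2 * t⁻¹) * E t) t := fun t => by
    have := expNegInvGlue.hasDerivAt_polynomial_eval_inv_mul (Polynomial.X ^ 2) t
    simpa [one_add_one_eq_two] using this
  have hN : ∀ y, ContDiffAt ℝ 2 (fun z : Euc n => ‖z‖ ^ 2) y := fun y =>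
    (contDiff_norm_sq ℝ).contDiffAt
  have hTlap : ∀ y, lap T y = -(2 * n / b) := by
    intro y
    have : T = fun z => b⁻¹ * (s₃ ^ 2 - ‖z‖ ^ 2) := by funext z; simp only [hT]; ring
    rw [this, lap_const_mul _ (contDiffAt_const.sub (hN y)), lap_sub contDiffAt_const (hN y),
      lap_const, lap_normSq]
    ring
  have hTgrad : ∀ y, gradSq T y = 4 * ‖y‖ ^ 2 / b ^ 2 := by
    intro y
    have h1 : ∀ i, pderiv i T y = -(2 * y i) / b := by
      intro i
      have : T = fun z => b⁻¹ * (s₃ ^ 2 - ‖z‖ ^ 2) := by funext z; simp only [hT]; ring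
      rw [this, pderiv_const_mul _ ((differentiableAt_const _).fun_sub
        (differentiableAt_of_contDiffAt (hN y))), pderiv_sub (differentiableAt_const _)
        (differentiableAt_of_contDiffAt (hN y)), pderiv_const, pderiv_normSq]
      ring
    simp only [gradSq, h1]
    rw [EuclideanSpace.real_norm_sq_eq, Finset.mul_sum, Finset.sum_div]
    exact Finset.sum_congr rfl fun i _ => by ring_nf
  have hlap : ∀ y, lap (fun z => E (T z)) y = ((T y)⁻¹ ^ 2 * E (T y)) * -(2 * n / b)
      + ((T y)⁻¹ ^ 2 * ((T y)⁻¹ ^ 2 - 2 * (T y)⁻¹) * E (T y)) * (4 * ‖y‖ ^ 2 / b ^ 2) := by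
    intro y
    rw [lap_comp (φ' := fun t => (t⁻¹) ^ 2 * E t) (Eventually.of_forall hE1) (hE2 (T y))
      (hTs.contDiffAt.of_le two_le_infty), hTlap, hTgrad]
  have hpos : ∀ y, s₀ < ‖y‖ → ‖y‖ < s₃ → 0 < lap (fun z => E (T z)) y := by
    intro y hy1 hy2
    have hτ0 : 0 < s₃ ^ 2 - ‖y‖ ^ 2 := by nlinarith [norm_nonneg y]
    have hτ1 : s₃ ^ 2 - ‖y‖ ^ 2 ≤ s₃ ^ 2 := by nlinarith [norm_nonneg y]
    have hy0 : s₀ ^ 2 < ‖y‖ ^ 2 := by gcongr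
    set τ := s₃ ^ 2 - ‖y‖ ^ 2 with hτ
    have hTy : T y = τ / b := rfl
    have hEpos : 0 < E (T y) := expNegInvGlue.pos_of_pos (by rw [hTy]; positivity)
    have heq : lap (fun z => E (T z)) y
        = E (T y) * (τ ^ 4)⁻¹ * b * (4 * ‖y‖ ^ 2 * (b - 2 * τ) - 2 * n * τ ^ 2) := by
      rw [hlap]
      generalize E (T y) = c
      rw [hTy]
      field_simp
      ring
    have hτ2 : τ ^ 2 ≤ s₃ ^ 4 := by nlinarith
    have h1 : 2 * n * τ ^ 2 ≤ 2 * (n * s₃ ^ 4) := by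
      have : (n : ℝ) * τ ^ 2 ≤ n * s₃ ^ 4 := by gcongr
      linarith
    have h2 : b / 2 ≤ b - 2 * τ := by linarith
    have h3 : 4 * s₀ ^ 2 * (b / 2) ≤ 4 * ‖y‖ ^ 2 * (b - 2 * τ) := by gcongr
    rw [heq]
    have : 0 < 4 * ‖y‖ ^ 2 * (b - 2 * τ) - 2 * n * τ ^ 2 := by linarith
    positivity
  have hzero : ∀ y, s₃ ≤ ‖y‖ → E (T y) = 0 := by
    intro y hy
    refine expNegInvGlue.zero_of_nonpos (div_nonpos_of_nonpos_of_nonneg ?_ hb0.le)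
    nlinarith
  refine ⟨fun y => E (T y), expNegInvGlue.contDiff.comp hTs, fun y => expNegInvGlue.nonneg _,
    fun y => ?_, hzero, fun y hy => ?_, hpos⟩
  · by_cases h : T y ≤ 0
    · simp [hE, expNegInvGlue.zero_of_nonpos h]
    · simp only [hE, expNegInvGlue, h, if_false]
      rw [Real.exp_le_one_iff]
      push Not at h
      simpa using h.le
  · rcases lt_or_ge ‖y‖ s₃ with h | h
    · exact (hpos y hy h).le
    · rw [hlap, hzero y h]; simp

/-- A positive harmonic function near infinity, with limit `1` and `< 1` on large spheres, can be
changed outside a large ball into a positive superharmonic function which is constant near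
infinity, and strictly superharmonic in a collar of the region where it is constant. -/
lemma exists_superharmonic_flattening {u : Euc n → ℝ} {s₀ : ℝ} (hs₀ : 0 < s₀)
    (hpos : ∀ y : Euc n, s₀ < ‖y‖ → 0 < u y) (hu : ∀ y : Euc n, s₀ < ‖y‖ → ContDiffAt ℝ ∞ u y)
    (hlap : ∀ y : Euc n, s₀ < ‖y‖ → lap u y = 0)
    (hlim : Tendsto u (Bornology.cobounded (Euc n)) (𝓝 1))
    (hlt : ∀ᶠ r in atTop, ∀ x : Euc n, ‖x‖ = r → u x < 1) (hn : 0 < n) :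
    ∃ (v : Euc n → ℝ) (s₁ s₂ s₃ ε c : ℝ), s₀ + ε < s₁ ∧ s₁ < s₂ ∧ s₂ < s₃ ∧ 0 < ε ∧ 0 < c ∧
      (∀ y : Euc n, s₀ < ‖y‖ → 0 < v y) ∧ (∀ y : Euc n, s₀ < ‖y‖ → ContDiffAt ℝ ∞ v y) ∧
      (∀ y : Euc n, s₁ - ε < ‖y‖ → ‖y‖ < s₁ + ε → v y = u y) ∧
      (∀ y : Euc n, s₀ < ‖y‖ → lap v y ≤ 0) ∧
      (∀ y : Euc n, s₂ ≤ ‖y‖ → ‖y‖ < s₃ → lap v y < 0) ∧ ∀ y : Euc n, s₃ ≤ ‖y‖ → v y = c := by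
  obtain ⟨s₁, hs₁lt, hs₁⟩ := (hlt.and (eventually_gt_atTop (s₀ + 1))).exists
  have hs₁0 : 0 < s₁ := by linarith
  have hcont : ∀ y : Euc n, s₀ < ‖y‖ → ContinuousAt u y := fun y hy => (hu y hy).continuousAt
  have hsph : ∀ r : ℝ, 0 ≤ r → ∃ y : Euc n, ‖y‖ = r := by
    have : Nonempty (Fin n) := ⟨⟨0, hn⟩⟩
    intro r hr
    obtain ⟨y, hy⟩ := NormedSpace.sphere_nonempty (x := (0 : Euc n)).2 hr
    exact ⟨y, by simpa using hy⟩
  have hne : (Metric.sphere (0 : Euc n) s₁).Nonempty := by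
    obtain ⟨y, hy⟩ := hsph s₁ hs₁0.le
    exact ⟨y, by simpa using hy⟩
  obtain ⟨x₀, hx₀, hmax⟩ := (isCompact_sphere (0 : Euc n) s₁).exists_isMaxOn hne
    fun y hy => (hcont y (by rw [mem_sphere_zero_iff_norm] at hy; linarith)).continuousWithinAt
  rw [mem_sphere_zero_iff_norm] at hx₀
  have ha1 : u x₀ < 1 := hs₁lt x₀ hx₀
  have ha0 : 0 < u x₀ := hpos x₀ (by linarith)
  -- Eighths of the gap leave room for separate levels: `u ≤ 1 - 7η` near the sphere `s₁`, the
  -- barrier `w` between `1 - 5η` and `1 - 4η`, and `u ≥ 1 - η` beyond `s₂`. Thus `u - w` leaves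
  -- `[-η, η]`, downwards near `s₁` and upwards beyond `s₂`.
  set η : ℝ := (1 - u x₀) / 8 with hη
  have hη0 : 0 < η := by rw [hη]; linarith
  have hux₀ : u x₀ = 1 - 8 * η := by rw [hη]; ring
  obtain ⟨ε, hε0, hε1, hεu⟩ : ∃ ε, 0 < ε ∧ ε < 1 ∧
      ∀ y : Euc n, s₁ - ε < ‖y‖ → ‖y‖ < s₁ + ε → u y ≤ 1 - 7 * η := by
    have hopen : IsOpen {y : Euc n | s₀ < ‖y‖ ∧ u y < 1 - 7 * η} := by
      rw [isOpen_iff_mem_nhds]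
      rintro y ⟨hy1, hy2⟩
      filter_upwards [(continuous_norm.tendsto y).eventually (lt_mem_nhds hy1),
        (hcont y hy1).eventually (gt_mem_nhds hy2)] with z h1 h2 using ⟨h1, h2⟩
    have hsub : Metric.sphere (0 : Euc n) s₁ ⊆ {y : Euc n | s₀ < ‖y‖ ∧ u y < 1 - 7 * η} := by
      intro y hy
      have h1 : u y ≤ u x₀ := hmax hy
      rw [mem_sphere_zero_iff_norm] at hy
      exact ⟨by linarith, by linarith⟩
    obtain ⟨d, hd0, hd⟩ := (isCompact_sphere (0 : Euc n) s₁).exists_thickening_subset_open hopen hsub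
    refine ⟨min d (1 / 2), by positivity, (min_le_right _ _).trans_lt (by norm_num),
      fun y hy1 hy2 => ?_⟩
    have hm1 := min_le_left d (1 / 2)
    have hm2 := min_le_right d (1 / 2)
    have hy0 : 0 < ‖y‖ := by linarith
    -- A point of the annulus is compared with its radial projection to the sphere.
    refine (hd (Metric.mem_thickening_iff.2 ⟨(s₁ / ‖y‖) • y, ?_, ?_⟩)).2.le
    · rw [mem_sphere_zero_iff_norm, norm_smul, Real.norm_of_nonneg (by positivity)]
      field_simp
    · rw [dist_eq_norm]
      have : y - (s₁ / ‖y‖) • y = (1 - s₁ / ‖y‖) • y := by rw [sub_smul, one_smul]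
      rw [this, norm_smul, Real.norm_eq_abs, ← abs_of_pos hy0, ← abs_mul, abs_of_pos hy0]
      have : (1 - s₁ / ‖y‖) * ‖y‖ = ‖y‖ - s₁ := by field_simp
      rw [this, abs_lt]
      constructor <;> linarith
  obtain ⟨s₂, hs₂1, hs₂⟩ : ∃ s₂, s₁ < s₂ ∧ ∀ y : Euc n, s₂ ≤ ‖y‖ → 1 - η ≤ u y := by
    have hev := hlim.eventually (lt_mem_nhds (show 1 - η < 1 by linarith))
    rw [← comap_norm_atTop, eventually_comap] at hev
    obtain ⟨T, hT⟩ := eventually_atTop.1 hev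
    exact ⟨max T (s₁ + 1), by linarith [le_max_right T (s₁ + 1)], fun y hy =>
      (hT ‖y‖ ((le_max_left _ _).trans hy) y rfl).le⟩
  set s₃ := s₂ + 1 with hs₃
  obtain ⟨q, hqs, hq0, hq1, hqz, hqlap, hqlap'⟩ :=
    exists_radial_subharmonic (n := n) hs₀ (show s₀ < s₃ by linarith)
  obtain ⟨χ, χ', χ'', k, hχs, hχd, hχd', hχ0, hχ1, hχ2, hχl, hχr, hχr', hχb⟩ :=
    exists_concave_cutoff hη0
  set w : Euc n → ℝ := fun y => (1 - 4 * η) - η * q y with hw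
  have hws : ∀ y, ContDiffAt ℝ ∞ w y := fun y =>
    (contDiff_const.sub (contDiff_const.mul hqs)).contDiffAt
  have hwlow : ∀ y, 1 - 5 * η ≤ w y := fun y => by
    have : η * q y ≤ η * 1 := by gcongr; exact hq1 y
    simp only [hw]; linarith
  have hwup : ∀ y, w y ≤ 1 - 4 * η := fun y => by
    have : 0 ≤ η * q y := mul_nonneg hη0.le (hq0 y)
    simp only [hw]; linarith
  have h2 : ∀ {f : Euc n → ℝ} {y}, ContDiffAt ℝ ∞ f y → ContDiffAt ℝ 2 f y := fun h =>
    h.of_le two_le_infty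
  have hwlap : ∀ y, lap w y = -(η * lap q y) := fun y => by
    have hq2 := h2 (hqs.contDiffAt (x := y))
    rw [hw, lap_sub contDiffAt_const (contDiffAt_const.mul hq2), lap_const, lap_const_mul _ hq2]
    ring
  -- A smoothed minimum of `u` and the superharmonic `w`, up to a constant. As `Δu = 0`, its
  -- Laplacian is `(1 - χ') Δw + χ'' |∇(u - w)|²`, both terms nonpositive; where `χ' = 0` it is at
  -- most `Δw`, negative for `|y| < s₃`.
  set v : Euc n → ℝ := fun y => w y + χ (u y - w y) with hv
  have hvlap : ∀ y, s₀ < ‖y‖ → lap v y = (1 - χ' (u y - w y)) * lap w y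
      + χ'' (u y - w y) * gradSq (fun z => u z - w z) y := by
    intro y hy
    have hu2 := h2 (hu y hy)
    have hw2 := h2 (hws y)
    have hχ2 : ContDiffAt ℝ 2 χ (u y - w y) := (hχs.contDiffAt).of_le two_le_infty
    have hc : ContDiffAt ℝ 2 (fun z => χ (u z - w z)) y := hχ2.comp y (hu2.sub hw2)
    rw [hv, lap_add hw2 hc, lap_comp (Eventually.of_forall hχd) (hχd' _)
      (hu2.sub hw2), lap_sub hu2 hw2, hlap y hy]
    ring
  have hvle : ∀ y, s₀ < ‖y‖ → lap v y ≤ (1 - χ' (u y - w y)) * lap w y := by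
    intro y hy
    rw [hvlap y hy]
    have := mul_nonpos_of_nonpos_of_nonneg (hχ2 (u y - w y)) (gradSq_nonneg (fun z => u z - w z) y)
    linarith
  have hvright : ∀ y, s₂ ≤ ‖y‖ → η ≤ u y - w y := fun y hy => by
    linarith [hs₂ y hy, hwup y]
  have hvconst : ∀ y, s₃ ≤ ‖y‖ → v y = 1 - 4 * η + k := by
    intro y hy
    simp only [hv]
    rw [hχr _ (hvright y (by linarith))]
    simp [hw, hqz y hy]
  -- Either `v = u`, or `v ≥ w - η ≥ 1 - 6η`, which is positive because `8η = 1 - u x₀ < 1`.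
  have hvpos : ∀ y : Euc n, s₀ < ‖y‖ → 0 < v y := by
    intro y hy
    rcases le_total (u y - w y) (-η) with h | h
    · simp only [hv, hχl _ h, add_sub_cancel]
      exact hpos y hy
    · have := hχb _ h
      have := hwlow y
      simp only [hv]
      linarith
  refine ⟨v, s₁, s₂, s₃, ε, 1 - 4 * η + k, by linarith, hs₂1, by linarith, hε0, ?_, hvpos, ?_, ?_,
    ?_, ?_, hvconst⟩
  · obtain ⟨y, hy⟩ := hsph s₃ (by linarith)
    rw [← hvconst y hy.ge]
    exact hvpos y (by linarith)
  · intro y hy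
    exact (hws y).add (hχs.contDiffAt.comp y ((hu y hy).sub (hws y)))
  · intro y hy1 hy2
    have h : u y - w y ≤ -η := by linarith [hεu y hy1 hy2, hwlow y]
    simp only [hv, hχl _ h]
    ring
  · intro y hy
    refine (hvle y hy).trans ?_
    rw [hwlap]
    have h1 : 0 ≤ 1 - χ' (u y - w y) := by linarith [hχ1 (u y - w y)]
    have h2 : 0 ≤ η * lap q y := mul_nonneg hη0.le (hqlap y hy)
    nlinarith
  · intro y hy1 hy2
    have hy0 : s₀ < ‖y‖ := by linarith
    refine (hvle y hy0).trans_lt ?_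
    rw [hwlap, hχr' _ (hvright y hy1)]
    have := mul_pos hη0 (hqlap' y hy0 hy2)
    linarith

end Flattening

/-! ### Continuous metrics in coordinates -/

section CoordinateMetrics

variable {n : ℕ} {M : Type*} [TopologicalSpace M] [ChartedSpace (Euc n) M]
  [IsManifold (𝓡 n) ∞ M]

/-- The minimum `c > 0` of `B v v` on the compact unit sphere gives `B v v ≥ c |v|²`. An empty
sphere means that the space is zero. -/
lemma isVonNBounded_of_pos (B : Euc n →L[ℝ] Euc n →L[ℝ] ℝ) (hB : ∀ v, v ≠ 0 → 0 < B v v) :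
    Bornology.IsVonNBounded ℝ {v | B v v < 1} := by
  rw [NormedSpace.isVonNBounded_iff]
  rcases (Metric.sphere (0 : Euc n) 1).eq_empty_or_nonempty with h | hne
  · have hall : ∀ v : Euc n, v = 0 := by
      intro v
      by_contra hv
      have : (‖v‖⁻¹ • v) ∈ Metric.sphere (0 : Euc n) 1 := by
        simp [norm_smul, inv_mul_cancel₀ (norm_ne_zero_iff.2 hv)]
      rw [h] at this
      exact this
    exact (Metric.isBounded_closedBall (x := (0 : Euc n)) (r := 0)).subset fun v _ => by
      simp [hall v]
  · have hcont : Continuous fun v : Euc n => B v v := by fun_prop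
    obtain ⟨w, hw, hmin⟩ := (isCompact_sphere (0 : Euc n) 1).exists_isMinOn hne hcont.continuousOn
    have hw0 : w ≠ 0 := by
      rintro rfl
      simp at hw
    set c := B w w
    have hc : 0 < c := hB w hw0
    refine (Metric.isBounded_closedBall (x := (0 : Euc n)) (r := √(1 / c))).subset fun v hv => ?_
    have hv1 : B v v < 1 := hv
    rw [mem_closedBall_zero_iff]
    rcases eq_or_ne v 0 with rfl | hv0
    · simp
    have hn : 0 < ‖v‖ := norm_pos_iff.2 hv0
    have h1 : c ≤ B (‖v‖⁻¹ • v) (‖v‖⁻¹ • v) :=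
      hmin (by simp [norm_smul, inv_mul_cancel₀ hn.ne'])
    simp only [map_smul, smul_apply, smul_eq_mul] at h1
    have h2 : c * ‖v‖ ^ 2 ≤ B v v := by
      have := mul_le_mul_of_nonneg_right h1 (sq_nonneg ‖v‖)
      have h3 : ‖v‖⁻¹ * (‖v‖⁻¹ * (B v) v) * ‖v‖ ^ 2 = B v v := by field_simp
      rwa [h3] at this
    apply Real.le_sqrt_of_sq_le
    rw [le_div_iff₀ hc]
    linarith

/-- The coordinate representation of a family of bilinear forms. -/
def coordForm (B : ∀ x : M, TangentSpace (𝓡 n) x →L[ℝ] TangentSpace (𝓡 n) x →L[ℝ] ℝ)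
    (e : OpenPartialHomeomorph M (Euc n)) (y : Euc n) (i j : Fin n) : ℝ :=
  B (e.symm y) (mfderiv (𝓡 n) (𝓡 n) e.symm y (basisVec n i))
    (mfderiv (𝓡 n) (𝓡 n) e.symm y (basisVec n j))

/-- In the trivialisation of the tangent bundle at `x₀` the form becomes its matrix in the preferred
chart at `x₀`. In finite dimension, continuity of the entries is enough. -/
lemma continuous_of_coordForm
    (B : ∀ x : M, TangentSpace (𝓡 n) x →L[ℝ] TangentSpace (𝓡 n) x →L[ℝ] ℝ)
    (hB : ∀ (x : M) (i j : Fin n), ContinuousAt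
      (fun y => coordForm B (chartAt (Euc n) x) y i j) (chartAt (Euc n) x x)) :
    Continuous (fun x : M => TotalSpace.mk' (Euc n →L[ℝ] Euc n →L[ℝ] ℝ)
      (E := fun x => TangentSpace (𝓡 n) x →L[ℝ] TangentSpace (𝓡 n) x →L[ℝ] ℝ) x (B x)) := by
  rw [continuous_iff_continuousAt]
  intro x₀
  rw [continuousAt_hom_bundle]
  refine ⟨continuousAt_id, ?_⟩
  have hb : ∀ i j : Fin n, ContinuousAt (fun x => ContinuousLinearMap.inCoordinates (Euc n)
      (fun x : M => TangentSpace (𝓡 n) x) (Euc n →L[ℝ] ℝ)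
      (fun x : M => TangentSpace (𝓡 n) x →L[ℝ] ℝ) x₀ x x₀ x (B x)
        (basisVec n i) (basisVec n j)) x₀ := by
    intro i j
    have h1 := (hB x₀ i j).comp (f := chartAt (Euc n) x₀)
      ((chartAt (Euc n) x₀).continuousAt (mem_chart_source _ x₀))
    refine h1.congr ?_
    filter_upwards [(chartAt (Euc n) x₀).open_source.mem_nhds (mem_chart_source _ x₀)] with x hx
    have hx' : x ∈ (trivializationAt (Euc n) (fun x : M => TangentSpace (𝓡 n) x) x₀).baseSet := by
      simpa using hx
    rw [inCoordinates_apply_eq₂ hx' hx' (Set.mem_univ _)]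
    have hs : ∀ v : Euc n, (trivializationAt (Euc n) (fun x : M => TangentSpace (𝓡 n) x) x₀).symm x v
        = mfderiv (𝓡 n) (𝓡 n) (chartAt (Euc n) x₀).symm (chartAt (Euc n) x₀ x) v := by
      intro v
      have := TangentBundle.symmL_trivializationAt (I := 𝓡 n) (𝕜 := ℝ) hx
      rw [← Trivialization.symmL_apply (R := ℝ) _ hx', this]
      simp only [mfld_simps, mfderivWithin_univ]
      rfl
    rw [hs, hs]
    -- All tangent spaces are definitionally `Euc n`, so forms at equal base points can be compared
    -- without transport.
    have hcast : ∀ x', x' = x → ∀ v w : Euc n, B x' v w = B x v w := by rintro _ rfl _ _; rfl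
    simp only [Function.comp_apply, coordForm]
    refine (hcast _ ((chartAt (Euc n) x₀).left_inv hx) _ _).trans ?_
    simp
  refine continuousAt_clm_apply.2 fun v => continuousAt_clm_apply.2 fun w => ?_
  have hexp : ∀ v : Euc n, v = ∑ i, v i • basisVec n i := fun v => by
    simpa [basisVec] using ((EuclideanSpace.basisFun (Fin n) ℝ).sum_repr v).symm
  rw [hexp v, hexp w]
  simp only [map_sum, map_smul, sum_apply, smul_apply]
  exact tendsto_finsetSum _ fun i _ => Tendsto.const_smul
    (tendsto_finsetSum _ fun j _ => Tendsto.const_smul (hb _ _) _) _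

/-- A continuous metric, from a family of inner products with continuous coordinate
representations. -/
def metricOfCoord (B : ∀ x : M, TangentSpace (𝓡 n) x →L[ℝ] TangentSpace (𝓡 n) x →L[ℝ] ℝ)
    (hsymm : ∀ x v w, B x v w = B x w v) (hpos : ∀ x v, v ≠ 0 → 0 < B x v v)
    (hB : ∀ (x : M) (i j : Fin n), ContinuousAt
      (fun y => coordForm B (chartAt (Euc n) x) y i j) (chartAt (Euc n) x x)) : C0Metric n M where
  inner := B
  symm := hsymm
  pos := hpos
  isVonNBounded x := isVonNBounded_of_pos (B x) (hpos x)
  continuous := continuous_of_coordForm B hB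

/-- The coordinate fields are images of constant sections under the tangent map of `e.symm`, hence
continuous sections, and a continuous metric pairs these continuously. -/
lemma continuousOn_coordMetric (g : C0Metric n M) {e : OpenPartialHomeomorph M (Euc n)}
    (he : e ∈ IsManifold.maximalAtlas (𝓡 n) ∞ M) (i j : Fin n) :
    ContinuousOn (fun y => coordMetric g e y i j) e.target := by
  let : RiemannianBundle (fun x : M => TangentSpace (𝓡 n) x) := ⟨g.toRiemannianMetric⟩
  have hv : ∀ i : Fin n, ContinuousOn (fun y => (⟨e.symm y,
      mfderiv (𝓡 n) (𝓡 n) e.symm y (basisVec n i)⟩ :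
        TotalSpace (Euc n) (fun x : M => TangentSpace (𝓡 n) x))) e.target := by
    intro i
    have h1 := (contMDiffOn_symm_of_mem_maximalAtlas he).continuousOn_tangentMapWithin
      (by simp) e.open_target.uniqueMDiffOn
    have h2 : ContinuousOn (fun y : Euc n => (⟨y, basisVec n i⟩ : TangentBundle (𝓡 n) (Euc n)))
        e.target := by
      refine Continuous.continuousOn ?_
      exact (tangentBundleModelSpaceHomeomorph (𝓡 n)).symm.continuous.comp
        (continuous_id.prodMk continuous_const)
    have h3 := h1.comp h2 fun y hy => hy
    refine h3.congr fun y hy => ?_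
    simp only [Function.comp_apply, tangentMapWithin]
    rw [mfderivWithin_of_mem_nhds (e.open_target.mem_nhds hy)]
  exact (hv i).inner_bundle (hv j)

/-- Multiplication of a metric by a positive function. -/
def scaleMetric (g : C0Metric n M) (k : M → ℝ) (hk : Continuous k) (hpos : ∀ x, 0 < k x) :
    C0Metric n M :=
  metricOfCoord (fun x => k x • g.inner x) (fun x v w => by simp [g.symm x v w])
    (fun x v hv => by simpa using mul_pos (hpos x) (g.pos x v hv))
    (fun x i j => by
      have h1 : ContinuousAt (fun y => coordMetric g (chartAt (Euc n) x) y i j)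
          (chartAt (Euc n) x x) :=
        (continuousOn_coordMetric g (IsManifold.chart_mem_maximalAtlas x) i j).continuousAt
          ((chartAt (Euc n) x).open_target.mem_nhds (mem_chart_target _ x))
      have h2 : ContinuousAt (fun y => k ((chartAt (Euc n) x).symm y)) (chartAt (Euc n) x x) :=
        hk.continuousAt.comp ((chartAt (Euc n) x).continuousAt_symm (mem_chart_target _ x))
      exact h2.mul h1)

lemma coordMetric_scaleMetric (g : C0Metric n M) (k : M → ℝ) (hk : Continuous k)
    (hpos : ∀ x, 0 < k x) (e : OpenPartialHomeomorph M (Euc n)) (y : Euc n) :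
    coordMetric (scaleMetric g k hk hpos) e y = k (e.symm y) • coordMetric g e y := rfl

end CoordinateMetrics

/-! ### Étale quotients of manifolds -/

section EtaleQuotient

variable {n : ℕ} {M : Type*} [TopologicalSpace M] [ChartedSpace (Euc n) M]
  {N : Type*} [TopologicalSpace N]

/-- `pr` maps the open set `W` onto `N` by a local homeomorphism, and points with the same image are
related by smooth germs over `N`. -/
structure IsEtale (n : ℕ) {M : Type*} [TopologicalSpace M] [ChartedSpace (Euc n) M]
    {N : Type*} [TopologicalSpace N] (pr : M → N) (W : Set M) : Prop where
  surj : ∀ q, ∃ x ∈ W, pr x = q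
  exists_local : ∀ x ∈ W, ∃ e : OpenPartialHomeomorph M N, x ∈ e.source ∧ e.source ⊆ W ∧ ⇑e = pr
  transition : ∀ x ∈ W, ∀ y ∈ W, pr x = pr y →
    ∃ τ : M → M, ContMDiffAt (𝓡 n) (𝓡 n) ∞ τ x ∧ τ x = y ∧ ∀ᶠ z in 𝓝 x, pr (τ z) = pr z

variable {pr : M → N} {W : Set M}

/-- Uniqueness of lifts: both sides lift `pr` into `e.source`, where `e` is injective. Smoothness,
isometry and orientation of transition germs pass through this to the local inverses of `pr`. -/
lemma eventuallyEq_symm_comp {e : OpenPartialHomeomorph M N} (he : ⇑e = pr) {τ : M → M} {x : M}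
    (hτc : ContinuousAt τ x) (hτx : τ x ∈ e.source) (hτpr : ∀ᶠ z in 𝓝 x, pr (τ z) = pr z) :
    (fun z => e.symm (pr z)) =ᶠ[𝓝 x] τ := by
  filter_upwards [hτpr, hτc.eventually (e.open_source.mem_nhds hτx)] with z h1 h2
  rw [← h1, ← he, e.left_inv h2]

lemma IsEtale.contMDiffAt_symm_comp (h : IsEtale n pr W) {e : OpenPartialHomeomorph M N}
    (heW : e.source ⊆ W) (he : ⇑e = pr) {x : M} (hx : x ∈ W) (hxe : pr x ∈ e.target) :
    ContMDiffAt (𝓡 n) (𝓡 n) ∞ (fun z => e.symm (pr z)) x := by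
  have hy : e.symm (pr x) ∈ e.source := e.map_target hxe
  obtain ⟨τ, hτ, hτx, hτpr⟩ := h.transition x hx (e.symm (pr x)) (heW hy)
    (by rw [← he, e.right_inv (he ▸ hxe)])
  exact hτ.congr_of_eventuallyEq
    (eventuallyEq_symm_comp he hτ.continuousAt (hτx ▸ hy) hτpr)

/-- The base of an étale quotient map is a manifold, with charts built from any prescribed smooth
charts upstairs. -/
theorem IsEtale.exists_isManifold [IsManifold (𝓡 n) ∞ M] (h : IsEtale n pr W)
    (c : M → OpenPartialHomeomorph M (Euc n)) (hc : ∀ x, c x ∈ IsManifold.maximalAtlas (𝓡 n) ∞ M)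
    (hcx : ∀ x, x ∈ (c x).source) :
    ∃ (_ : ChartedSpace (Euc n) N) (_ : IsManifold (𝓡 n) ∞ N),
      (∀ e : OpenPartialHomeomorph M N, e.source ⊆ W → ⇑e = pr →
        ContMDiffOn (𝓡 n) (𝓡 n) ∞ e e.source ∧ ContMDiffOn (𝓡 n) (𝓡 n) ∞ e.symm e.target) ∧
      ∀ q : N, ∃ x ∈ W, ∃ e : OpenPartialHomeomorph M N, x ∈ e.source ∧ e.source ⊆ W ∧ ⇑e = pr ∧
        pr x = q ∧ chartAt (Euc n) q = e.symm ≫ₕ c x := by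
  choose rep hrepW hrep using h.surj
  choose E hEx hEW hEpr using fun q => h.exists_local (rep q) (hrepW q)
  have hqT : ∀ q, q ∈ (E q).target := fun q => by
    have := (E q).map_source (hEx q)
    rwa [hEpr, hrep] at this
  have hsymm : ∀ q, (E q).symm q = rep q := fun q => by
    have := (E q).left_inv (hEx q)
    rwa [hEpr, hrep] at this
  -- The chart at `q` is a local inverse of `pr` followed by the prescribed chart at a
  -- representative. Keeping control of the preferred charts is what later allows `scalarCurv` to be
  -- computed in the end coordinates.
  let cs : ChartedSpace (Euc n) N :=
    { atlas := range fun q => (E q).symm ≫ₕ c (rep q)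
      chartAt := fun q => (E q).symm ≫ₕ c (rep q)
      mem_chart_source := fun q => by
        rw [OpenPartialHomeomorph.trans_source]
        refine ⟨hqT q, ?_⟩
        rw [mem_preimage, hsymm]
        exact hcx _
      chart_mem_atlas := fun q => mem_range_self q }
  have hman : IsManifold (𝓡 n) ∞ N := by
    refine isManifold_of_contDiffOn (𝓡 n) ∞ N ?_
    rintro _ _ ⟨q, rfl⟩ ⟨q', rfl⟩
    intro y hy
    simp only [mfld_simps] at hy ⊢
    obtain ⟨⟨hy1, hy2⟩, hy3, hy4⟩ := hy
    refine ContDiffAt.contDiffWithinAt ?_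
    rw [← contMDiffAt_iff_contDiffAt]
    have h1 : ContMDiffAt (𝓡 n) (𝓡 n) ∞ (c (rep q)).symm y :=
      contMDiffAt_symm_of_mem_maximalAtlas (hc _) hy1
    rw [hEpr] at hy3 hy4
    have h2 := h.contMDiffAt_symm_comp (hEW q') (hEpr q') (hEW q hy2) hy3
    have h3 : ContMDiffAt (𝓡 n) (𝓡 n) ∞ (c (rep q')) ((E q').symm (pr ((c (rep q)).symm y))) :=
      contMDiffAt_of_mem_maximalAtlas (hc _) hy4
    have h4 := h3.comp y (h2.comp y h1)
    rw [hEpr]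
    exact h4
  have hchart : ∀ q : N, chartAt (Euc n) q = (E q).symm ≫ₕ c (rep q) := fun q => rfl
  refine ⟨cs, hman, fun e heW he => ⟨fun x hx => ?_, fun p hp => ?_⟩, fun q =>
    ⟨rep q, hrepW q, E q, hEx q, hEW q, hEpr q, hrep q, rfl⟩⟩
  · refine ContMDiffAt.contMDiffWithinAt ?_
    set q := pr x
    have hxT : pr x ∈ (E q).target := hqT q
    have h2 := h.contMDiffAt_symm_comp (hEW q) (hEpr q) (heW hx) hxT
    have h3 : ContMDiffAt (𝓡 n) (𝓡 n) ∞ (c (rep q)) ((E q).symm (pr x)) :=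
      contMDiffAt_of_mem_maximalAtlas (hc _) (by rw [show pr x = q from rfl, hsymm]; exact hcx _)
    have h4 : ContMDiffAt (𝓡 n) (𝓡 n) ∞ (chartAt (Euc n) q).symm
        (c (rep q) ((E q).symm (pr x))) := by
      refine contMDiffAt_symm_of_mem_maximalAtlas (IsManifold.chart_mem_maximalAtlas q) ?_
      exact mem_chart_target (Euc n) q
    have h5 := h4.comp x (h3.comp x h2)
    refine h5.congr_of_eventuallyEq ?_
    have hcont : ContinuousAt pr x := he ▸ e.continuousAt hx
    have hmem : ∀ᶠ z in 𝓝 x, pr z ∈ (chartAt (Euc n) q).source :=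
      hcont.eventually ((chartAt (Euc n) q).open_source.mem_nhds (mem_chart_source (Euc n) q))
    filter_upwards [hmem] with z hz
    rw [he]
    exact ((chartAt (Euc n) q).left_inv hz).symm
  · refine ContMDiffAt.contMDiffWithinAt ?_
    have h1 : ContMDiffAt (𝓡 n) (𝓡 n) ∞ (chartAt (Euc n) p) p :=
      contMDiffAt_of_mem_maximalAtlas (IsManifold.chart_mem_maximalAtlas p)
        (mem_chart_source (Euc n) p)
    have hcp : chartAt (Euc n) p p = c (rep p) (rep p) := by
      rw [hchart]
      simp [hsymm]
    have h2 : ContMDiffAt (𝓡 n) (𝓡 n) ∞ (c (rep p)).symm (chartAt (Euc n) p p) := by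
      rw [hcp]
      exact contMDiffAt_symm_of_mem_maximalAtlas (hc _) ((c (rep p)).map_source (hcx _))
    have hb : (c (rep p)).symm (chartAt (Euc n) p p) = rep p := by
      rw [hcp, (c (rep p)).left_inv (hcx _)]
    have h3 : ContMDiffAt (𝓡 n) (𝓡 n) ∞ (fun z => e.symm (pr z))
        ((c (rep p)).symm (chartAt (Euc n) p p)) := by
      rw [hb]
      exact h.contMDiffAt_symm_comp heW he (hrepW p) (by rwa [hrep])
    have h4 := h3.comp p (h2.comp p h1)
    refine h4.congr_of_eventuallyEq ?_
    filter_upwards [(chartAt (Euc n) p).open_source.mem_nhds (mem_chart_source (Euc n) p)] with z hz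
    have hz' : z ∈ ((E p).symm ≫ₕ c (rep p)).source := hz
    rw [OpenPartialHomeomorph.trans_source] at hz'
    simp only [Function.comp_apply, hchart, OpenPartialHomeomorph.coe_trans]
    rw [(c (rep p)).left_inv hz'.2, ← hEpr p, (E p).right_inv hz'.1]

end EtaleQuotient

/-! ### Metrics on étale quotients -/

section DescendMetric

set_option linter.unusedSectionVars false

variable {n : ℕ} {M : Type*} [TopologicalSpace M] [ChartedSpace (Euc n) M]
  [IsManifold (𝓡 n) ∞ M] {N : Type*} [TopologicalSpace N] [ChartedSpace (Euc n) N]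
  [IsManifold (𝓡 n) ∞ N]

/-- `e` is a restriction of `pr` to an open subset of `W` and is a diffeomorphism onto its image. -/
structure IsPiece (pr : M → N) (W : Set M) (e : OpenPartialHomeomorph M N) : Prop where
  subset : e.source ⊆ W
  coe_eq : ⇑e = pr
  smooth : ContMDiffOn (𝓡 n) (𝓡 n) ∞ e e.source
  smooth_symm : ContMDiffOn (𝓡 n) (𝓡 n) ∞ e.symm e.target

/-- `pr` maps the set `W` onto `N` by a local diffeomorphism. -/
structure IsSmoothEtale (pr : M → N) (W : Set M) : Prop where
  surj : ∀ q, ∃ x ∈ W, pr x = q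
  exists_piece : ∀ x ∈ W, ∃ e : OpenPartialHomeomorph M N, x ∈ e.source ∧ IsPiece (n := n) pr W e

/-- Points of `W` with the same image are related by isometric germs over `N`. -/
def IsInvariantMetric (g : C0Metric n M) (pr : M → N) (W : Set M) : Prop :=
  ∀ x ∈ W, ∀ y ∈ W, pr x = pr y → ∃ τ : M → M, ContMDiffAt (𝓡 n) (𝓡 n) ∞ τ x ∧ τ x = y ∧
    (∀ᶠ z in 𝓝 x, pr (τ z) = pr z) ∧
    ∀ v w : TangentSpace (𝓡 n) x, g.inner (τ x) (mfderiv (𝓡 n) (𝓡 n) τ x v)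
      (mfderiv (𝓡 n) (𝓡 n) τ x w) = g.inner x v w

/-- Serves to replace a base point such as `e.symm (e x)` by `x` without transporting tangent
vectors. -/
lemma inner_congr (g : C0Metric n M) {x y : M} (h : x = y) (v w : Euc n) :
    g.inner x v w = g.inner y v w := by
  subst h; rfl

variable {pr : M → N} {W : Set M}

lemma IsPiece.mdifferentiableAt {e : OpenPartialHomeomorph M N} (he : IsPiece (n := n) pr W e)
    {x : M} (hx : x ∈ e.source) : MDifferentiableAt (𝓡 n) (𝓡 n) e x :=
  (he.smooth.contMDiffAt (e.open_source.mem_nhds hx)).mdifferentiableAt (by simp)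

lemma IsPiece.mdifferentiableAt_symm {e : OpenPartialHomeomorph M N}
    (he : IsPiece (n := n) pr W e) {q : N} (hq : q ∈ e.target) :
    MDifferentiableAt (𝓡 n) (𝓡 n) e.symm q :=
  (he.smooth_symm.contMDiffAt (e.open_target.mem_nhds hq)).mdifferentiableAt (by simp)

lemma mfderiv_symm_apply_mfderiv {M' N' : Type*} [TopologicalSpace M'] [ChartedSpace (Euc n) M']
    [TopologicalSpace N'] [ChartedSpace (Euc n) N'] (e : OpenPartialHomeomorph M' N') {x : M'}
    (hx : x ∈ e.source) (h1 : MDifferentiableAt (𝓡 n) (𝓡 n) e x)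
    (h2 : MDifferentiableAt (𝓡 n) (𝓡 n) e.symm (e x)) (v : Euc n) :
    mfderiv (𝓡 n) (𝓡 n) e.symm (e x) (mfderiv (𝓡 n) (𝓡 n) e x v) = v := by
  have h3 : (e.symm ∘ e) =ᶠ[𝓝 x] id := e.eventually_left_inverse hx
  have h4 := h3.mfderiv_eq (I := 𝓡 n) (I' := 𝓡 n)
  have h5 : mfderiv (𝓡 n) (𝓡 n) (e.symm ∘ e) x
    = (mfderiv (𝓡 n) (𝓡 n) e.symm (e x)).comp (mfderiv (𝓡 n) (𝓡 n) e x) := mfderiv_comp x h2 h1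
  have h6 := DFunLike.congr_fun (h5.symm.trans h4) v
  rw [mfderiv_id] at h6
  exact h6

lemma mfderiv_apply_mfderiv_symm {M' N' : Type*} [TopologicalSpace M'] [ChartedSpace (Euc n) M']
    [TopologicalSpace N'] [ChartedSpace (Euc n) N'] (e : OpenPartialHomeomorph M' N') {q : N'}
    (hq : q ∈ e.target) (h1 : MDifferentiableAt (𝓡 n) (𝓡 n) e.symm q)
    (h2 : MDifferentiableAt (𝓡 n) (𝓡 n) e (e.symm q)) (v : Euc n) :
    mfderiv (𝓡 n) (𝓡 n) e (e.symm q) (mfderiv (𝓡 n) (𝓡 n) e.symm q v) = v := by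
  have h3 : (e ∘ e.symm) =ᶠ[𝓝 q] id := e.eventually_right_inverse hq
  have h4 := h3.mfderiv_eq (I := 𝓡 n) (I' := 𝓡 n)
  have h5 : mfderiv (𝓡 n) (𝓡 n) (e ∘ e.symm) q
    = (mfderiv (𝓡 n) (𝓡 n) e (e.symm q)).comp (mfderiv (𝓡 n) (𝓡 n) e.symm q) :=
    mfderiv_comp q h2 h1
  have h6 := DFunLike.congr_fun (h5.symm.trans h4) v
  rw [mfderiv_id] at h6
  exact h6

lemma IsPiece.eq_zero_of_mfderiv_symm {e : OpenPartialHomeomorph M N}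
    (he : IsPiece (n := n) pr W e) {q : N} (hq : q ∈ e.target) {v : Euc n}
    (hv : mfderiv (𝓡 n) (𝓡 n) e.symm q v = (0 : Euc n)) : v = 0 := by
  have h1 := mfderiv_apply_mfderiv_symm e hq (he.mdifferentiableAt_symm hq)
    (he.mdifferentiableAt (e.map_target hq)) v
  have h2 : mfderiv (𝓡 n) (𝓡 n) e (e.symm q) (mfderiv (𝓡 n) (𝓡 n) e.symm q v)
      = mfderiv (𝓡 n) (𝓡 n) e (e.symm q) (0 : Euc n) :=
    congrArg (fun w : Euc n => mfderiv (𝓡 n) (𝓡 n) e (e.symm q) w) hv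
  exact (h1.symm.trans h2).trans (map_zero (mfderiv (𝓡 n) (𝓡 n) e (e.symm q)))

/-- The pullback of a bilinear form. -/
def pullForm (G : Euc n →L[ℝ] Euc n →L[ℝ] ℝ) (D : Euc n →L[ℝ] Euc n) :
    Euc n →L[ℝ] Euc n →L[ℝ] ℝ := G.bilinearComp D D

/-- By the chain rule for `e.symm ∘ c.symm`. Every chart question about the form downstairs becomes
one about `g` in the chart `e ≫ₕ c`. -/
lemma coordForm_of_eqOn_piece {g : C0Metric n M} {e : OpenPartialHomeomorph M N}
    (he : IsPiece (n := n) pr W e)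
    {B : ∀ q : N, TangentSpace (𝓡 n) q →L[ℝ] TangentSpace (𝓡 n) q →L[ℝ] ℝ}
    (hB : ∀ q ∈ e.target, ∀ v w : TangentSpace (𝓡 n) q, B q v w =
      g.inner (e.symm q) (mfderiv (𝓡 n) (𝓡 n) e.symm q v) (mfderiv (𝓡 n) (𝓡 n) e.symm q w))
    {c : OpenPartialHomeomorph N (Euc n)} (hc : c ∈ IsManifold.maximalAtlas (𝓡 n) ∞ N) {y : Euc n}
    (hy : y ∈ (e ≫ₕ c).target) (i j : Fin n) :
    coordForm B c y i j = coordMetric g (e ≫ₕ c) y i j := by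
  rw [OpenPartialHomeomorph.trans_target] at hy
  have hd : ∀ v : Euc n, mfderiv (𝓡 n) (𝓡 n) (e ≫ₕ c).symm y v
      = mfderiv (𝓡 n) (𝓡 n) e.symm (c.symm y) (mfderiv (𝓡 n) (𝓡 n) c.symm y v) := by
    intro v
    have h1 : MDifferentiableAt (𝓡 n) (𝓡 n) c.symm y :=
      (contMDiffAt_symm_of_mem_maximalAtlas hc hy.1).mdifferentiableAt (by simp)
    have h2 := mfderiv_comp y (he.mdifferentiableAt_symm hy.2) h1
    exact DFunLike.congr_fun h2 v
  simp only [coordForm, coordMetric]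
  rw [hB _ hy.2]
  exact congrArg₂ (fun a b => g.inner (e.symm (c.symm y)) a b) (hd _).symm (hd _).symm

lemma IsPiece.trans_mem_maximalAtlas {e : OpenPartialHomeomorph M N}
    (he : IsPiece (n := n) pr W e) {c : OpenPartialHomeomorph N (Euc n)}
    (hc : c ∈ IsManifold.maximalAtlas (𝓡 n) ∞ N) :
    e ≫ₕ c ∈ IsManifold.maximalAtlas (𝓡 n) ∞ M := by
  rw [IsManifold.mem_maximalAtlas_iff_contMDiffOn] at hc ⊢
  constructor
  · rw [OpenPartialHomeomorph.trans_source]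
    exact hc.1.comp (he.smooth.mono inter_subset_left) fun x hx => hx.2
  · rw [OpenPartialHomeomorph.trans_target]
    exact he.smooth_symm.comp (hc.2.mono inter_subset_left) fun x hx => hx.2

/-- The form at `q` is defined by one chosen piece. Any other piece gives the same form, because the
two local inverses differ by an isometric germ; continuity is then checked in a single piece near
each point. -/
lemma exists_descended_metric (h : IsSmoothEtale (n := n) pr W) (g : C0Metric n M)
    (hg : IsInvariantMetric g pr W) :
    ∃ k : C0Metric n N, ∀ e : OpenPartialHomeomorph M N, IsPiece (n := n) pr W e →
      ∀ q ∈ e.target, ∀ v w : TangentSpace (𝓡 n) q, k.inner q v w =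
        g.inner (e.symm q) (mfderiv (𝓡 n) (𝓡 n) e.symm q v)
          (mfderiv (𝓡 n) (𝓡 n) e.symm q w) := by
  have hex : ∀ q : N, ∃ E : OpenPartialHomeomorph M N, q ∈ E.target ∧ IsPiece (n := n) pr W E := by
    intro q
    obtain ⟨x, hx, rfl⟩ := h.surj q
    obtain ⟨e, hxe, he⟩ := h.exists_piece x hx
    exact ⟨e, he.coe_eq ▸ e.map_source hxe, he⟩
  choose E hET hE using hex
  obtain ⟨B, hBdef⟩ : ∃ B : ∀ q : N, TangentSpace (𝓡 n) q →L[ℝ] TangentSpace (𝓡 n) q →L[ℝ] ℝ,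
      ∀ q (v w : TangentSpace (𝓡 n) q), B q v w = g.inner ((E q).symm q)
        (mfderiv (𝓡 n) (𝓡 n) (E q).symm q v) (mfderiv (𝓡 n) (𝓡 n) (E q).symm q w) :=
    ⟨fun q => pullForm (g.inner ((E q).symm q)) (mfderiv (𝓡 n) (𝓡 n) (E q).symm q),
      fun q v w => rfl⟩
  have key : ∀ e : OpenPartialHomeomorph M N, IsPiece (n := n) pr W e →
      ∀ q ∈ e.target, ∀ v w : TangentSpace (𝓡 n) q, B q v w =
        g.inner (e.symm q) (mfderiv (𝓡 n) (𝓡 n) e.symm q v)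
          (mfderiv (𝓡 n) (𝓡 n) e.symm q w) := by
    intro e he q hq v w
    have hxs : (E q).symm q ∈ (E q).source := (E q).map_target (hET q)
    have hpx : pr ((E q).symm q) = q := by rw [← (hE q).coe_eq, (E q).right_inv (hET q)]
    have hys : e.symm q ∈ e.source := e.map_target hq
    have hpy : pr (e.symm q) = q := by rw [← he.coe_eq, e.right_inv hq]
    obtain ⟨τ, hτ, hτx, hτπ, hτg⟩ := hg _ ((hE q).subset hxs) _ (he.subset hys) (hpx.trans hpy.symm)
    have hev : e.symm =ᶠ[𝓝 q] τ ∘ (E q).symm := by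
      have h1 := eventuallyEq_symm_comp he.coe_eq hτ.continuousAt (hτx ▸ hys) hτπ
      have h2 := ((E q).continuousAt_symm (hET q)).eventually h1
      filter_upwards [h2, (E q).open_target.mem_nhds (hET q)] with p hp hpT
      rw [Function.comp_apply, ← hp, ← (hE q).coe_eq, (E q).right_inv hpT]
    have hd : ∀ v : Euc n, mfderiv (𝓡 n) (𝓡 n) e.symm q v
        = mfderiv (𝓡 n) (𝓡 n) τ ((E q).symm q) (mfderiv (𝓡 n) (𝓡 n) (E q).symm q v) := by
      intro v
      have h1 := hev.mfderiv_eq (I := 𝓡 n) (I' := 𝓡 n)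
      have h2 := mfderiv_comp q (hτ.mdifferentiableAt (by simp))
        ((hE q).mdifferentiableAt_symm (hET q))
      exact DFunLike.congr_fun (h1.trans h2) v
    rw [hBdef, ← hτg]
    refine (inner_congr g hτx _ _).trans ?_
    exact congrArg₂ (fun a b => g.inner (e.symm q) a b) (hd _).symm (hd _).symm
  refine ⟨metricOfCoord B (fun q v w => ?_) (fun q v hv => ?_) fun q i j => ?_, key⟩
  · rw [hBdef, hBdef]
    exact g.symm _ _ _
  · rw [hBdef]
    exact g.pos _ _ fun h0 => hv ((hE q).eq_zero_of_mfderiv_symm (hET q) h0)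
  · set c := chartAt (Euc n) q
    have hc : c ∈ IsManifold.maximalAtlas (𝓡 n) ∞ N := IsManifold.chart_mem_maximalAtlas q
    have hmem : c q ∈ (E q ≫ₕ c).target := by
      rw [OpenPartialHomeomorph.trans_target]
      refine ⟨mem_chart_target _ q, ?_⟩
      rw [mem_preimage, c.left_inv (mem_chart_source _ q)]
      exact hET q
    have h1 := (continuousOn_coordMetric g ((hE q).trans_mem_maximalAtlas hc) i j).continuousAt
      ((E q ≫ₕ c).open_target.mem_nhds hmem)
    refine h1.congr ?_
    filter_upwards [(E q ≫ₕ c).open_target.mem_nhds hmem] with y hy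
    exact (coordForm_of_eqOn_piece (hE q) (key (E q) (hE q)) hc hy i j).symm

end DescendMetric

/-! ### Transfer of local properties to étale quotients -/

section Sobolev

variable {n : ℕ} {p : ENNReal} {f f' : Euc n → ℝ} {V V' : Set (Euc n)}

lemma MemW1p.congr (hf : MemW1p p f V) (hV : IsOpen V) (h : EqOn f f' V) : MemW1p p f' V := by
  have hae : f =ᵐ[volume.restrict V] f' :=
    (ae_restrict_iff' hV.measurableSet).2 (Eventually.of_forall h)
  refine ⟨hf.1.ae_eq hae, fun k => ?_⟩
  obtain ⟨v, hv, hint⟩ := hf.2 k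
  refine ⟨v, hv, fun ψ h1 h2 h3 => ?_⟩
  rw [← hint ψ h1 h2 h3]
  exact (setIntegral_congr_fun hV.measurableSet fun y hy => by simp only [h hy]).symm

lemma MemW1p.mono (hf : MemW1p p f V) (hV : IsOpen V) (h : V' ⊆ V) :
    MemW1p p f V' := by
  have key : ∀ (a ψ : Euc n → ℝ), (∀ y ∉ V', ψ y = 0) →
      ∫ y in V', a y * ψ y = ∫ y in V, a y * ψ y := by
    intro a ψ hψ
    exact (setIntegral_eq_of_subset_of_forall_sdiff_eq_zero hV.measurableSet h
      fun y hy => by rw [hψ y hy.2, mul_zero]).symm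
  refine ⟨hf.1.mono_measure (Measure.restrict_mono h le_rfl), fun k => ?_⟩
  obtain ⟨v, hv, hint⟩ := hf.2 k
  refine ⟨v, hv.mono_measure (Measure.restrict_mono h le_rfl), fun ψ h1 h2 h3 => ?_⟩
  have hz : ∀ y ∉ V', ψ y = 0 := fun y hy => image_eq_zero_of_notMem_tsupport fun hy' => hy (h3 hy')
  have hz' : ∀ y ∉ V', pderiv k ψ y = 0 := fun y hy => by
    have : fderiv ℝ ψ y = 0 := by
      by_contra hne
      exact hy (h3 (support_fderiv_subset ℝ (f := ψ) hne))
    simp [pderiv, this]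
  rw [key f _ hz', key v _ hz, hint ψ h1 h2 (h3.trans h)]

/-- A function which is smooth near a point is in `W^{1,p}` near that point. -/
lemma exists_memW1p_of_contDiffOn {O : Set (Euc n)} (hO : IsOpen O) (hf : ContDiffOn ℝ ∞ f O)
    {y : Euc n} (hy : y ∈ O) : ∃ V ⊆ O, IsOpen V ∧ y ∈ V ∧ MemW1p p f V := by
  obtain ⟨r, hr, hrO⟩ := Metric.isOpen_iff.1 hO y hy
  -- Cutting off gives a compactly supported smooth function on all of `ℝⁿ`, for which the weak
  -- derivative identity is global integration by parts.
  let b : ContDiffBump y := ⟨r / 3, r / 2, by positivity, by linarith⟩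
  set F : Euc n → ℝ := fun z => b z * f z with hF
  have hFs : ContDiff ℝ ∞ F := by
    rw [contDiff_iff_contDiffAt]
    intro z
    by_cases hz : z ∈ O
    · exact b.contDiff.contDiffAt.mul (hf.contDiffAt (hO.mem_nhds hz))
    · have hzt : z ∉ tsupport b := by
        rw [b.tsupport_eq]
        intro h
        exact hz (hrO (Metric.closedBall_subset_ball (show r / 2 < r by linarith) h))
      have : F =ᶠ[𝓝 z] fun _ => 0 := by
        filter_upwards [(isClosed_tsupport b).isOpen_compl.mem_nhds hzt] with w hw
        simp [hF, image_eq_zero_of_notMem_tsupport hw]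
      exact contDiffAt_const.congr_of_eventuallyEq this
  have hFc : HasCompactSupport F := b.hasCompactSupport.mul_right
  set V := Metric.ball y (r / 3) with hV
  have hFf : EqOn F f V := fun z hz => by
    simp [hF, b.one_of_mem_closedBall (Metric.ball_subset_closedBall hz)]
  refine ⟨V, (Metric.ball_subset_ball (by linarith)).trans hrO, Metric.isOpen_ball,
    Metric.mem_ball_self (by positivity), ?_⟩
  suffices h : MemW1p p F V from h.congr Metric.isOpen_ball hFf
  have hFd : Continuous (fderiv ℝ F) := hFs.continuous_fderiv (by simp)
  refine ⟨(hFs.continuous.memLp_of_hasCompactSupport hFc).restrict V, fun k => ?_⟩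
  have hdc : Continuous (pderiv k F) := hFd.clm_apply continuous_const
  have hdcs : HasCompactSupport (pderiv k F) := hFc.fderiv_apply (𝕜 := ℝ) (basisVec n k)
  refine ⟨pderiv k F, (hdc.memLp_of_hasCompactSupport hdcs).restrict V, fun ψ h1 h2 h3 => ?_⟩
  have hψd : Continuous (pderiv k ψ) :=
    (h1.continuous_fderiv (by simp)).clm_apply continuous_const
  have hz : ∀ z ∉ V, ψ z = 0 := fun z hz => image_eq_zero_of_notMem_tsupport fun hz' => hz (h3 hz')
  have hz' : ∀ z ∉ V, pderiv k ψ z = 0 := fun z hz => by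
    have : fderiv ℝ ψ z = 0 := by
      by_contra hne
      exact hz (h3 (support_fderiv_subset ℝ (f := ψ) hne))
    simp [pderiv, this]
  rw [setIntegral_eq_integral_of_forall_compl_eq_zero fun z hzV => by rw [hz' z hzV, mul_zero],
    setIntegral_eq_integral_of_forall_compl_eq_zero fun z hzV => by rw [hz z hzV, mul_zero]]
  have hdψ : HasCompactSupport (pderiv k ψ) := h2.fderiv_apply (𝕜 := ℝ) (basisVec n k)
  exact integral_mul_fderiv_eq_neg_fderiv_mul_of_integrable
    ((hdc.mul h1.continuous).integrable_of_hasCompactSupport (h2.mul_left))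
    ((hFs.continuous.mul hψd).integrable_of_hasCompactSupport hdψ.mul_left)
    ((hFs.continuous.mul h1.continuous).integrable_of_hasCompactSupport (h2.mul_left))
    (fun z _ => hFs.differentiable (by simp) z) (fun z _ => h1.differentiable (by simp) z)

end Sobolev

/-! ### Regularity, singular sets, curvature and orientation under descent. -/

section Transfer

set_option linter.unusedSectionVars false

variable {n : ℕ} {M : Type*} [TopologicalSpace M] [ChartedSpace (Euc n) M]
  [IsManifold (𝓡 n) ∞ M] {N : Type*} [TopologicalSpace N] [ChartedSpace (Euc n) N]
  [IsManifold (𝓡 n) ∞ N] {pr : M → N} {W : Set M} {g : C0Metric n M} {k : C0Metric n N}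

/-- The metric `k` on `N` pulls back to `g` on `W`. -/
def IsDescended (g : C0Metric n M) (k : C0Metric n N) (pr : M → N) (W : Set M) : Prop :=
  ∀ e : OpenPartialHomeomorph M N, IsPiece (n := n) pr W e →
    ∀ q ∈ e.target, ∀ v w : TangentSpace (𝓡 n) q, k.inner q v w =
      g.inner (e.symm q) (mfderiv (𝓡 n) (𝓡 n) e.symm q v) (mfderiv (𝓡 n) (𝓡 n) e.symm q w)

lemma IsDescended.coordMetric_eq (hk : IsDescended g k pr W) {e : OpenPartialHomeomorph M N}
    (he : IsPiece (n := n) pr W e) {c : OpenPartialHomeomorph N (Euc n)}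
    (hc : c ∈ IsManifold.maximalAtlas (𝓡 n) ∞ N) {y : Euc n} (hy : y ∈ (e ≫ₕ c).target) :
    coordMetric k c y = coordMetric g (e ≫ₕ c) y := by
  ext i j
  exact coordForm_of_eqOn_piece he (hk e he) hc hy i j

lemma IsDescended.inner_mfderiv (hk : IsDescended g k pr W) (h : IsSmoothEtale (n := n) pr W)
    {x : M} (hx : x ∈ W) (v w : TangentSpace (𝓡 n) x) :
    k.inner (pr x) (mfderiv (𝓡 n) (𝓡 n) pr x v) (mfderiv (𝓡 n) (𝓡 n) pr x w) = g.inner x v w := by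
  obtain ⟨e, hxe, he⟩ := h.exists_piece x hx
  have hT : e x ∈ e.target := e.map_source hxe
  have hd := fun v => mfderiv_symm_apply_mfderiv e hxe (he.mdifferentiableAt hxe)
    (he.mdifferentiableAt_symm hT) v
  have h1 := hk e he (e x) hT (mfderiv (𝓡 n) (𝓡 n) e x v) (mfderiv (𝓡 n) (𝓡 n) e x w)
  have h2 : g.inner (e.symm (e x))
      (mfderiv (𝓡 n) (𝓡 n) e.symm (e x) (mfderiv (𝓡 n) (𝓡 n) e x v))
      (mfderiv (𝓡 n) (𝓡 n) e.symm (e x) (mfderiv (𝓡 n) (𝓡 n) e x w)) = g.inner x v w := by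
    refine (inner_congr g (e.left_inv hxe) _ _).trans ?_
    exact congrArg₂ (fun a b => g.inner x a b) (hd v) (hd w)
  rw [h2] at h1
  have he' := he.coe_eq
  subst he'
  exact h1

/-- Every point of `N` in the domain of a chart `c` is covered by a chart `e ≫ₕ c` of `M`. -/
lemma IsSmoothEtale.exists_trans (h : IsSmoothEtale (n := n) pr W) {x : M} (hx : x ∈ W)
    {c : OpenPartialHomeomorph N (Euc n)} {y : Euc n} (hy : y ∈ c.target) (hxy : pr x = c.symm y) :
    ∃ e : OpenPartialHomeomorph M N, IsPiece (n := n) pr W e ∧ y ∈ (e ≫ₕ c).target ∧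
      (e ≫ₕ c).symm y = x := by
  obtain ⟨e, hxe, he⟩ := h.exists_piece x hx
  have hex : e x = c.symm y := by rw [he.coe_eq, hxy]
  refine ⟨e, he, ?_, ?_⟩
  · rw [OpenPartialHomeomorph.trans_target]
    exact ⟨hy, by rw [mem_preimage, ← hex]; exact e.map_source hxe⟩
  · rw [OpenPartialHomeomorph.trans_symm_eq_symm_trans_symm, OpenPartialHomeomorph.coe_trans,
      Function.comp_apply, ← hex, e.left_inv hxe]

lemma IsDescended.isSmoothOn (hk : IsDescended g k pr W) (h : IsSmoothEtale (n := n) pr W)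
    {S : Set M} {T : Set N} (hS : IsClosed S) (hST : ∀ x ∈ W, x ∈ S → pr x ∈ T)
    (hg : IsSmoothOn g Sᶜ) : IsSmoothOn k Tᶜ := by
  intro c hc i j y hy
  obtain ⟨x, hx, hxy⟩ := h.surj (c.symm y)
  obtain ⟨e, he, hyT, hyx⟩ := h.exists_trans hx hy.1 hxy
  refine ContDiffAt.contDiffWithinAt ?_
  have hopen : IsOpen ((e ≫ₕ c).target ∩ (e ≫ₕ c).symm ⁻¹' Sᶜ) :=
    (e ≫ₕ c).isOpen_inter_preimage_symm hS.isOpen_compl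
  have hmem : y ∈ (e ≫ₕ c).target ∩ (e ≫ₕ c).symm ⁻¹' Sᶜ := by
    refine ⟨hyT, ?_⟩
    rw [mem_preimage, hyx]
    intro hxS
    exact hy.2 (by rw [← hxy]; exact hST x hx hxS)
  refine ((hg _ (he.trans_mem_maximalAtlas hc) i j).contDiffAt
    (hopen.mem_nhds hmem)).congr_of_eventuallyEq ?_
  filter_upwards [(e ≫ₕ c).open_target.mem_nhds hyT] with z hz
  rw [hk.coordMetric_eq he hc hz]

lemma IsDescended.isW1pLoc (hk : IsDescended g k pr W) (h : IsSmoothEtale (n := n) pr W)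
    {p : ENNReal} (hg : IsW1pLoc p g) : IsW1pLoc p k := by
  intro c hc i j y hy
  obtain ⟨x, hx, hxy⟩ := h.surj (c.symm y)
  obtain ⟨e, he, hyT, hyx⟩ := h.exists_trans hx hy hxy
  obtain ⟨V, hVo, hyV, hVT, hV⟩ := hg _ (he.trans_mem_maximalAtlas hc) i j y hyT
  refine ⟨V, hVo, hyV, hVT.trans ?_, hV.congr hVo fun z hz => ?_⟩
  · rw [OpenPartialHomeomorph.trans_target]; exact inter_subset_left
  · rw [hk.coordMetric_eq he hc (hVT hz)]

/-- In a chart `c` and its lift `e ≫ₕ c` the singular sets of `N` and `M` are literally the same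
subset of `ℝⁿ`, so Hausdorff measures need no distortion estimate. -/
lemma IsSmoothEtale.image_saturated {S : Set M} (hsat : ∀ x ∈ W, pr x ∈ pr '' S → x ∈ S)
    {e : OpenPartialHomeomorph M N} (he : IsPiece (n := n) pr W e)
    {c : OpenPartialHomeomorph N (Euc n)} {z : Euc n} (hz : z ∈ (e ≫ₕ c).target)
    (hzT : c.symm z ∈ pr '' S) : (e ≫ₕ c).symm z ∈ S := by
  rw [OpenPartialHomeomorph.trans_target] at hz
  have h1 : e.symm (c.symm z) ∈ e.source := e.map_target hz.2
  refine hsat _ (he.subset h1) ?_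
  have h2 : pr (e.symm (c.symm z)) = c.symm z := by rw [← he.coe_eq, e.right_inv hz.2]
  exact h2 ▸ hzT

/-- The part of the image in `K` is compact, hence covered by finitely many sets on which the bound
is that of `S` in a lifted chart. Closedness of the image is needed for this compactness. -/
lemma IsSmoothEtale.hausdorffLocFinite (h : IsSmoothEtale (n := n) pr W) {S : Set M}
    (hSW : S ⊆ W) (hsat : ∀ x ∈ W, pr x ∈ pr '' S → x ∈ S) (hT : IsClosed (pr '' S)) {d : ℝ}
    (hS : HausdorffLocFinite n d S) : HausdorffLocFinite n d (pr '' S) := by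
  intro c hc K hK hKc
  have hKT : IsCompact (K ∩ c.symm ⁻¹' (pr '' S)) := by
    refine hK.of_isClosed_subset ?_ inter_subset_left
    exact (c.continuousOn_symm.mono hKc).preimage_isClosed_of_isClosed hK.isClosed hT
  refine hKT.induction_on (p := fun A => μH[d] A < ⊤) (by simp)
    (fun A B hAB hB => (measure_mono hAB).trans_lt hB)
    (fun A B hA hB => (measure_union_le A B).trans_lt (ENNReal.add_lt_top.2 ⟨hA, hB⟩)) ?_
  rintro y ⟨hyK, x, hxS, hxy⟩
  obtain ⟨e, he, hyT, hyx⟩ := h.exists_trans (hSW hxS) (hKc hyK) hxy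
  obtain ⟨L, hL, hLT, hLc⟩ := local_compact_nhds ((e ≫ₕ c).open_target.mem_nhds hyT)
  refine ⟨L ∩ (K ∩ c.symm ⁻¹' (pr '' S)), inter_mem (mem_nhdsWithin_of_mem_nhds hL)
    self_mem_nhdsWithin, ?_⟩
  refine (measure_mono ?_).trans_lt (hS _ (he.trans_mem_maximalAtlas hc) L hLc hLT)
  exact fun z hz => ⟨hz.1, IsSmoothEtale.image_saturated hsat he (hLT hz.1) hz.2.2⟩

lemma IsSmoothEtale.hausdorffNull (h : IsSmoothEtale (n := n) pr W) {S : Set M}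
    (hSW : S ⊆ W) (hsat : ∀ x ∈ W, pr x ∈ pr '' S → x ∈ S) {d : ℝ}
    (hS : HausdorffNull n d S) : HausdorffNull n d (pr '' S) := by
  intro c hc
  refine measure_null_of_locally_null _ ?_
  rintro y ⟨hyc, x, hxS, hxy⟩
  obtain ⟨e, he, hyT, hyx⟩ := h.exists_trans (hSW hxS) hyc hxy
  refine ⟨(e ≫ₕ c).target ∩ (c.target ∩ c.symm ⁻¹' (pr '' S)), inter_mem
    (mem_nhdsWithin_of_mem_nhds ((e ≫ₕ c).open_target.mem_nhds hyT)) self_mem_nhdsWithin, ?_⟩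
  refine measure_mono_null ?_ (hS _ (he.trans_mem_maximalAtlas hc))
  exact fun z hz => ⟨hz.1, IsSmoothEtale.image_saturated hsat he hz.1 hz.2.2⟩

lemma IsDescended.hasSingularSet (hk : IsDescended g k pr W) (h : IsSmoothEtale (n := n) pr W)
    {S : Set M} (hSW : S ⊆ W) (hsat : ∀ x ∈ W, pr x ∈ pr '' S → x ∈ S)
    (hT : IsClosed (pr '' S)) {p : ENNReal} (hg : HasSingularSet p g S) :
    HasSingularSet p k (pr '' S) where
  isClosed := hT
  sobolev := hk.isW1pLoc h hg.sobolev
  smooth := hk.isSmoothOn h hg.isClosed (fun _ _ hx => mem_image_of_mem _ hx) hg.smooth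
  hausdorff_of_lt_top hp := h.hausdorffLocFinite hSW hsat hT (hg.hausdorff_of_lt_top hp)
  hausdorff_of_eq_top hp := h.hausdorffNull hSW hsat (hg.hausdorff_of_eq_top hp)

lemma coordMetric_congr (g : C0Metric n M) {c c' : OpenPartialHomeomorph M (Euc n)} {y : Euc n}
    (h : c.symm =ᶠ[𝓝 y] c'.symm) : coordMetric g c =ᶠ[𝓝 y] coordMetric g c' := by
  filter_upwards [h.eventuallyEq_nhds] with z hz
  ext i j
  have h1 : c.symm z = c'.symm z := hz.eq_of_nhds
  have h2 : ∀ v : Euc n, mfderiv (𝓡 n) (𝓡 n) c.symm z v = mfderiv (𝓡 n) (𝓡 n) c'.symm z v :=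
    fun v => DFunLike.congr_fun (hz.mfderiv_eq (I := 𝓡 n) (I' := 𝓡 n)) v
  simp only [coordMetric]
  refine (inner_congr g h1 _ _).trans ?_
  exact congrArg₂ (fun a b => g.inner (c'.symm z) a b) (h2 _) (h2 _)

/-- The scalar curvature of a descended metric is computed upstairs. -/
lemma IsDescended.scalarCurv_eq (hk : IsDescended g k pr W) {e : OpenPartialHomeomorph M N}
    (he : IsPiece (n := n) pr W e) {x : M} (hx : x ∈ e.source) {c : OpenPartialHomeomorph M (Euc n)}
    (hxc : x ∈ c.source) (hchart : chartAt (Euc n) (pr x) = e.symm ≫ₕ c) :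
    scalarCurv k (pr x) = scalarCoord (coordMetric g c) (c x) := by
  have hcx : chartAt (Euc n) (pr x) (pr x) = c x := by
    rw [hchart, OpenPartialHomeomorph.coe_trans, Function.comp_apply, ← he.coe_eq, e.left_inv hx]
  have hatl : e.symm ≫ₕ c ∈ IsManifold.maximalAtlas (𝓡 n) ∞ N :=
    hchart ▸ IsManifold.chart_mem_maximalAtlas (pr x)
  have hmem : c x ∈ (e ≫ₕ (e.symm ≫ₕ c)).target := by
    simp only [mfld_simps, c.map_source hxc, c.left_inv hxc, hx, e.map_source hx]
  rw [scalarCurv, hcx, hchart]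
  refine scalarCoord_congr ?_
  have h1 : coordMetric k (e.symm ≫ₕ c) =ᶠ[𝓝 (c x)] coordMetric g (e ≫ₕ (e.symm ≫ₕ c)) := by
    filter_upwards [(e ≫ₕ (e.symm ≫ₕ c)).open_target.mem_nhds hmem] with z hz
    exact hk.coordMetric_eq he hatl hz
  refine h1.trans (coordMetric_congr g ?_)
  have h2 : ∀ᶠ z in 𝓝 (c x), c.symm z ∈ e.source :=
    (c.continuousAt_symm (c.map_source hxc)).eventually
      (e.open_source.mem_nhds (by rwa [c.left_inv hxc]))
  filter_upwards [h2] with z hz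
  simp only [mfld_simps, e.left_inv hz]

lemma IsPiece.symm_trans_mem_maximalAtlas {e : OpenPartialHomeomorph M N}
    (he : IsPiece (n := n) pr W e) {c : OpenPartialHomeomorph M (Euc n)}
    (hc : c ∈ IsManifold.maximalAtlas (𝓡 n) ∞ M) :
    e.symm ≫ₕ c ∈ IsManifold.maximalAtlas (𝓡 n) ∞ N := by
  rw [IsManifold.mem_maximalAtlas_iff_contMDiffOn] at hc ⊢
  constructor
  · rw [OpenPartialHomeomorph.trans_source]
    exact hc.1.comp (he.smooth_symm.mono inter_subset_left) fun x hx => hx.2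
  · rw [OpenPartialHomeomorph.trans_target]
    exact he.smooth.comp (hc.2.mono inter_subset_left) fun x hx => hx.2

/-- The charts are local inverses of `pr` followed by oriented charts upstairs; near a point their
transitions are `a' ∘ τ ∘ a.symm`, with `τ` the germ relating the two lifts. -/
lemma IsSmoothEtale.isOrientable (h : IsSmoothEtale (n := n) pr W)
    {A : Set (OpenPartialHomeomorph M (Euc n))} (hA : A ⊆ IsManifold.maximalAtlas (𝓡 n) ∞ M)
    (hcov : ∀ x : M, ∃ a ∈ A, x ∈ a.source)
    (hτ : ∀ x ∈ W, ∀ y ∈ W, pr x = pr y → ∃ τ : M → M, ContinuousAt τ x ∧ τ x = y ∧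
      (∀ᶠ z in 𝓝 x, pr (τ z) = pr z) ∧ ∀ a ∈ A, ∀ a' ∈ A, x ∈ a.source → y ∈ a'.source →
        0 < (fderiv ℝ (a' ∘ τ ∘ a.symm) (a x)).det) :
    IsOrientable n N := by
  refine ⟨{b | ∃ e : OpenPartialHomeomorph M N, IsPiece (n := n) pr W e ∧
    ∃ a ∈ A, b = e.symm ≫ₕ a}, ?_, ?_, ?_⟩
  · rintro _ ⟨e, he, a, ha, rfl⟩
    exact he.symm_trans_mem_maximalAtlas (hA ha)
  · intro q
    obtain ⟨x, hx, rfl⟩ := h.surj q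
    obtain ⟨e, hxe, he⟩ := h.exists_piece x hx
    obtain ⟨a, ha, hxa⟩ := hcov x
    refine ⟨_, ⟨e, he, a, ha, rfl⟩, ?_⟩
    rw [OpenPartialHomeomorph.trans_source, ← he.coe_eq]
    refine ⟨e.map_source hxe, ?_⟩
    rwa [mem_preimage, e.left_inv hxe]
  · rintro _ ⟨e, he, a, ha, rfl⟩ _ ⟨e', he', a', ha', rfl⟩ q ⟨hq, hq'⟩
    rw [OpenPartialHomeomorph.trans_source] at hq hq'
    have hxs : e.symm q ∈ e.source := e.map_target hq.1
    have hys : e'.symm q ∈ e'.source := e'.map_target hq'.1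
    have hpx : pr (e.symm q) = q := by rw [← he.coe_eq]; exact e.right_inv hq.1
    have hpy : pr (e'.symm q) = q := by rw [← he'.coe_eq]; exact e'.right_inv hq'.1
    obtain ⟨τ, hτc, hτx, hτpr, hdet⟩ :=
      hτ _ (he.subset hxs) _ (he'.subset hys) (hpx.trans hpy.symm)
    have h1 := hdet a ha a' ha' hq.2 hq'.2
    have h2 := eventuallyEq_symm_comp he'.coe_eq hτc (hτx ▸ hys) hτpr
    have h3 : ((e'.symm ≫ₕ a') ∘ (e.symm ≫ₕ a).symm) =ᶠ[𝓝 (a (e.symm q))] (a' ∘ τ ∘ a.symm) := by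
      have h4 := (a.continuousAt_symm (a.map_source hq.2)).eventually
        (by rw [a.left_inv hq.2]; exact h2)
      filter_upwards [h4] with z hz
      simp only [mfld_simps, ← hz, he.coe_eq]
    have h5 : (e.symm ≫ₕ a) q = a (e.symm q) := rfl
    rw [h5, h3.fderiv_eq]
    exact h1

end Transfer

/-! ### Conformal change of a metric by a smooth factor. -/

section Scale

variable {n : ℕ} {M : Type*} [TopologicalSpace M] [ChartedSpace (Euc n) M]
  [IsManifold (𝓡 n) ∞ M] {g : C0Metric n M} {κ : M → ℝ} (hκ : Continuous κ) (hpos : ∀ x, 0 < κ x)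

lemma isSmoothOn_scaleMetric {U : Set M} (hU : IsOpen U) (hg : IsSmoothOn g U)
    (hκs : ∀ x ∈ U, ContMDiffAt (𝓡 n) 𝓘(ℝ, ℝ) ∞ κ x) :
    IsSmoothOn (scaleMetric g κ hκ hpos) U := by
  intro c hc i j y hy
  have hs : ContMDiffAt (𝓡 n) (𝓡 n) ∞ c.symm y := contMDiffAt_symm_of_mem_maximalAtlas hc hy.1
  have h1 : ContDiffAt ℝ ∞ (fun y => κ (c.symm y)) y := by
    rw [← contMDiffAt_iff_contDiffAt]
    exact (hκs _ hy.2).comp y hs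
  have h2 := (hg c hc i j).contDiffAt ((c.isOpen_inter_preimage_symm hU).mem_nhds hy)
  exact (h1.mul h2).contDiffWithinAt

/-- Near `S` the factor is `1` and nothing changes; off `S` the new metric is smooth, hence locally
`W^{1,p}`. -/
lemma hasSingularSet_scaleMetric {S : Set M} {p : ENNReal} (hg : HasSingularSet p g S)
    (hκS : ∀ x ∈ S, κ =ᶠ[𝓝 x] 1) (hκs : ∀ x, ContMDiffAt (𝓡 n) 𝓘(ℝ, ℝ) ∞ κ x) :
    HasSingularSet p (scaleMetric g κ hκ hpos) S := by
  have hsm := isSmoothOn_scaleMetric hκ hpos hg.isClosed.isOpen_compl hg.smooth fun x _ => hκs x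
  refine ⟨hg.isClosed, fun c hc i j y hy => ?_, hsm, hg.hausdorff_of_lt_top,
    hg.hausdorff_of_eq_top⟩
  by_cases hyS : c.symm y ∈ S
  · obtain ⟨V, hVo, hyV, hVT, hV⟩ := hg.sobolev c hc i j y hy
    have h1 : ∀ᶠ z in 𝓝 y, κ (c.symm z) = 1 := (c.continuousAt_symm hy).eventually (hκS _ hyS)
    obtain ⟨O, hO, hOo, hyO⟩ := eventually_nhds_iff.1 h1
    refine ⟨V ∩ O, hVo.inter hOo, ⟨hyV, hyO⟩, inter_subset_left.trans hVT,
      (hV.mono hVo inter_subset_left).congr (hVo.inter hOo) fun z hz => ?_⟩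
    rw [coordMetric_scaleMetric, hO z hz.2, one_smul]
  · obtain ⟨V, hVO, hVo, hyV, hV⟩ := exists_memW1p_of_contDiffOn (p := p)
      (c.isOpen_inter_preimage_symm hg.isClosed.isOpen_compl) (hsm c hc i j) ⟨hy, hyS⟩
    exact ⟨V, hVo, hyV, hVO.trans inter_subset_left, hV⟩

end Scale

/-! ### The lattice -/

section Lattice

variable {n : ℕ} {L : ℝ}

/-- The point of the lattice `L ℤⁿ` with coordinates `k`. -/
def latVec (L : ℝ) (k : Fin n → ℤ) : Euc n := L • WithLp.toLp 2 (fun i => (k i : ℝ))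

lemma latVec_apply (k : Fin n → ℤ) (i : Fin n) : latVec L k i = L * k i := by
  simp [latVec]

lemma latVec_zero : latVec L (0 : Fin n → ℤ) = 0 := by
  ext i; simp [latVec_apply]

lemma latVec_add (k l : Fin n → ℤ) : latVec L (k + l) = latVec L k + latVec L l := by
  ext i; simp [latVec_apply, mul_add]

lemma latVec_neg (k : Fin n → ℤ) : latVec L (-k) = -latVec L k := by
  ext i; simp [latVec_apply]

lemma latVec_sub (k l : Fin n → ℤ) : latVec L (k - l) = latVec L k - latVec L l := by
  ext i; simp [latVec_apply, mul_sub]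

lemma le_norm_latVec (hL : 0 < L) {k : Fin n → ℤ} (hk : k ≠ 0) : L ≤ ‖latVec L k‖ := by
  obtain ⟨i, hi⟩ := Function.ne_iff.1 hk
  have h1 : ‖latVec L k i‖ ≤ ‖latVec L k‖ := PiLp.norm_apply_le _ i
  rw [latVec_apply, norm_mul, Real.norm_of_nonneg hL.le, Real.norm_eq_abs] at h1
  have h2 : (1 : ℝ) ≤ |(k i : ℝ)| := by exact_mod_cast Int.one_le_abs hi
  nlinarith

lemma pairwise_le_dist_latVec (hL : 0 < L) (s : Set (Fin n → ℤ)) :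
    (latVec L '' s).Pairwise fun x y => L ≤ dist x y := by
  rintro _ ⟨k, _, rfl⟩ _ ⟨l, _, rfl⟩ hne
  rw [dist_eq_norm, ← latVec_sub]
  exact le_norm_latVec hL fun h => hne (by rw [sub_eq_zero.1 h])

lemma isClosed_image_latVec (hL : 0 < L) (s : Set (Fin n → ℤ)) : IsClosed (latVec L '' s) :=
  Metric.isClosed_of_pairwise_le_dist hL (pairwise_le_dist_latVec hL s)

/-- The closed cube of side `L` about the origin. -/
def cube (n : ℕ) (L : ℝ) : Set (Euc n) := {z | ∀ i, |z i| ≤ L / 2}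

lemma isCompact_cube : IsCompact (cube n L) := by
  refine Metric.isCompact_of_isClosed_isBounded ?_ ?_
  · rw [cube, ofPred_forall]
    exact isClosed_iInter fun i => isClosed_le (by fun_prop) continuous_const
  · refine (Metric.isBounded_closedBall (x := (0 : Euc n)) (r := √(n * (L / 2) ^ 2))).subset ?_
    intro z hz
    rw [mem_closedBall_zero_iff, EuclideanSpace.norm_eq]
    refine Real.sqrt_le_sqrt ?_
    calc ∑ i, ‖z i‖ ^ 2 ≤ ∑ _i : Fin n, (L / 2) ^ 2 := by
          refine Finset.sum_le_sum fun i _ => ?_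
          exact pow_le_pow_left₀ (norm_nonneg _) (hz i) 2
      _ = n * (L / 2) ^ 2 := by simp

/-- The cube is the Voronoi cell of the origin: in each coordinate, a nonzero shift by a multiple of
`L` cannot decrease an absolute value that is at most `L / 2`. -/
lemma norm_le_norm_sub_latVec (hL : 0 < L) {z : Euc n} (hz : z ∈ cube n L) (k : Fin n → ℤ) :
    ‖z‖ ≤ ‖z - latVec L k‖ := by
  rw [EuclideanSpace.norm_eq, EuclideanSpace.norm_eq]
  refine Real.sqrt_le_sqrt (Finset.sum_le_sum fun i _ => ?_)
  refine pow_le_pow_left₀ (norm_nonneg _) ?_ 2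
  rw [PiLp.sub_apply, latVec_apply, Real.norm_eq_abs, Real.norm_eq_abs]
  rcases eq_or_ne (k i) 0 with h | h
  · simp [h]
  · have h2 : (1 : ℝ) ≤ |(k i : ℝ)| := by exact_mod_cast Int.one_le_abs h
    have h3 : |L * (k i : ℝ)| - |z i| ≤ |z i - L * k i| := by
      rw [abs_sub_comm]; exact abs_sub_abs_le_abs_sub _ _
    rw [abs_mul, abs_of_pos hL] at h3
    have h4 := hz i
    nlinarith

/-- Otherwise `z` would be within `a` of the origin as well, and the lattice vector would have
length at most `2a < L`. -/
lemma lt_norm_sub_latVec_of_mem_cube {a : ℝ} (hL : 0 < L) (ha : 2 * a < L) {z : Euc n}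
    (hz : z ∈ cube n L) {k : Fin n → ℤ} (hk : k ≠ 0) : a < ‖z - latVec L k‖ := by
  have h1 := norm_le_norm_sub_latVec hL hz k
  have h2 := le_norm_latVec hL hk
  have h3 : ‖latVec L k‖ ≤ ‖z‖ + ‖z - latVec L k‖ := by
    calc ‖latVec L k‖ = ‖z - (z - latVec L k)‖ := by congr 1; abel
      _ ≤ _ := norm_sub_le _ _
  linarith

lemma exists_sub_latVec_mem_cube (hL : 0 < L) (z : Euc n) :
    ∃ k : Fin n → ℤ, z - latVec L k ∈ cube n L := by
  refine ⟨fun i => round (z i / L), fun i => ?_⟩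
  rw [PiLp.sub_apply, latVec_apply]
  have h1 := abs_sub_round (z i / L)
  have h2 : z i - L * round (z i / L) = L * (z i / L - round (z i / L)) := by
    field_simp
  rw [h2, abs_mul, abs_of_pos hL]
  nlinarith

lemma mem_cube_of_norm_le {z : Euc n} (hz : ‖z‖ ≤ L / 2) : z ∈ cube n L := fun i =>
  (PiLp.norm_apply_le z i).trans hz

lemma smul_mem_cube {z : Euc n} (hz : z ∈ cube n L) {t : ℝ} (h0 : 0 ≤ t) (h1 : t ≤ 1) :
    t • z ∈ cube n L := fun i => by
  rw [PiLp.smul_apply, smul_eq_mul, abs_mul, abs_of_nonneg h0]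
  exact (mul_le_of_le_one_left (abs_nonneg _) h1).trans (hz i)

end Lattice

/-! ### Gluing a torus to an end -/

section Glue

variable {n : ℕ} {M : Type u} [TopologicalSpace M] {φ : OpenPartialHomeomorph M (Euc n)} {a L : ℝ}

/-- The complement in `M` of the preimages of the closed balls of radius `a` about the nonzero
points of the lattice `L ℤⁿ`. -/
def glueDomain (φ : OpenPartialHomeomorph M (Euc n)) (a L : ℝ) : Set M :=
  {x | x ∈ φ.source → ∀ k : Fin n → ℤ, k ≠ 0 → a < ‖φ x - latVec L k‖}

/-- Translation of the end by a lattice vector. -/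
def endShift (φ : OpenPartialHomeomorph M (Euc n)) (L : ℝ) (k : Fin n → ℤ) (x : M) : M :=
  φ.symm (φ x + latVec L k)

/-- The part of `M` on which the lattice acts. -/
def periodicPart (φ : OpenPartialHomeomorph M (Euc n)) (a L : ℝ) : Set M :=
  {x | x ∈ φ.source ∧ ∀ k : Fin n → ℤ, a < ‖φ x - latVec L k‖}

/-- The set `{r ≥ s}` for `s > 1` is closed, as appropriate for an end, and the lattice is coarse
enough for the balls of radius `a` about its points to be disjoint. -/
structure IsGlueable (φ : OpenPartialHomeomorph M (Euc n)) (a L : ℝ) : Prop where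
  target_eq : φ.target = {y : Euc n | 1 < ‖y‖}
  isClosed_endRegion : ∀ s : ℝ, 1 < s → IsClosed {x | x ∈ φ.source ∧ s ≤ ‖φ x‖}
  one_lt : 1 < a
  lt : 2 * a < L

namespace IsGlueable

lemma L_pos (h : IsGlueable φ a L) : 0 < L := by
  have := h.one_lt
  have := h.lt
  linarith

/-- `φ` is continuous only on its source; closedness in `M` comes from `{r ≥ s}` being closed there.
-/
lemma isClosed_inter_preimage (h : IsGlueable φ a L) {s : ℝ} (hs : 1 < s) {D : Set (Euc n)}
    (hD : IsClosed D) : IsClosed ({x | x ∈ φ.source ∧ s ≤ ‖φ x‖} ∩ φ ⁻¹' D) :=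
  (φ.continuousOn.mono fun _ hx => hx.1).preimage_isClosed_of_isClosed
    (h.isClosed_endRegion s hs) hD

/-- An infinite union of balls, closed because it is the closed thickening of a closed, uniformly
discrete set. -/
lemma isClosed_balls (h : IsGlueable φ a L) (s : Set (Fin n → ℤ)) :
    IsClosed {z : Euc n | ∃ k ∈ s, ‖z - latVec L k‖ ≤ a} := by
  have h1 := (isClosed_image_latVec (n := n) h.L_pos s).cthickening_eq_biUnion_closedBall
    (δ := a) (by linarith [h.one_lt])
  have h2 : {z : Euc n | ∃ k ∈ s, ‖z - latVec L k‖ ≤ a} = Metric.cthickening a (latVec L '' s) := by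
    rw [h1]
    ext z
    simp [dist_eq_norm]
  rw [h2]
  exact Metric.isClosed_cthickening

lemma isOpen_glueDomain (h : IsGlueable φ a L) : IsOpen (glueDomain φ a L) := by
  have h1 := h.isClosed_inter_preimage h.one_lt (h.isClosed_balls {k | k ≠ 0})
  rw [← isClosed_compl_iff]
  convert h1 using 1
  ext x
  simp only [glueDomain, mem_compl_iff, mem_ofPred_eq, mem_inter_iff, mem_preimage]
  push Not
  constructor
  · rintro ⟨hx, k, hk, hle⟩
    refine ⟨⟨hx, ?_⟩, k, hk, hle⟩
    -- The removed balls lie in `{r ≥ a}` because `L > 2a`; this part of the end is closed in `M`.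
    have h2 := le_norm_latVec h.L_pos hk
    have h3 : ‖latVec L k‖ ≤ ‖φ x‖ + ‖φ x - latVec L k‖ := by
      calc ‖latVec L k‖ = ‖φ x - (φ x - latVec L k)‖ := by congr 1; abel
        _ ≤ _ := norm_sub_le _ _
    linarith [h.lt]
  · rintro ⟨hx, k, hk, hle⟩
    exact ⟨hx.1, k, hk, hle⟩

lemma isOpen_periodicPart (h : IsGlueable φ a L) : IsOpen (periodicPart φ a L) := by
  have h1 := φ.isOpen_inter_preimage (h.isClosed_balls univ).isOpen_compl
  convert h1 using 1
  ext x
  simp [periodicPart]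

lemma lt_norm_of_mem_periodicPart {x : M} (hx : x ∈ periodicPart φ a L) : a < ‖φ x‖ := by
  have := hx.2 0
  rwa [latVec_zero, sub_zero] at this

lemma periodicPart_subset : periodicPart φ a L ⊆ glueDomain φ a L :=
  fun _ hx _ k _ => hx.2 k

lemma add_mem_target (h : IsGlueable φ a L) {x : M} (hx : x ∈ periodicPart φ a L)
    (k : Fin n → ℤ) : φ x + latVec L k ∈ φ.target := by
  have h1 := hx.2 (-k)
  rw [latVec_neg, sub_neg_eq_add] at h1
  rw [h.target_eq]
  exact h.one_lt.trans h1

lemma apply_endShift (h : IsGlueable φ a L) {x : M} (hx : x ∈ periodicPart φ a L)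
    (k : Fin n → ℤ) : φ (endShift φ L k x) = φ x + latVec L k :=
  φ.right_inv (h.add_mem_target hx k)

lemma endShift_mem (h : IsGlueable φ a L) {x : M} (hx : x ∈ periodicPart φ a L)
    (k : Fin n → ℤ) : endShift φ L k x ∈ periodicPart φ a L := by
  refine ⟨φ.map_target (h.add_mem_target hx k), fun l => ?_⟩
  rw [h.apply_endShift hx k]
  have h1 := hx.2 (l - k)
  rwa [latVec_sub, ← sub_add, sub_add_eq_add_sub] at h1

lemma continuousOn_endShift (h : IsGlueable φ a L) (k : Fin n → ℤ) :
    ContinuousOn (endShift φ L k) (periodicPart φ a L) :=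
  φ.continuousOn_symm.comp ((φ.continuousOn.mono fun _ hx => hx.1).add continuousOn_const)
    fun _ hx => h.add_mem_target hx k

end IsGlueable

/-- Points of the end are related if they differ by a lattice vector. -/
def glueRel (φ : OpenPartialHomeomorph M (Euc n)) (a L : ℝ) (x y : M) : Prop :=
  x = y ∨ ((x ∈ φ.source ∧ a ≤ ‖φ x‖) ∧ (y ∈ φ.source ∧ a ≤ ‖φ y‖) ∧
    ∃ k : Fin n → ℤ, φ y = φ x + latVec L k)

lemma glueRel.symm {x y : M} (h : glueRel φ a L x y) : glueRel φ a L y x := by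
  rcases h with rfl | ⟨h1, h2, k, hk⟩
  · exact Or.inl rfl
  · exact Or.inr ⟨h2, h1, -k, by rw [hk, latVec_neg, add_neg_cancel_right]⟩

lemma glueRel.trans {x y z : M} (h : glueRel φ a L x y) (h' : glueRel φ a L y z) :
    glueRel φ a L x z := by
  rcases h with rfl | ⟨h1, h2, k, hk⟩
  · exact h'
  rcases h' with rfl | ⟨h3, h4, l, hl⟩
  · exact Or.inr ⟨h1, h2, k, hk⟩
  · exact Or.inr ⟨h1, h4, k + l, by rw [hl, hk, latVec_add, add_assoc]⟩

/-- On the glueing domain, distinct related points are in the periodic part. -/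
lemma glueRel.cases {x y : M} (hx : x ∈ glueDomain φ a L) (hy : y ∈ glueDomain φ a L)
    (h : glueRel φ a L x y) : x = y ∨ (x ∈ periodicPart φ a L ∧
      ∃ k : Fin n → ℤ, y = endShift φ L k x) := by
  rcases h with rfl | ⟨h1, h2, k, hk⟩
  · exact Or.inl rfl
  rcases eq_or_ne k 0 with rfl | hk0
  · rw [latVec_zero, add_zero] at hk
    exact Or.inl (φ.injOn h1.1 h2.1 hk.symm)
  · refine Or.inr ⟨⟨h1.1, fun l => ?_⟩, k, ?_⟩
    -- For the ball about the origin, the distance of `φ x` from `0` is that of `φ y` from the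
    -- nonzero lattice point `k`, which exceeds `a` as `y` is in the domain.
    · rcases eq_or_ne l 0 with rfl | hl
      · have := hy h2.1 k hk0
        rwa [hk, add_sub_cancel_right, ← sub_zero (φ x), ← latVec_zero (L := L)] at this
      · exact hx h1.1 l hl
    · rw [endShift, ← hk, φ.left_inv h2.1]

lemma IsGlueable.glueRel_endShift (h : IsGlueable φ a L) {x : M} (hx : x ∈ periodicPart φ a L)
    (k : Fin n → ℤ) : glueRel φ a L x (endShift φ L k x) := by
  have h1 := h.endShift_mem hx k
  exact Or.inr ⟨⟨hx.1, (IsGlueable.lt_norm_of_mem_periodicPart hx).le⟩,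
    ⟨h1.1, (IsGlueable.lt_norm_of_mem_periodicPart h1).le⟩, k, h.apply_endShift hx k⟩

variable {N : Type*} [TopologicalSpace N] {pr : M → N}

/-- `pr` exhibits `N` as the quotient of the glueing domain. -/
structure IsGlueQuotient (φ : OpenPartialHomeomorph M (Euc n)) (a L : ℝ) (pr : M → N) : Prop where
  surj : ∀ q, ∃ x ∈ glueDomain φ a L, pr x = q
  continuousOn : ContinuousOn pr (glueDomain φ a L)
  isOpen_image : ∀ V ⊆ glueDomain φ a L, IsOpen V → IsOpen (pr '' V)
  eq_iff : ∀ x ∈ glueDomain φ a L, ∀ y ∈ glueDomain φ a L, pr x = pr y ↔ glueRel φ a L x y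

theorem IsGlueable.exists_quotient (h : IsGlueable φ a L) (hne : (glueDomain φ a L).Nonempty) :
    ∃ (N : Type u) (_ : TopologicalSpace N) (pr : M → N), IsGlueQuotient φ a L pr := by
  let W := glueDomain φ a L
  let st : Setoid W :=
    { r := fun x y => glueRel φ a L x y
      iseqv := ⟨fun _ => Or.inl rfl, fun h => h.symm, fun h h' => h.trans h'⟩ }
  have hW : Nonempty W := hne.to_subtype
  classical
  -- The value off `W` is arbitrary; it makes the projection a function on `M`, as local
  -- homeomorphisms between `M` and the quotient require.
  let pr : M → Quotient st := fun x => if hx : x ∈ W then ⟦⟨x, hx⟩⟧ else ⟦Classical.choice hW⟧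
  have hpr : ∀ x (hx : x ∈ W), pr x = ⟦⟨x, hx⟩⟧ := fun x hx => dif_pos hx
  have heq : ∀ x ∈ W, ∀ y ∈ W, pr x = pr y ↔ glueRel φ a L x y := by
    intro x hx y hy
    rw [hpr x hx, hpr y hy]
    exact Quotient.eq (r := st)
  refine ⟨Quotient st, inferInstance, pr, fun q => ?_, ?_, fun V hVW hV => ?_, heq⟩
  · obtain ⟨⟨x, hx⟩, rfl⟩ := Quotient.exists_rep q
    exact ⟨x, hx, hpr x hx⟩
  · rw [continuousOn_iff_continuous_domRestrict]
    have : W.domRestrict pr = fun x => ⟦x⟧ := funext fun x => hpr x x.2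
    rw [this]
    exact continuous_quotient_mk'
  · rw [← (isQuotientMap_quotient_mk' (s := st)).isOpen_preimage]
    -- The saturation of `V` is its union with the preimages of `V` under the translations, which
    -- are continuous on the open periodic part.
    have hsat : (Quotient.mk st) ⁻¹' (pr '' V) = Subtype.val ⁻¹' (V ∪ ⋃ k : Fin n → ℤ,
        periodicPart φ a L ∩ endShift φ L k ⁻¹' V) := by
      ext ⟨y, hy⟩
      simp only [mem_preimage, mem_image, mem_union, mem_iUnion, mem_inter_iff]
      rw [← hpr y hy]
      constructor
      · rintro ⟨x, hxV, hxy⟩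
        rcases (((heq x (hVW hxV) y hy).1 hxy).symm).cases hy (hVW hxV) with rfl | ⟨h1, k, rfl⟩
        · exact Or.inl hxV
        · exact Or.inr ⟨k, h1, hxV⟩
      · rintro (hyV | ⟨k, h1, h2⟩)
        · exact ⟨y, hyV, rfl⟩
        · exact ⟨_, h2, (heq _ (hVW h2) y hy).2 (h.glueRel_endShift h1 k).symm⟩
    rw [show (Quotient.mk' : W → Quotient st) = Quotient.mk st from rfl, hsat]
    refine IsOpen.preimage continuous_subtype_val (hV.union (isOpen_iUnion fun k => ?_))
    exact (h.continuousOn_endShift k).isOpen_inter_preimage h.isOpen_periodicPart hV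

end Glue

/-! ### Topology of the glued space. -/

section GlueTopology

variable {n : ℕ} {M : Type u} [TopologicalSpace M] {φ : OpenPartialHomeomorph M (Euc n)} {a L : ℝ}
  {N : Type*} [TopologicalSpace N] {pr : M → N}

namespace IsGlueQuotient

lemma eq_of_notMem (hq : IsGlueQuotient φ a L pr) {x y : M} (hx : x ∈ glueDomain φ a L)
    (hy : y ∈ glueDomain φ a L) (hxa : ¬ (x ∈ φ.source ∧ a ≤ ‖φ x‖)) (hxy : pr x = pr y) :
    x = y := by
  rcases (hq.eq_iff x hx y hy).1 hxy with h | h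
  · exact h
  · exact absurd h.1 hxa

lemma isOpenQuotientMap (hq : IsGlueQuotient φ a L pr) (h : IsGlueable φ a L) :
    IsOpenQuotientMap ((glueDomain φ a L).domRestrict pr) := by
  refine ⟨fun q => ?_, continuousOn_iff_continuous_domRestrict.1 hq.continuousOn, fun V hV => ?_⟩
  · obtain ⟨x, hx, hxq⟩ := hq.surj q
    exact ⟨⟨x, hx⟩, hxq⟩
  · have h1 : (glueDomain φ a L).domRestrict pr '' V = pr '' (Subtype.val '' V) := by
      rw [image_image]; rfl
    rw [h1]
    refine hq.isOpen_image _ ?_ (h.isOpen_glueDomain.isOpenMap_subtype_val V hV)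
    rintro _ ⟨x, _, rfl⟩
    exact x.2

lemma secondCountableTopology [SecondCountableTopology M] (hq : IsGlueQuotient φ a L pr)
    (h : IsGlueable φ a L) : SecondCountableTopology N :=
  (hq.isOpenQuotientMap h).isQuotientMap.secondCountableTopology (hq.isOpenQuotientMap h).isOpenMap

/-- For an open quotient map it suffices that the relation is closed. It is the diagonal together
with the pairs in `{r ≥ a}` whose difference lies in the closed set `L ℤⁿ`; this is why the relation
is stated with `a ≤ ‖φ x‖`. -/
lemma t2Space [T2Space M] (hq : IsGlueQuotient φ a L pr) (h : IsGlueable φ a L) : T2Space N := by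
  rw [t2Space_iff_of_isOpenQuotientMap (hq.isOpenQuotientMap h)]
  have hF := h.isClosed_endRegion a h.one_lt
  set F : Set M := {x | x ∈ φ.source ∧ a ≤ ‖φ x‖}
  have h1 : IsClosed ((F ×ˢ F) ∩ (fun p : M × M => φ p.2 - φ p.1) ⁻¹' (latVec L '' univ)) := by
    have hc : ContinuousOn φ F := φ.continuousOn.mono fun _ hx => hx.1
    refine ContinuousOn.preimage_isClosed_of_isClosed ?_ (hF.prod hF)
      (isClosed_image_latVec h.L_pos univ)
    exact (hc.comp continuousOn_snd fun p hp => hp.2).sub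
      (hc.comp continuousOn_fst fun p hp => hp.1)
  have h2 : {q : glueDomain φ a L × glueDomain φ a L |
      (glueDomain φ a L).domRestrict pr q.1 = (glueDomain φ a L).domRestrict pr q.2}
      = (fun q => ((q.1 : M), (q.2 : M))) ⁻¹' (diagonal M ∪
        ((F ×ˢ F) ∩ (fun p : M × M => φ p.2 - φ p.1) ⁻¹' (latVec L '' univ))) := by
    ext ⟨⟨x, hx⟩, ⟨y, hy⟩⟩
    refine (hq.eq_iff x hx y hy).trans ?_
    simp only [glueRel, mem_preimage, mem_union, mem_diagonal_iff, mem_inter_iff, mem_prod,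
      image_univ, mem_range, and_assoc, F, mem_ofPred_eq]
    simp only [eq_sub_iff_add_eq, eq_comm, add_comm]
  rw [h2]
  exact (isClosed_diagonal.union h1).preimage (by fun_prop)

lemma exists_openPartialHomeomorph [Nonempty M] (hq : IsGlueQuotient φ a L pr) {O : Set M}
    (hO : IsOpen O) (hOW : O ⊆ glueDomain φ a L) (hinj : InjOn pr O) :
    ∃ e : OpenPartialHomeomorph M N, e.source = O ∧ ⇑e = pr := by
  refine ⟨OpenPartialHomeomorph.ofContinuousOpenRestrict (hinj.toPartialEquiv pr O)
    (hq.continuousOn.mono hOW) ?_ hO, rfl, rfl⟩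
  intro V hV
  have h1 : O.domRestrict pr '' V = pr '' (Subtype.val '' V) := by
    rw [image_image]; rfl
  refine h1 ▸ hq.isOpen_image _ ?_ (hO.isOpenMap_subtype_val V hV)
  rintro _ ⟨x, _, rfl⟩
  exact hOW x.2

lemma injOn_compl (hq : IsGlueQuotient φ a L pr) :
    InjOn pr (glueDomain φ a L ∩ {x | x ∈ φ.source ∧ a ≤ ‖φ x‖}ᶜ) :=
  fun _ hx _ hy hxy => hq.eq_of_notMem hx.1 hy.1 hx.2 hxy

lemma injOn_ball (hq : IsGlueQuotient φ a L pr) (h : IsGlueable φ a L) (z : Euc n) :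
    InjOn pr (glueDomain φ a L ∩ (φ.source ∩ φ ⁻¹' Metric.ball z (L / 2))) := by
  rintro x ⟨hxW, hxφ, hx⟩ y ⟨hyW, hyφ, hy⟩ hxy
  rcases (hq.eq_iff x hxW y hyW).1 hxy with rfl | ⟨-, -, k, hk⟩
  · rfl
  have hk0 : k = 0 := by
    by_contra hne
    have h1 := le_norm_latVec h.L_pos hne
    have h2 : dist (φ y) (φ x) < L := by
      have := dist_triangle_right (φ y) (φ x) z
      rw [mem_preimage, Metric.mem_ball] at hx hy
      linarith
    rw [hk, dist_eq_norm, add_sub_cancel_left] at h2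
    linarith
  rw [hk0, latVec_zero, add_zero] at hk
  exact φ.injOn hxφ hyφ hk.symm

/-- Two kinds of neighbourhoods: coordinate balls of diameter `L`, too small to contain two
equivalent points, and the complement of `{r ≥ a}`, where nothing is identified. -/
lemma exists_local [Nonempty M] (hq : IsGlueQuotient φ a L pr) (h : IsGlueable φ a L) {x : M}
    (hx : x ∈ glueDomain φ a L) :
    ∃ e : OpenPartialHomeomorph M N, x ∈ e.source ∧ e.source ⊆ glueDomain φ a L ∧ ⇑e = pr := by
  have key : ∀ O : Set M, IsOpen O → x ∈ O → InjOn pr (glueDomain φ a L ∩ O) →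
      ∃ e : OpenPartialHomeomorph M N, x ∈ e.source ∧ e.source ⊆ glueDomain φ a L ∧ ⇑e = pr := by
    intro O hO hxO hinj
    obtain ⟨e, he, hpr⟩ := hq.exists_openPartialHomeomorph (h.isOpen_glueDomain.inter hO)
      inter_subset_left hinj
    exact ⟨e, he ▸ ⟨hx, hxO⟩, he ▸ inter_subset_left, hpr⟩
  by_cases hxa : x ∈ φ.source ∧ a ≤ ‖φ x‖
  · refine key _ (φ.isOpen_inter_preimage Metric.isOpen_ball) ⟨hxa.1, ?_⟩ (hq.injOn_ball h (φ x))
    exact Metric.mem_ball_self (half_pos h.L_pos)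
  · exact key _ (h.isClosed_endRegion a h.one_lt).isOpen_compl hxa hq.injOn_compl

lemma isClosed_image (hq : IsGlueQuotient φ a L pr) (h : IsGlueable φ a L) {A : Set M}
    (hA : IsClosed A) (hsat : ∀ x ∈ A, ∀ y, glueRel φ a L x y → y ∈ A) :
    IsClosed (pr '' (glueDomain φ a L ∩ A)) := by
  rw [← (hq.isOpenQuotientMap h).isQuotientMap.isClosed_preimage]
  convert hA.preimage (continuous_subtype_val (p := (· ∈ glueDomain φ a L))) using 1
  ext ⟨x, hx⟩
  constructor
  · rintro ⟨y, ⟨hyW, hyA⟩, hyx⟩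
    exact hsat y hyA x ((hq.eq_iff y hyW x hx).1 hyx)
  · exact fun hxA => ⟨x, ⟨hx, hxA⟩, rfl⟩

lemma symm_mem (h : IsGlueable φ a L) {z : Euc n} (hz : z ∈ cube n L) (hz1 : 1 < ‖z‖) :
    φ.symm z ∈ glueDomain φ a L := by
  intro _ k hk
  rw [φ.right_inv (by rw [h.target_eq]; exact hz1)]
  exact lt_norm_sub_latVec_of_mem_cube h.L_pos h.lt hz hk

/-- The points of the end have representatives in the cube. -/
lemma exists_mem_cube (hq : IsGlueQuotient φ a L pr) (h : IsGlueable φ a L) {s : ℝ} (hsa : s ≤ a)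
    {x : M} (hx : x ∈ glueDomain φ a L) (hxφ : x ∈ φ.source) (hxs : s ≤ ‖φ x‖) :
    ∃ z ∈ cube n L, s ≤ ‖z‖ ∧ 1 < ‖z‖ ∧ pr x = pr (φ.symm z) := by
  have h1 : 1 < ‖φ x‖ := by
    have := φ.map_source hxφ
    rwa [h.target_eq] at this
  by_cases hxa : ‖φ x‖ ≤ a
  · exact ⟨φ x, mem_cube_of_norm_le (by linarith [h.lt]), hxs, h1, by rw [φ.left_inv hxφ]⟩
  · have hxP : x ∈ periodicPart φ a L := by
      refine ⟨hxφ, fun k => ?_⟩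
      rcases eq_or_ne k 0 with rfl | hk
      · rw [latVec_zero, sub_zero]; exact not_le.1 hxa
      · exact hx hxφ k hk
    obtain ⟨k, hk⟩ := exists_sub_latVec_mem_cube h.L_pos (φ x)
    have h2 := hxP.2 k
    refine ⟨_, hk, (hsa.trans_lt h2).le, h.one_lt.trans h2, ?_⟩
    have h3 := h.endShift_mem hxP (-k)
    have h4 := (hq.eq_iff x hx _ (IsGlueable.periodicPart_subset h3)).2
      (h.glueRel_endShift hxP (-k))
    rw [h4, endShift, latVec_neg, ← sub_eq_add_neg]

lemma continuousOn_comp_symm (hq : IsGlueQuotient φ a L pr) (h : IsGlueable φ a L) :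
    ContinuousOn (fun z => pr (φ.symm z)) (cube n L ∩ {z | 1 < ‖z‖}) :=
  hq.continuousOn.comp (φ.continuousOn_symm.mono fun z hz => by rw [h.target_eq]; exact hz.2)
    fun z hz => symm_mem h hz.1 hz.2

lemma image_eq_image_cube (hq : IsGlueQuotient φ a L pr) (h : IsGlueable φ a L) {s : ℝ}
    (hs : 1 < s) (hsa : s ≤ a) :
    pr '' (glueDomain φ a L ∩ {x | x ∈ φ.source ∧ s ≤ ‖φ x‖})
      = (fun z => pr (φ.symm z)) '' (cube n L ∩ {z | s ≤ ‖z‖}) := by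
  ext q
  constructor
  · rintro ⟨x, ⟨hx, hxφ, hxs⟩, rfl⟩
    obtain ⟨z, hz, hzs, -, hxz⟩ := hq.exists_mem_cube h hsa hx hxφ hxs
    exact ⟨z, ⟨hz, hzs⟩, hxz.symm⟩
  · rintro ⟨z, ⟨hz, hzs⟩, rfl⟩
    have hzs : s ≤ ‖z‖ := hzs
    have hzt : z ∈ φ.target := by rw [h.target_eq]; exact hs.trans_le hzs
    refine ⟨φ.symm z, ⟨symm_mem h hz (hs.trans_le hzs), φ.map_target hzt, ?_⟩, rfl⟩
    rwa [φ.right_inv hzt]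

/-- The lattice folds the unbounded end onto the part of the compact cube outside the open ball of
radius `s`. -/
lemma isCompact_image (hq : IsGlueQuotient φ a L pr) (h : IsGlueable φ a L) {s : ℝ}
    (hs : 1 < s) (hsa : s ≤ a) :
    IsCompact (pr '' (glueDomain φ a L ∩ {x | x ∈ φ.source ∧ s ≤ ‖φ x‖})) := by
  rw [hq.image_eq_image_cube h hs hsa]
  refine (isCompact_cube.inter_right (isClosed_le continuous_const continuous_norm)
    ).image_of_continuousOn ((hq.continuousOn_comp_symm h).mono ?_)
  exact fun z hz => ⟨hz.1, hs.trans_le hz.2⟩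

lemma compl_subset (h : IsGlueable φ a L) {s : ℝ} (hsa : s ≤ a) :
    {x | x ∈ φ.source ∧ s ≤ ‖φ x‖}ᶜ ⊆ glueDomain φ a L := by
  intro x hx hxφ k hk
  have h1 : ‖φ x‖ < s := not_le.1 fun hle => hx ⟨hxφ, hle⟩
  refine lt_norm_sub_latVec_of_mem_cube h.L_pos h.lt (mem_cube_of_norm_le ?_) hk
  linarith [h.lt]

lemma compl_image_compl (hq : IsGlueQuotient φ a L pr) (h : IsGlueable φ a L) {s : ℝ}
    (hsa : s ≤ a) :
    (pr '' {x | x ∈ φ.source ∧ s ≤ ‖φ x‖}ᶜ)ᶜ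
      = pr '' (glueDomain φ a L ∩ {x | x ∈ φ.source ∧ s ≤ ‖φ x‖}) := by
  ext q
  constructor
  · intro hqn
    obtain ⟨x, hx, rfl⟩ := hq.surj q
    refine ⟨x, ⟨hx, ?_⟩, rfl⟩
    by_contra hxs
    exact hqn ⟨x, hxs, rfl⟩
  · rintro ⟨x, ⟨hx, hxs⟩, rfl⟩ ⟨y, hy, hyx⟩
    have hya : ¬ (y ∈ φ.source ∧ a ≤ ‖φ y‖) := fun hya => hy ⟨hya.1, hsa.trans hya.2⟩
    exact hy (hq.eq_of_notMem (compl_subset h hsa hy) hx hya hyx ▸ hxs)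

/-- The radial retraction shows that the complement of a neighbourhood of infinity in the end is
connected. -/
lemma isConnected_core [ConnectedSpace M] (h : IsGlueable φ a L) :
    IsConnected {x | x ∈ φ.source → ‖φ x‖ ≤ a} := by
  classical
  have ha := h.one_lt
  set F : Set M := {x | x ∈ φ.source ∧ a ≤ ‖φ x‖} with hF
  set C : Set M := {x | x ∈ φ.source → ‖φ x‖ ≤ a} with hC
  have hFc : IsClosed F := h.isClosed_endRegion a ha
  have hCc : IsClosed C := by
    have h1 := φ.isOpen_inter_preimage (isOpen_lt continuous_const continuous_norm :
      IsOpen {z : Euc n | a < ‖z‖})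
    rw [← isOpen_compl_iff]
    convert h1 using 1
    ext x
    simp [hC]
  let r : M → M := fun x => if x ∈ C then x else φ.symm ((a / ‖φ x‖) • φ x)
  have hr : EqOn r (fun x => φ.symm ((a / ‖φ x‖) • φ x)) F := by
    intro x hx
    by_cases hxC : x ∈ C
    · have h1 : ‖φ x‖ = a := le_antisymm (hxC hx.1) hx.2
      simp only [r, hxC, if_true, h1]
      rw [div_self (by linarith), one_smul, φ.left_inv hx.1]
    · simp only [r, hxC, if_false]
  have hnorm : ∀ x ∈ F, ‖(a / ‖φ x‖) • φ x‖ = a := by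
    intro x hx
    have h1 : 0 < ‖φ x‖ := by linarith [hx.2]
    rw [norm_smul, norm_div, norm_norm, div_mul_cancel₀ _ h1.ne', Real.norm_of_nonneg (by linarith)]
  have hrt : ∀ x ∈ F, (a / ‖φ x‖) • φ x ∈ φ.target := by
    intro x hx
    rw [h.target_eq, mem_ofPred_eq, hnorm x hx]
    exact ha
  have hcont : Continuous r := by
    have hu : C ∪ F = univ := by
      refine eq_univ_of_forall fun x => ?_
      by_cases hxC : x ∈ C
      · exact Or.inl hxC
      · simp only [hC, mem_ofPred_eq, Classical.not_imp, not_le] at hxC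
        exact Or.inr ⟨hxC.1, hxC.2.le⟩
    rw [← continuousOn_univ, ← hu]
    refine ContinuousOn.union_of_isClosed ?_ ?_ hCc hFc
    · exact continuousOn_id.congr fun x hx => by simp only [r, hx, if_true, id]
    · refine ContinuousOn.congr ?_ hr
      have hφ : ContinuousOn φ F := φ.continuousOn.mono fun x hx => hx.1
      refine φ.continuousOn_symm.comp ((continuousOn_const.div hφ.norm fun x hx => ?_).smul hφ) hrt
      have : 0 < ‖φ x‖ := by linarith [hx.2]
      exact this.ne'
  have hrange : range r = C := by
    ext x
    constructor
    · rintro ⟨y, rfl⟩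
      by_cases hy : y ∈ C
      · simp only [r, hy, if_true]
      · have hyF : y ∈ F := by
          simp only [hC, mem_ofPred_eq, Classical.not_imp, not_le] at hy
          exact ⟨hy.1, hy.2.le⟩
        intro _
        rw [hr hyF, φ.right_inv (hrt y hyF), hnorm y hyF]
    · intro hx
      exact ⟨x, by simp only [r, hx, if_true]⟩
  rw [← hrange]
  exact isConnected_range hcont

/-- A point of the torus part has a representative in the cube, and the radial segment down to the
sphere of radius `a` joins it to the connected core. The segment stays in the cube, hence avoids the
removed balls. -/
lemma connectedSpace [ConnectedSpace M] (hq : IsGlueQuotient φ a L pr) (h : IsGlueable φ a L) :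
    ConnectedSpace N := by
  have ha := h.one_lt
  set C : Set M := {x | x ∈ φ.source → ‖φ x‖ ≤ a} with hC
  have hCW : C ⊆ glueDomain φ a L := by
    intro x hx hxφ k hk
    refine lt_norm_sub_latVec_of_mem_cube h.L_pos h.lt (mem_cube_of_norm_le ?_) hk
    linarith [h.lt, hx hxφ]
  have hCcon : IsConnected (pr '' C) := (isConnected_core h).image pr (hq.continuousOn.mono hCW)
  obtain ⟨q₀, hq₀⟩ := hCcon.nonempty
  have : PreconnectedSpace N := by
    refine ⟨isPreconnected_of_forall q₀ fun q _ => ?_⟩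
    obtain ⟨x, hx, rfl⟩ := hq.surj q
    by_cases hxC : x ∈ C
    · exact ⟨pr '' C, subset_univ _, hq₀, mem_image_of_mem _ hxC, hCcon.isPreconnected⟩
    simp only [hC, mem_ofPred_eq, Classical.not_imp, not_le] at hxC
    obtain ⟨z, hz, hza, -, hxz⟩ := hq.exists_mem_cube h le_rfl hx hxC.1 hxC.2.le
    have hz0 : 0 < ‖z‖ := by linarith
    have hsub : ∀ t ∈ Icc (a / ‖z‖) 1, t • z ∈ cube n L ∩ {z | 1 < ‖z‖} := by
      intro t ht
      have h0 : 0 < t := (by positivity : 0 < a / ‖z‖).trans_le ht.1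
      refine ⟨smul_mem_cube hz h0.le ht.2, ?_⟩
      have h1 : a ≤ t * ‖z‖ := (div_le_iff₀ hz0).1 ht.1
      rw [mem_ofPred_eq, norm_smul, Real.norm_of_nonneg h0.le]
      linarith
    have hseg : IsPreconnected ((fun t : ℝ => pr (φ.symm (t • z))) '' Icc (a / ‖z‖) 1) :=
      isPreconnected_Icc.image _ ((hq.continuousOn_comp_symm h).comp
        (continuous_id.smul continuous_const).continuousOn hsub)
    have hle : a / ‖z‖ ≤ 1 := (div_le_one hz0).2 hza
    refine ⟨pr '' C ∪ (fun t : ℝ => pr (φ.symm (t • z))) '' Icc (a / ‖z‖) 1, subset_univ _,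
      Or.inl hq₀, Or.inr ⟨1, ⟨hle, le_rfl⟩, ?_⟩, ?_⟩
    · simp only [one_smul]; exact hxz.symm
    · refine hCcon.isPreconnected.union (pr (φ.symm ((a / ‖z‖) • z))) ?_ ?_ hseg
      · refine ⟨_, fun _ => ?_, rfl⟩
        have h1 := (hsub _ ⟨le_rfl, hle⟩).2
        rw [φ.right_inv (by rw [h.target_eq]; exact h1), norm_smul, norm_div, norm_norm,
          div_mul_cancel₀ _ hz0.ne', Real.norm_of_nonneg (by linarith)]
      · exact ⟨_, ⟨le_rfl, hle⟩, rfl⟩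
  exact { toNonempty := ⟨q₀⟩ }

end IsGlueQuotient

end GlueTopology

/-! ### Orientations -/

section Orientation

set_option linter.unusedSectionVars false

variable {n : ℕ} {M : Type*} [TopologicalSpace M] [ChartedSpace (Euc n) M]
  [IsManifold (𝓡 n) ∞ M]

lemma isPreconnected_one_lt_norm (hn : 2 ≤ n) : IsPreconnected {y : Euc n | 1 < ‖y‖} := by
  have hr : 1 < Module.rank ℝ (Euc n) := by
    rw [← Module.finrank_eq_rank, finrank_euclideanSpace_fin]
    exact_mod_cast hn
  have h1 : IsPreconnected ((fun p : Euc n × ℝ => p.2 • p.1) ''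
      (Metric.sphere (0 : Euc n) 1 ×ˢ Ioi (1 : ℝ))) :=
    ((isPreconnected_sphere hr 0 1).prod isPreconnected_Ioi).image _ (by fun_prop)
  convert h1 using 1
  ext y
  constructor
  · intro hy
    have hy : 1 < ‖y‖ := hy
    have h0 : ‖y‖ ≠ 0 := by linarith
    refine ⟨(‖y‖⁻¹ • y, ‖y‖), ⟨?_, hy⟩, ?_⟩
    · rw [mem_sphere_zero_iff_norm, norm_smul, norm_inv, norm_norm, inv_mul_cancel₀ h0]
    · exact smul_inv_smul₀ h0 y
  · rintro ⟨⟨w, t⟩, ⟨hw, ht⟩, rfl⟩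
    have ht : 1 < t := ht
    rw [mem_sphere_zero_iff_norm] at hw
    rw [mem_ofPred_eq, norm_smul, hw, mul_one, Real.norm_of_nonneg (by linarith)]
    exact ht

variable {b c d φ : OpenPartialHomeomorph M (Euc n)}

lemma contDiffAt_transition (hb : b ∈ IsManifold.maximalAtlas (𝓡 n) ∞ M)
    (hc : c ∈ IsManifold.maximalAtlas (𝓡 n) ∞ M) {y : Euc n} (hy : y ∈ b.target)
    (hyc : b.symm y ∈ c.source) : ContDiffAt ℝ ∞ (c ∘ b.symm) y := by
  rw [← contMDiffAt_iff_contDiffAt]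
  exact (contMDiffAt_of_mem_maximalAtlas hc hyc).comp y
    (contMDiffAt_symm_of_mem_maximalAtlas hb hy)

lemma det_fderiv_transition (hb : b ∈ IsManifold.maximalAtlas (𝓡 n) ∞ M)
    (hc : c ∈ IsManifold.maximalAtlas (𝓡 n) ∞ M) (hd : d ∈ IsManifold.maximalAtlas (𝓡 n) ∞ M)
    {y : Euc n} (hy : y ∈ b.target) (hyc : b.symm y ∈ c.source) (hyd : b.symm y ∈ d.source) :
    (fderiv ℝ (d ∘ b.symm) y).det
      = (fderiv ℝ (d ∘ c.symm) (c (b.symm y))).det * (fderiv ℝ (c ∘ b.symm) y).det := by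
  have h1 : (d ∘ b.symm) =ᶠ[𝓝 y] (d ∘ c.symm) ∘ (c ∘ b.symm) := by
    filter_upwards [(b.continuousAt_symm hy).eventually (c.open_source.mem_nhds hyc)] with z hz
    simp only [Function.comp_apply, c.left_inv hz]
  have h2 := (contDiffAt_transition hc hd (c.map_source hyc)
    (by rwa [c.left_inv hyc])).differentiableAt (by simp)
  have h3 := (contDiffAt_transition hb hc hy hyc).differentiableAt (by simp)
  rw [h1.fderiv_eq, fderiv_comp y (by exact h2) h3]
  exact LinearMap.det_comp _ _

lemma det_fderiv_transition_self {y : Euc n} (hy : y ∈ b.target) :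
    (fderiv ℝ (b ∘ b.symm) y).det = 1 := by
  have h1 : (b ∘ b.symm) =ᶠ[𝓝 y] id := b.eventually_right_inverse hy
  rw [h1.fderiv_eq, fderiv_id]
  exact LinearMap.det_id

lemma continuousAt_det_transition (hb : b ∈ IsManifold.maximalAtlas (𝓡 n) ∞ M)
    (hc : c ∈ IsManifold.maximalAtlas (𝓡 n) ∞ M) {y : Euc n} (hy : y ∈ b.target)
    (hyc : b.symm y ∈ c.source) : ContinuousAt (fun z => (fderiv ℝ (c ∘ b.symm) z).det) y :=
  ContinuousLinearMap.continuous_det.continuousAt.comp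
    ((contDiffAt_transition hb hc hy hyc).continuousAt_fderiv (by simp))

/-- A connected chart either preserves or reverses the orientation given by an oriented atlas. -/
lemma pos_det_or_neg_det {A : Set (OpenPartialHomeomorph M (Euc n))}
    (hA : A ⊆ IsManifold.maximalAtlas (𝓡 n) ∞ M) (hcov : ∀ x : M, ∃ e ∈ A, x ∈ e.source)
    (hpos : ∀ e ∈ A, ∀ e' ∈ A, ∀ x ∈ e.source ∩ e'.source, 0 < (fderiv ℝ (e' ∘ e.symm) (e x)).det)
    (hφ : φ ∈ IsManifold.maximalAtlas (𝓡 n) ∞ M) (hconn : IsPreconnected φ.target) :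
    (∀ y ∈ φ.target, ∀ e ∈ A, φ.symm y ∈ e.source → 0 < (fderiv ℝ (e ∘ φ.symm) y).det) ∨
    (∀ y ∈ φ.target, ∀ e ∈ A, φ.symm y ∈ e.source → (fderiv ℝ (e ∘ φ.symm) y).det < 0) := by
  have hne : ∀ y ∈ φ.target, ∀ e ∈ A, φ.symm y ∈ e.source →
      (fderiv ℝ (e ∘ φ.symm) y).det ≠ 0 := by
    intro y hy e he hye h0
    have h1 := det_fderiv_transition hφ (hA he) hφ hy hye (φ.map_target hy)
    rw [det_fderiv_transition_self hy, h0, mul_zero] at h1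
    exact one_ne_zero h1
  have hiff : ∀ y ∈ φ.target, ∀ e ∈ A, ∀ e' ∈ A, φ.symm y ∈ e.source → φ.symm y ∈ e'.source →
      0 < (fderiv ℝ (e ∘ φ.symm) y).det → 0 < (fderiv ℝ (e' ∘ φ.symm) y).det := by
    intro y hy e he e' he' hye hye' h
    rw [det_fderiv_transition hφ (hA he) (hA he') hy hye hye']
    exact mul_pos (hpos e he e' he' _ ⟨hye, hye'⟩) h
  let P : Set (Euc n) := {y | y ∈ φ.target ∧ ∃ e ∈ A, φ.symm y ∈ e.source ∧
    0 < (fderiv ℝ (e ∘ φ.symm) y).det}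
  let Q : Set (Euc n) := {y | y ∈ φ.target ∧ ∃ e ∈ A, φ.symm y ∈ e.source ∧
    (fderiv ℝ (e ∘ φ.symm) y).det < 0}
  have hP : IsOpen P := by
    rw [isOpen_iff_mem_nhds]
    rintro y ⟨hy, e, he, hye, hdet⟩
    filter_upwards [φ.open_target.mem_nhds hy,
      (φ.continuousAt_symm hy).eventually (e.open_source.mem_nhds hye),
      (continuousAt_det_transition hφ (hA he) hy hye).eventually_const_lt hdet] with z h1 h2 h3
    exact ⟨h1, e, he, h2, h3⟩
  have hQ : IsOpen Q := by
    rw [isOpen_iff_mem_nhds]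
    rintro y ⟨hy, e, he, hye, hdet⟩
    filter_upwards [φ.open_target.mem_nhds hy,
      (φ.continuousAt_symm hy).eventually (e.open_source.mem_nhds hye),
      (continuousAt_det_transition hφ (hA he) hy hye).eventually_lt_const hdet] with z h1 h2 h3
    exact ⟨h1, e, he, h2, h3⟩
  have hdisj : Disjoint P Q := by
    rw [disjoint_left]
    rintro y ⟨hy, e, he, hye, hdet⟩ ⟨-, e', he', hye', hdet'⟩
    exact hdet'.not_gt (hiff y hy e he e' he' hye hye' hdet)
  have hsub : φ.target ⊆ P ∪ Q := by
    intro y hy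
    obtain ⟨e, he, hye⟩ := hcov (φ.symm y)
    rcases (hne y hy e he hye).lt_or_gt with h | h
    · exact Or.inr ⟨hy, e, he, hye, h⟩
    · exact Or.inl ⟨hy, e, he, hye, h⟩
  rcases hconn.subset_or_subset hP hQ hdisj hsub with h | h
  · left
    intro y hy e he hye
    obtain ⟨-, e', he', hye', hdet⟩ := h hy
    exact hiff y hy e' he' e he hye' hye hdet
  · right
    intro y hy e he hye
    obtain ⟨-, e', he', hye', hdet⟩ := h hy
    by_contra hlt
    exact hdet.not_gt (hiff y hy e he e' he' hye hye'
      (lt_of_le_of_ne (not_lt.1 hlt) (hne y hy e he hye).symm))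

end Orientation

/-! ### Smooth structure of the glued space -/

section GlueSmooth

set_option linter.unusedSectionVars false

variable {n : ℕ} {M : Type u} [TopologicalSpace M] [ChartedSpace (Euc n) M]
  [IsManifold (𝓡 n) ∞ M] {φ : OpenPartialHomeomorph M (Euc n)} {a L : ℝ}

lemma IsGlueable.contMDiffAt_endShift (h : IsGlueable φ a L)
    (hφ : φ ∈ IsManifold.maximalAtlas (𝓡 n) ∞ M) {x : M} (hx : x ∈ periodicPart φ a L)
    (k : Fin n → ℤ) : ContMDiffAt (𝓡 n) (𝓡 n) ∞ (endShift φ L k) x := by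
  have h1 : ContMDiffAt (𝓡 n) (𝓡 n) ∞ φ x := contMDiffAt_of_mem_maximalAtlas hφ hx.1
  have h2 : ContMDiffAt (𝓡 n) (𝓡 n) ∞ (fun z : Euc n => z + latVec L k) (φ x) :=
    contMDiffAt_iff_contDiffAt.2 (by fun_prop)
  have h3 : ContMDiffAt (𝓡 n) (𝓡 n) ∞ φ.symm (φ x + latVec L k) :=
    contMDiffAt_symm_of_mem_maximalAtlas hφ (h.add_mem_target hx k)
  have h4 : ContMDiffAt (𝓡 n) (𝓡 n) ∞ ((fun z : Euc n => z + latVec L k) ∘ φ) x := h2.comp x h1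
  exact h3.comp x h4

/-- If the metric is conformally flat at `x`, the metric at `x` is a multiple of the Euclidean
inner product in coordinates. -/
lemma inner_eq_of_coordMetric_eq_smul_one {g : C0Metric n M}
    (hφ : φ ∈ IsManifold.maximalAtlas (𝓡 n) ∞ M) {x : M} (hx : x ∈ φ.source) {b : ℝ}
    (hb : coordMetric g φ (φ x) = b • (1 : Matrix (Fin n) (Fin n) ℝ))
    {v w : TangentSpace (𝓡 n) x} {V V' : Euc n} (hV : mfderiv (𝓡 n) (𝓡 n) φ x v = V)
    (hV' : mfderiv (𝓡 n) (𝓡 n) φ x w = V') : g.inner x v w = b * inner ℝ V V' := by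
  obtain ⟨B, hB⟩ : ∃ B : Euc n →L[ℝ] Euc n →L[ℝ] ℝ, ∀ v w, B v w = g.inner (φ.symm (φ x))
      (mfderiv (𝓡 n) (𝓡 n) φ.symm (φ x) v) (mfderiv (𝓡 n) (𝓡 n) φ.symm (φ x) w) :=
    ⟨pullForm (g.inner (φ.symm (φ x))) (mfderiv (𝓡 n) (𝓡 n) φ.symm (φ x)), fun v w => rfl⟩
  have hd := fun v => mfderiv_symm_apply_mfderiv φ hx
    ((contMDiffAt_of_mem_maximalAtlas hφ hx).mdifferentiableAt (by simp))
    ((contMDiffAt_symm_of_mem_maximalAtlas hφ (φ.map_source hx)).mdifferentiableAt (by simp)) v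
  have h1 : g.inner x v w = B V V' := by
    rw [hB, ← hV, ← hV']
    refine Eq.symm ?_
    refine (inner_congr g (φ.left_inv hx) _ _).trans ?_
    exact congrArg₂ (fun a b => g.inner x a b) (hd v) (hd w)
  have h2 : ∀ i j, B (basisVec n i) (basisVec n j) = b * (1 : Matrix (Fin n) (Fin n) ℝ) i j := by
    intro i j
    rw [hB]
    exact congrFun (congrFun hb i) j
  have hsum : ∀ v : Euc n, v = ∑ i, v i • basisVec n i := by
    intro v
    have := (EuclideanSpace.basisFun (Fin n) ℝ).sum_repr v
    simpa [basisVec] using this.symm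
  rw [h1]
  conv_lhs => rw [hsum V, hsum V']
  simp only [map_sum, map_smul, sum_apply, smul_apply, h2,
    smul_eq_mul, Matrix.one_apply, PiLp.inner_apply, Finset.mul_sum]
  simp
  refine Finset.sum_congr rfl fun i _ => by ring

/-- In the coordinates `φ` the shift is a translation, whose derivative is the identity. -/
lemma mfderiv_endShift (h : IsGlueable φ a L) (hφ : φ ∈ IsManifold.maximalAtlas (𝓡 n) ∞ M) {x : M}
    (hx : x ∈ periodicPart φ a L) (k : Fin n → ℤ) (v : Euc n) :
    mfderiv (𝓡 n) (𝓡 n) φ (endShift φ L k x) (mfderiv (𝓡 n) (𝓡 n) (endShift φ L k) x v)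
      = mfderiv (𝓡 n) (𝓡 n) φ x v := by
  have hφ1 : MDifferentiableAt (𝓡 n) (𝓡 n) φ x :=
    (contMDiffAt_of_mem_maximalAtlas hφ hx.1).mdifferentiableAt (by simp)
  have hφ2 : MDifferentiableAt (𝓡 n) (𝓡 n) φ (endShift φ L k x) :=
    (contMDiffAt_of_mem_maximalAtlas hφ (h.endShift_mem hx k).1).mdifferentiableAt (by simp)
  have hs := (h.contMDiffAt_endShift hφ hx k).mdifferentiableAt (by simp)
  have h1 := mfderiv_comp x hφ2 hs
  have h2 : (φ ∘ endShift φ L k) =ᶠ[𝓝 x] (fun z : Euc n => z + latVec L k) ∘ φ := by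
    filter_upwards [h.isOpen_periodicPart.mem_nhds hx] with z hz
    exact h.apply_endShift hz k
  have h3 : MDifferentiableAt (𝓡 n) (𝓡 n) (fun z : Euc n => z + latVec L k) (φ x) :=
    DifferentiableAt.mdifferentiableAt (by fun_prop)
  have h4 := mfderiv_comp x h3 hφ1
  have h5 := h2.mfderiv_eq (I := 𝓡 n) (I' := 𝓡 n)
  have h6 : mfderiv (𝓡 n) (𝓡 n) (fun z : Euc n => z + latVec L k) (φ x)
      = ContinuousLinearMap.id ℝ (Euc n) := by
    rw [mfderiv_eq_fderiv]
    have : fderiv ℝ (fun z : Euc n => z + latVec L k) (φ x) = ContinuousLinearMap.id ℝ (Euc n) := by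
      rw [fderiv_add_const, fderiv_fun_id]
    exact this
  have h7 := DFunLike.congr_fun ((h1.symm.trans h5).trans h4) v
  refine h7.trans ?_
  exact DFunLike.congr_fun h6 (mfderiv (𝓡 n) (𝓡 n) φ x v)

variable {N : Type*} [TopologicalSpace N] {pr : M → N}

namespace IsGlueQuotient

lemma eventually_endShift (hq : IsGlueQuotient φ a L pr) (h : IsGlueable φ a L) {x : M}
    (hx : x ∈ periodicPart φ a L) (k : Fin n → ℤ) :
    ∀ᶠ z in 𝓝 x, pr (endShift φ L k z) = pr z := by
  filter_upwards [h.isOpen_periodicPart.mem_nhds hx] with z hz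
  exact (hq.eq_iff _ (IsGlueable.periodicPart_subset (h.endShift_mem hz k)) _
    (IsGlueable.periodicPart_subset hz)).2 (h.glueRel_endShift hz k).symm

lemma isEtale [Nonempty M] (hq : IsGlueQuotient φ a L pr) (h : IsGlueable φ a L)
    (hφ : φ ∈ IsManifold.maximalAtlas (𝓡 n) ∞ M) : IsEtale n pr (glueDomain φ a L) where
  surj := hq.surj
  exists_local _ hx := hq.exists_local h hx
  transition x hx y hy hxy := by
    rcases ((hq.eq_iff x hx y hy).1 hxy).cases hx hy with rfl | ⟨hxP, k, rfl⟩
    · exact ⟨id, contMDiffAt_id, rfl, Eventually.of_forall fun _ => rfl⟩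
    · exact ⟨_, h.contMDiffAt_endShift hφ hxP k, rfl, hq.eventually_endShift h hxP k⟩

/-- The identifications are translations of the end, and there the metric is a constant multiple of
the Euclidean one. -/
lemma isInvariantMetric [ChartedSpace (Euc n) N] [IsManifold (𝓡 n) ∞ N]
    (hq : IsGlueQuotient φ a L pr) (h : IsGlueable φ a L)
    (hφ : φ ∈ IsManifold.maximalAtlas (𝓡 n) ∞ M) {g : C0Metric n M} {b : ℝ}
    (hb : ∀ y : Euc n, a ≤ ‖y‖ → coordMetric g φ y = b • (1 : Matrix (Fin n) (Fin n) ℝ)) :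
    IsInvariantMetric g pr (glueDomain φ a L) := by
  intro x hx y hy hxy
  rcases ((hq.eq_iff x hx y hy).1 hxy).cases hx hy with rfl | ⟨hxP, k, rfl⟩
  · refine ⟨id, contMDiffAt_id, rfl, Eventually.of_forall fun _ => rfl, fun v w => ?_⟩
    have h1 : ∀ v : Euc n, mfderiv (𝓡 n) (𝓡 n) (id : M → M) x v = v := fun v =>
      DFunLike.congr_fun (mfderiv_id (I := 𝓡 n) (x := x)) v
    exact congrArg₂ (fun a b => g.inner x a b) (h1 v) (h1 w)
  · refine ⟨_, h.contMDiffAt_endShift hφ hxP k, rfl, hq.eventually_endShift h hxP k,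
      fun v w => ?_⟩
    have hxP' := h.endShift_mem hxP k
    rw [inner_eq_of_coordMetric_eq_smul_one hφ hxP'.1
        (hb _ (IsGlueable.lt_norm_of_mem_periodicPart hxP').le)
        (mfderiv_endShift h hφ hxP k v) (mfderiv_endShift h hφ hxP k w),
      inner_eq_of_coordMetric_eq_smul_one hφ hxP.1
        (hb _ (IsGlueable.lt_norm_of_mem_periodicPart hxP).le) rfl rfl]

lemma isOrientable [ChartedSpace (Euc n) N] [IsManifold (𝓡 n) ∞ N]
    (hq : IsGlueQuotient φ a L pr) (h : IsGlueable φ a L)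
    (hφ : φ ∈ IsManifold.maximalAtlas (𝓡 n) ∞ M) (hn : 2 ≤ n)
    (het : IsSmoothEtale (n := n) pr (glueDomain φ a L)) (hM : IsOrientable n M) :
    IsOrientable n N := by
  obtain ⟨A, hA, hcov, hpos⟩ := hM
  refine het.isOrientable hA hcov fun x hx y hy hxy => ?_
  rcases ((hq.eq_iff x hx y hy).1 hxy).cases hx hy with rfl | ⟨hxP, k, rfl⟩
  · exact ⟨id, continuousAt_id, rfl, Eventually.of_forall fun _ => rfl,
      fun e he e' he' hxe hxe' => hpos e he e' he' x ⟨hxe, hxe'⟩⟩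
  · refine ⟨_, (h.contMDiffAt_endShift hφ hxP k).continuousAt, rfl,
      hq.eventually_endShift h hxP k, fun e he e' he' hxe hxe' => ?_⟩
    have hxP' := h.endShift_mem hxP k
    have hyT := h.add_mem_target hxP k
    have h1 : (e' ∘ endShift φ L k ∘ e.symm)
        = (e' ∘ φ.symm) ∘ ((fun z : Euc n => z + latVec L k) ∘ (φ ∘ e.symm)) := rfl
    have hxs : e.symm (e x) = x := e.left_inv hxe
    have hd1 : DifferentiableAt ℝ (φ ∘ e.symm) (e x) :=
      (contDiffAt_transition (hA he) hφ (e.map_source hxe) (by rw [hxs]; exact hxP.1)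
        ).differentiableAt (by simp)
    have hd2 : DifferentiableAt ℝ ((fun z : Euc n => z + latVec L k) ∘ (φ ∘ e.symm)) (e x) :=
      hd1.add_const _
    have hval : ((fun z : Euc n => z + latVec L k) ∘ (φ ∘ e.symm)) (e x) = φ x + latVec L k := by
      simp only [Function.comp_apply, hxs]
    have hd3 : DifferentiableAt ℝ (e' ∘ φ.symm)
        (((fun z : Euc n => z + latVec L k) ∘ (φ ∘ e.symm)) (e x)) := by
      rw [hval]
      exact (contDiffAt_transition hφ (hA he') hyT hxe').differentiableAt (by simp)
    have h2 : fderiv ℝ ((fun z : Euc n => z + latVec L k) ∘ (φ ∘ e.symm)) (e x)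
        = fderiv ℝ (φ ∘ e.symm) (e x) := fderiv_add_const (f := φ ∘ e.symm) (latVec L k)
    rw [h1, fderiv_comp _ hd3 hd2, hval, h2]
    have h3 : ((fderiv ℝ (e' ∘ φ.symm) (φ x + latVec L k)).comp
        (fderiv ℝ (φ ∘ e.symm) (e x))).det = (fderiv ℝ (e' ∘ φ.symm) (φ x + latVec L k)).det
        * (fderiv ℝ (φ ∘ e.symm) (e x)).det := LinearMap.det_comp _ _
    rw [h3]
    have h4 := det_fderiv_transition (hA he) hφ (hA he) (e.map_source hxe)
      (by rw [hxs]; exact hxP.1) (by rw [hxs]; exact hxe)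
    rw [det_fderiv_transition_self (e.map_source hxe), hxs] at h4
    have hxT : φ x ∈ φ.target := φ.map_source hxP.1
    have hconn : IsPreconnected φ.target := by
      rw [h.target_eq]; exact isPreconnected_one_lt_norm hn
    have hxe'' : φ.symm (φ x) ∈ e.source := by rwa [φ.left_inv hxP.1]
    -- A translation preserves orientation in `φ`, and the sign of `φ` relative to the oriented
    -- atlas is the same at `x` and at its translate, by connectedness of the end; the two signs
    -- multiply to a positive one.
    rcases pos_det_or_neg_det hA hcov hpos hφ hconn with hs | hs
    · have h5 := hs _ hyT e' he' hxe'
      have h6 := hs _ hxT e he hxe''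
      exact mul_pos h5 (pos_of_mul_pos_right (h4 ▸ one_pos) h6.le)
    · have h5 := hs _ hyT e' he' hxe'
      have h6 := hs _ hxT e he hxe''
      refine mul_pos_of_neg_of_neg h5 ?_
      by_contra hge
      have := mul_nonpos_of_nonpos_of_nonneg h6.le (not_lt.1 hge)
      linarith

end IsGlueQuotient

end GlueSmooth

/-! ### The induced distance -/

section Distance

variable {n : ℕ} {M : Type*} [TopologicalSpace M] [ChartedSpace (Euc n) M]
  [IsManifold (𝓡 n) ∞ M] {N : Type*} [TopologicalSpace N] [ChartedSpace (Euc n) N]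
  [IsManifold (𝓡 n) ∞ N]

/-- The length of a curve. -/
def gLen (g : C0Metric n M) (γ : ℝ → M) (a b : ℝ) : ENNReal :=
  letI : RiemannianBundle (fun x : M => TangentSpace (𝓡 n) x) := ⟨g.toRiemannianMetric⟩
  pathELength (𝓡 n) γ a b

lemma gLen_eq (g : C0Metric n M) (γ : ℝ → M) (a b : ℝ) :
    gLen g γ a b = ∫⁻ t in Ioo a b, ENNReal.ofReal (√(g.inner (γ t)
      (mfderiv 𝓘(ℝ, ℝ) (𝓡 n) γ t (1 : ℝ)) (mfderiv 𝓘(ℝ, ℝ) (𝓡 n) γ t (1 : ℝ)))) := by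
  let : RiemannianBundle (fun x : M => TangentSpace (𝓡 n) x) := ⟨g.toRiemannianMetric⟩
  have h1 : ∀ (x : M) (v : TangentSpace (𝓡 n) x), ‖v‖ₑ = ENNReal.ofReal √(g.inner x v v) := by
    intro x v
    rw [← ofReal_norm, norm_eq_sqrt_real_inner]
    rfl
  rw [gLen, pathELength_eq_lintegral_mfderiv_Ioo]
  exact lintegral_congr fun t => h1 _ _

lemma gLen_mono (g : C0Metric n M) (γ : ℝ → M) {a b a' b' : ℝ} (h : a' ≤ a) (h' : b ≤ b') :
    gLen g γ a b ≤ gLen g γ a' b' := by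
  let : RiemannianBundle (fun x : M => TangentSpace (𝓡 n) x) := ⟨g.toRiemannianMetric⟩
  exact pathELength_mono h h'

lemma gDist_le_gLen (g : C0Metric n M) {γ : ℝ → M} {a b : ℝ}
    (hγ : ContMDiffOn 𝓘(ℝ, ℝ) (𝓡 n) 1 γ (Icc a b)) (hab : a ≤ b) :
    gDist g (γ a) (γ b) ≤ gLen g γ a b := by
  let : RiemannianBundle (fun x : M => TangentSpace (𝓡 n) x) := ⟨g.toRiemannianMetric⟩
  exact riemannianEDist_le_pathELength hγ rfl rfl hab

lemma exists_gLen_lt (g : C0Metric n M) {x y : M} {r : ENNReal} (h : gDist g x y < r) :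
    ∃ γ : ℝ → M, γ 0 = x ∧ γ 1 = y ∧ ContMDiff 𝓘(ℝ, ℝ) (𝓡 n) 1 γ ∧ gLen g γ 0 1 < r := by
  let : RiemannianBundle (fun x : M => TangentSpace (𝓡 n) x) := ⟨g.toRiemannianMetric⟩
  obtain ⟨γ, h0, h1, h2, h3, -⟩ := exists_lt_locally_constant_of_riemannianEDist_lt h one_pos
  exact ⟨γ, h0, h1, h2, h3⟩

/-- The extended pseudometric structure given by the induced distance. -/
@[reducible] def gEMetric [RegularSpace M] (g : C0Metric n M) : PseudoEMetricSpace M :=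
  letI : RiemannianBundle (fun x : M => TangentSpace (𝓡 n) x) := ⟨g.toRiemannianMetric⟩
  PseudoEMetricSpace.ofRiemannianMetric (𝓡 n) M

lemma setDist_pos [RegularSpace M] (g : C0Metric n M) {A B B' : Set M} (hA : IsCompact A)
    (hB : IsClosed B) (hAB : Disjoint A B) (hB' : B' ⊆ B) : 0 < setDist g A B' := by
  let : PseudoEMetricSpace M := gEMetric g
  obtain ⟨r, hr, h⟩ := Metric.exists_pos_forall_lt_edist hA hB hAB
  refine (ENNReal.coe_pos.2 hr).trans_le ?_
  exact le_iInf₂ fun x hx => le_iInf₂ fun y hy => (h x hx y (hB' hy)).le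

lemma isBoundedFor_of_isCompact [RegularSpace M] [PreconnectedSpace M] (g : C0Metric n M)
    {K U : Set M} (hK : IsCompact K) (hU : U ⊆ K) : IsBoundedFor g U := by
  let : PseudoEMetricSpace M := gEMetric g
  rcases U.eq_empty_or_nonempty with rfl | ⟨x₀, -⟩
  · exact ⟨0, by simp⟩
  have hball : ∀ r : ENNReal, IsOpen {y : M | edist x₀ y < r} := fun r =>
    isOpen_lt (continuous_const.edist continuous_id) continuous_const
  -- The set of points at finite distance is open and closed, so connectedness makes all distances
  -- finite; the balls of integer radius then cover `K`.
  have hfin : {y : M | edist x₀ y < ⊤} = univ := by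
    refine IsClopen.eq_univ ⟨?_, hball ⊤⟩ ⟨x₀, by simp⟩
    rw [← isOpen_compl_iff, isOpen_iff_mem_nhds]
    intro y hy
    have h1 : ∀ᶠ z in 𝓝 y, edist z y < 1 := Metric.eball_mem_nhds y one_pos
    filter_upwards [h1] with z hz hzt
    exact hy ((edist_triangle x₀ z y).trans_lt
      (ENNReal.add_lt_top.2 ⟨hzt, hz.trans ENNReal.one_lt_top⟩))
  obtain ⟨t, ht⟩ := hK.elim_directed_cover (fun m : ℕ => {y : M | edist x₀ y < m})
    (fun m => hball m) (fun y _ => by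
      have h1 : edist x₀ y < ⊤ := (hfin ▸ mem_univ y : y ∈ {y : M | edist x₀ y < ⊤})
      obtain ⟨m, hm⟩ := ENNReal.exists_nat_gt h1.ne
      exact mem_iUnion.2 ⟨m, hm⟩)
    (directed_of_isDirected_le fun i j hij y (hy : edist x₀ y < i) =>
      show edist x₀ y < j from hy.trans_le (Nat.cast_le.2 hij))
  refine ⟨2 * t, fun x hx y hy => ?_⟩
  have h1 : edist x₀ x < t := ht (hU hx)
  have h2 : edist x₀ y < t := ht (hU hy)
  calc gDist g x y = edist x y := rfl
    _ ≤ edist x x₀ + edist x₀ y := edist_triangle _ _ _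
    _ ≤ t + t := add_le_add (by rw [edist_comm]; exact h1.le) h2.le
    _ = ((2 * t : ℝ≥0) : ENNReal) := by push_cast; ring

/-- Curves in the image of an isometric embedding can be lifted. -/
lemma gDist_symm_le_gLen {g : C0Metric n M} {k : C0Metric n N} {e : OpenPartialHomeomorph M N}
    (hs : ContMDiffOn (𝓡 n) (𝓡 n) ∞ e.symm e.target)
    (hk : ∀ q ∈ e.target, ∀ v w : TangentSpace (𝓡 n) q, k.inner q v w =
      g.inner (e.symm q) (mfderiv (𝓡 n) (𝓡 n) e.symm q v) (mfderiv (𝓡 n) (𝓡 n) e.symm q w))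
    {γ : ℝ → N} (hγ : ContMDiff 𝓘(ℝ, ℝ) (𝓡 n) 1 γ) {a b : ℝ} (hab : a ≤ b)
    (hγe : ∀ t ∈ Icc a b, γ t ∈ e.target) :
    gDist g (e.symm (γ a)) (e.symm (γ b)) ≤ gLen k γ a b := by
  have h1 : ContMDiffOn 𝓘(ℝ, ℝ) (𝓡 n) 1 (e.symm ∘ γ) (Icc a b) :=
    (hs.of_le (by simp)).comp hγ.contMDiffOn hγe
  refine (gDist_le_gLen g h1 hab).trans (le_of_eq ?_)
  rw [gLen_eq, gLen_eq]
  refine setLIntegral_congr_fun measurableSet_Ioo fun t ht => ?_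
  have htT : γ t ∈ e.target := hγe t ⟨ht.1.le, ht.2.le⟩
  have hes : MDifferentiableAt (𝓡 n) (𝓡 n) e.symm (γ t) :=
    (hs.contMDiffAt (e.open_target.mem_nhds htT)).mdifferentiableAt (by simp)
  have hd : mfderiv 𝓘(ℝ, ℝ) (𝓡 n) (e.symm ∘ γ) t (1 : ℝ)
      = mfderiv (𝓡 n) (𝓡 n) e.symm (γ t) (mfderiv 𝓘(ℝ, ℝ) (𝓡 n) γ t (1 : ℝ)) :=
    DFunLike.congr_fun (mfderiv_comp t hes (hγ.mdifferentiableAt (by simp))) (1 : ℝ)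
  have h2 := hk (γ t) htT (mfderiv 𝓘(ℝ, ℝ) (𝓡 n) γ t (1 : ℝ)) (mfderiv 𝓘(ℝ, ℝ) (𝓡 n) γ t (1 : ℝ))
  have h3 : g.inner ((e.symm ∘ γ) t) (mfderiv 𝓘(ℝ, ℝ) (𝓡 n) (e.symm ∘ γ) t (1 : ℝ))
      (mfderiv 𝓘(ℝ, ℝ) (𝓡 n) (e.symm ∘ γ) t (1 : ℝ))
      = g.inner (e.symm (γ t)) (mfderiv (𝓡 n) (𝓡 n) e.symm (γ t) (mfderiv 𝓘(ℝ, ℝ) (𝓡 n) γ t (1 : ℝ)))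
        (mfderiv (𝓡 n) (𝓡 n) e.symm (γ t) (mfderiv 𝓘(ℝ, ℝ) (𝓡 n) γ t (1 : ℝ))) :=
    congrArg₂ (fun a b => g.inner (e.symm (γ t)) a b) hd hd
  exact congrArg (fun r => ENNReal.ofReal √r) (h3.trans h2.symm)

/-- A metric is complete if the complement of a compact set is isometric to a part of a complete
manifold, with a margin. -/
theorem isCompleteMetric_of_isometric_outside_compact [RegularSpace N] {g : C0Metric n M}
    (hg : IsCompleteMetric g) {k : C0Metric n N} {e : OpenPartialHomeomorph M N}
    (hs : ContMDiffOn (𝓡 n) (𝓡 n) ∞ e.symm e.target)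
    (hk : ∀ q ∈ e.target, ∀ v w : TangentSpace (𝓡 n) q, k.inner q v w =
      g.inner (e.symm q) (mfderiv (𝓡 n) (𝓡 n) e.symm q v) (mfderiv (𝓡 n) (𝓡 n) e.symm q w))
    {D K : Set N} (hD : IsClosed D) (hDe : D ⊆ e.target) (hK : IsCompact K) (hKD : K ∪ D = univ)
    (heT : IsCompact e.targetᶜ) (hDs : IsClosed (e.symm '' D)) : IsCompleteMetric k := by
  intro u hu
  let : PseudoEMetricSpace N := gEMetric k
  have hcs : CauchySeq u := by
    rw [EMetric.cauchySeq_iff]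
    exact fun ε hε => hu ε hε
  -- A Cauchy sequence returning to the compact set `K` has a cluster point there and converges to
  -- it. Otherwise it is eventually in `D` and can be carried over to `M`.
  by_cases hfreq : ∃ᶠ i in atTop, u i ∈ K
  · obtain ⟨x, -, hx⟩ := hK.exists_mapClusterPt_of_frequently hfreq
    exact ⟨x, le_nhds_of_cauchy_adhp hcs hx⟩
  have hev : ∀ᶠ i in atTop, u i ∈ D := by
    filter_upwards [not_frequently.1 hfreq] with i hi
    have h1 : u i ∈ K ∪ D := hKD ▸ mem_univ _
    exact h1.resolve_left hi
  obtain ⟨I, hI⟩ := eventually_atTop.1 hev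
  -- The margin: a curve shorter than `r` starting in `D` cannot leave `e.target`, so it lifts to
  -- `M` with the same length.
  obtain ⟨r, hr, hsep⟩ := Metric.exists_pos_forall_lt_edist heT hD
    (disjoint_left.2 fun q hq hqD => hq (hDe hqD))
  have hlift : ∀ q ∈ D, ∀ q', ∀ ε : ENNReal, ε ≤ r → edist q q' < ε →
      gDist g (e.symm q) (e.symm q') < ε := by
    intro q hq q' ε hε hqq'
    obtain ⟨γ, rfl, rfl, hγ, hlen⟩ := exists_gLen_lt k hqq'
    refine (gDist_symm_le_gLen hs hk hγ zero_le_one fun t ht => ?_).trans_lt hlen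
    by_contra hnot
    have h1 : gDist k (γ 0) (γ t) ≤ gLen k γ 0 t := gDist_le_gLen k hγ.contMDiffOn ht.1
    have h2 := hsep (γ t) hnot (γ 0) hq
    have h3 : edist (γ t) (γ 0) ≤ gLen k γ 0 1 := by
      rw [edist_comm]
      exact h1.trans (gLen_mono k γ le_rfl ht.2)
    exact absurd (h2.trans_le h3) (not_lt.2 (hlen.le.trans hε))
  obtain ⟨x, hx⟩ := hg (fun i => e.symm (u i)) fun ε hε => by
    obtain ⟨J, hJ⟩ := hu (min ε r) (lt_min hε (ENNReal.coe_pos.2 hr))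
    refine ⟨max I J, fun i hi j hj => ?_⟩
    refine (hlift (u i) (hI i ((le_max_left _ _).trans hi)) (u j) (min ε r) (min_le_right _ _)
      (hJ i ((le_max_right _ _).trans hi) j ((le_max_right _ _).trans hj))).trans_le
      (min_le_left _ _)
  have hxD : x ∈ e.symm '' D :=
    hDs.mem_of_tendsto hx (hev.mono fun i hi => mem_image_of_mem _ hi)
  obtain ⟨q, hqD, rfl⟩ := hxD
  have hqs : e.symm q ∈ e.source := e.map_target (hDe hqD)
  refine ⟨e (e.symm q), ?_⟩
  refine ((e.continuousAt hqs).tendsto.comp hx).congr' ?_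
  filter_upwards [hev] with i hi
  exact e.right_inv (hDe hi)

end Distance

/-! ### The conformal factor near infinity -/

section ConformalFactor

variable {n : ℕ} {M : Type*} [TopologicalSpace M] [ChartedSpace (Euc n) M]
  [IsManifold (𝓡 n) ∞ M] {g : C0Metric n M} {φ : OpenPartialHomeomorph M (Euc n)}

lemma mem_nhds_lt_norm {s : ℝ} {y : Euc n} (hy : s < ‖y‖) : ∀ᶠ z in 𝓝 y, s < ‖z‖ :=
  (isOpen_lt continuous_const continuous_norm).mem_nhds hy

lemma IsAFEnd.contDiffAt_coordMetric (hφ : IsAFEnd g φ) {y : Euc n} (hy : 1 < ‖y‖) (i j : Fin n) :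
    ContDiffAt ℝ ∞ (fun z => coordMetric g φ z i j) y := by
  have hyT : y ∈ φ.target := by rw [hφ.target_eq]; exact hy
  exact (hφ.smooth φ hφ.mem_atlas i j).contDiffAt
    ((φ.isOpen_inter_preimage_symm φ.open_source).mem_nhds ⟨hyT, φ.map_target hyT⟩)

lemma IsAFEnd.tendsto_coordMetric (hφ : IsAFEnd g φ) (hn : 3 ≤ n) (i j : Fin n) :
    Tendsto (fun y => coordMetric g φ y i j) (Bornology.cobounded (Euc n))
      (𝓝 ((1 : Matrix (Fin n) (Fin n) ℝ) i j)) := by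
  obtain ⟨C, σ, hσ, h⟩ := hφ.decay
  have hσ0 : 0 < σ := by
    have : (3 : ℝ) ≤ n := by exact_mod_cast hn
    linarith
  rw [tendsto_iff_norm_sub_tendsto_zero]
  have hlim : Tendsto (fun y : Euc n => C * ‖y‖ ^ (-σ)) (Bornology.cobounded (Euc n)) (𝓝 0) := by
    simpa using ((tendsto_rpow_neg_atTop hσ0).comp tendsto_norm_cobounded_atTop).const_mul C
  refine squeeze_zero' (Eventually.of_forall fun y => norm_nonneg _) ?_ hlim
  filter_upwards [tendsto_norm_cobounded_atTop.eventually (eventually_gt_atTop 1)] with y hy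
  refine le_trans ?_ (h y hy i j)
  rw [Real.norm_eq_abs, add_assoc]
  exact le_add_of_nonneg_right (by positivity)

/-- For `f δ` the integrand contracts to `-(n - 1) ∂ᵢf νⁱ`. The minus sign is why a negative mass
means a positive flux of the conformal factor. -/
lemma admFlux_eq_of_conformal (hn : 3 ≤ n) {f : Euc n → ℝ} {s r : ℝ} (hs : 0 < s) (hr : s < r)
    (hf : ∀ y : Euc n, s < ‖y‖ → DifferentiableAt ℝ f y)
    (hG : ∀ y : Euc n, s < ‖y‖ → coordMetric g φ y = f y • (1 : Matrix (Fin n) (Fin n) ℝ)) :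
    admFlux g φ r = -((2 * ((volume : Measure (Euc n)).toSphere univ).toReal)⁻¹ *
      (r ^ (n - 1) * ∫ w : Metric.sphere (0 : Euc n) 1,
        fderiv ℝ f (r • (w : Euc n)) (w : Euc n) ∂(sphereMeasure n))) := by
  have hn1 : (0 : ℝ) < (n : ℝ) - 1 := by
    have : (3 : ℝ) ≤ n := by exact_mod_cast hn
    linarith
  have hint : ∀ w : Metric.sphere (0 : Euc n) 1,
      (∑ i, ∑ j, (pderiv j (fun z => coordMetric g φ z i j) (r • (w : Euc n))
        - pderiv i (fun z => coordMetric g φ z j j) (r • (w : Euc n))) * (w : Euc n) i)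
      = -((n : ℝ) - 1) * fderiv ℝ f (r • (w : Euc n)) (w : Euc n) := by
    intro w
    have hw : s < ‖r • (w : Euc n)‖ := by
      rw [norm_smul, norm_eq_of_mem_sphere w, mul_one, Real.norm_of_nonneg (by linarith)]
      exact hr
    set y := r • (w : Euc n)
    have hp : ∀ l i j, pderiv l (fun z => coordMetric g φ z i j) y
        = pderiv l f y * (1 : Matrix (Fin n) (Fin n) ℝ) i j := by
      intro l i j
      rw [← pderiv_mul_const _ (hf y hw)]
      refine pderiv_congr ?_
      filter_upwards [mem_nhds_lt_norm hw] with z hz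
      rw [hG z hz]
      rfl
    have hfd : fderiv ℝ f y (w : Euc n) = ∑ i, pderiv i f y * (w : Euc n) i := by
      have hsum : (w : Euc n) = ∑ i, (w : Euc n) i • basisVec n i := by
        have := (EuclideanSpace.basisFun (Fin n) ℝ).sum_repr (w : Euc n)
        simpa [basisVec] using this.symm
      conv_lhs => rw [hsum]
      simp only [map_sum, map_smul, smul_eq_mul, pderiv, mul_comm]
    rw [hfd, Finset.mul_sum]
    refine Finset.sum_congr rfl fun i _ => ?_
    simp only [hp, Matrix.one_apply]
    rw [← Finset.sum_mul, Finset.sum_sub_distrib]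
    simp
    ring
  rw [admFlux]
  simp only [hint]
  rw [integral_const_mul]
  field_simp

/-- A superharmonic modification `v`, constant for `r ≥ s₃`, of the conformal factor `u` of an
asymptotically flat end. -/
structure IsConformalCap (g : C0Metric n M) (φ : OpenPartialHomeomorph M (Euc n))
    (u v : Euc n → ℝ) (s₀ s₁ s₂ s₃ ε c : ℝ) : Prop where
  one_le : 1 ≤ s₀
  lt₀ : s₀ + ε < s₁
  lt₁ : s₁ < s₂
  lt₂ : s₂ < s₃
  ε_pos : 0 < ε
  c_pos : 0 < c
  u_pos : ∀ y : Euc n, s₀ < ‖y‖ → 0 < u y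
  u_smooth : ∀ y : Euc n, s₀ < ‖y‖ → ContDiffAt ℝ ∞ u y
  coordMetric_eq : ∀ y : Euc n, s₀ < ‖y‖ →
    coordMetric g φ y = (u y ^ (4 / ((n : ℝ) - 2))) • (1 : Matrix (Fin n) (Fin n) ℝ)
  v_pos : ∀ y : Euc n, s₀ < ‖y‖ → 0 < v y
  v_smooth : ∀ y : Euc n, s₀ < ‖y‖ → ContDiffAt ℝ ∞ v y
  v_eq_u : ∀ y : Euc n, s₁ - ε < ‖y‖ → ‖y‖ < s₁ + ε → v y = u y
  lap_nonpos : ∀ y : Euc n, s₀ < ‖y‖ → lap v y ≤ 0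
  lap_neg : ∀ y : Euc n, s₂ ≤ ‖y‖ → ‖y‖ < s₃ → lap v y < 0
  v_const : ∀ y : Euc n, s₃ ≤ ‖y‖ → v y = c

theorem exists_isConformalCap (hn : 3 ≤ n) (hφ : IsAFEnd g φ)
    (hflat : IsConformallyFlatScalarFlatNearInfinity g φ) {m : ℝ} (hm : HasADMMass g φ m)
    (hm_neg : m < 0) : ∃ u v s₀ s₁ s₂ s₃ ε c, IsConformalCap g φ u v s₀ s₁ s₂ s₃ ε c := by
  obtain ⟨s₀, hs₀, u, hu⟩ := hflat
  have hn3 : (3 : ℝ) ≤ n := by exact_mod_cast hn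
  have hn2 : (0 : ℝ) < (n : ℝ) - 2 := by linarith
  set p : ℝ := 4 / ((n : ℝ) - 2) with hp
  have hp0 : 0 < p := by positivity
  have hs0 : 0 < s₀ := by linarith
  have hpos : ∀ y : Euc n, s₀ < ‖y‖ → 0 < u y := fun y hy => (hu y hy).1
  have hG : ∀ y : Euc n, s₀ < ‖y‖ → coordMetric g φ y = (u y ^ p) • (1 : Matrix _ _ ℝ) :=
    fun y hy => (hu y hy).2.1
  let i₀ : Fin n := ⟨0, by omega⟩
  -- Nothing is assumed about the regularity or limit of `u`; both are recovered from a diagonal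
  -- entry of the metric.
  have hu_eq : ∀ y : Euc n, s₀ < ‖y‖ → u y = (coordMetric g φ y i₀ i₀) ^ p⁻¹ := by
    intro y hy
    rw [hG y hy, Matrix.smul_apply, Matrix.one_apply_eq, smul_eq_mul, mul_one,
      Real.rpow_rpow_inv (hpos y hy).le hp0.ne']
  have husm : ∀ y : Euc n, s₀ < ‖y‖ → ContDiffAt ℝ ∞ u y := by
    intro y hy
    have h1 := hφ.contDiffAt_coordMetric (hs₀.trans_lt hy) i₀ i₀
    have hne : coordMetric g φ y i₀ i₀ ≠ 0 := by
      rw [hG y hy, Matrix.smul_apply, Matrix.one_apply_eq, smul_eq_mul, mul_one]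
      exact (Real.rpow_pos_of_pos (hpos y hy) p).ne'
    refine (h1.rpow_const_of_ne (p := p⁻¹) hne).congr_of_eventuallyEq ?_
    filter_upwards [mem_nhds_lt_norm hy] with z hz using hu_eq z hz
  have hlap : ∀ y : Euc n, s₀ < ‖y‖ → lap u y = 0 := by
    intro y hy
    have h1 := scalarCoord_conformal hn ((husm y hy).of_le two_le_infty) (hpos y hy)
      (G := coordMetric g φ) (by filter_upwards [mem_nhds_lt_norm hy] with z hz using hG z hz)
    rw [(hu y hy).2.2] at h1
    have h2 : (0 : ℝ) < (u y ^ (4 / ((n : ℝ) - 2)))⁻¹ * (4 * ((n : ℝ) - 1) / ((n : ℝ) - 2))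
        * (u y)⁻¹ := by
      have := Real.rpow_pos_of_pos (hpos y hy) (4 / ((n : ℝ) - 2))
      have := hpos y hy
      have : (0 : ℝ) < (n : ℝ) - 1 := by linarith
      positivity
    rcases mul_eq_zero.1 (neg_eq_zero.1 h1.symm) with h3 | h3
    · exact absurd h3 h2.ne'
    · exact h3
  have hlim : Tendsto u (Bornology.cobounded (Euc n)) (𝓝 1) := by
    have h1 := (hφ.tendsto_coordMetric hn i₀ i₀).rpow_const (p := p⁻¹) (Or.inl (by simp))
    rw [Matrix.one_apply_eq, Real.one_rpow] at h1
    refine h1.congr' ?_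
    filter_upwards [tendsto_norm_cobounded_atTop.eventually (eventually_gt_atTop s₀)] with y hy
    exact (hu_eq y hy).symm
  have hfd : ∀ y : Euc n, s₀ < ‖y‖ → DifferentiableAt ℝ (fun y => u y ^ p) y := fun y hy =>
    ((husm y hy).rpow_const_of_ne (hpos y hy).ne').differentiableAt (by simp)
  set A : ℝ := ((volume : Measure (Euc n)).toSphere univ).toReal
  have hA0 : 0 ≤ A := ENNReal.toReal_nonneg
  have hflux0 : ∀ᶠ r in atTop, m / 2 > -((2 * A)⁻¹ * (r ^ (n - 1) *
      ∫ w : Metric.sphere (0 : Euc n) 1, fderiv ℝ (fun y => u y ^ p) (r • (w : Euc n)) (w : Euc n)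
        ∂(sphereMeasure n))) := by
    filter_upwards [hm.eventually (gt_mem_nhds (show m < m / 2 by linarith)),
      eventually_gt_atTop s₀] with r h1 h2
    rwa [admFlux_eq_of_conformal hn hs0 h2 hfd hG] at h1
  -- For `A = 0` the convention `0⁻¹ = 0` would make the flux expression vanish, forcing `m / 2 >
  -- 0`.
  have hA : 0 < A := by
    refine lt_of_le_of_ne hA0 fun h0 => ?_
    obtain ⟨r, hr⟩ := hflux0.exists
    rw [← h0] at hr
    simp at hr
    linarith
  have hlt := eventually_lt_one_of_flux hn hs0 hp0 hpos
    (fun y hy => (husm y hy).of_le two_le_infty) hlap hlim (ℓ := -m * A)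
    (mul_pos (by linarith) hA) (by
      filter_upwards [hflux0] with r hr
      set X := r ^ (n - 1) * ∫ w : Metric.sphere (0 : Euc n) 1,
        fderiv ℝ (fun y => u y ^ p) (r • (w : Euc n)) (w : Euc n) ∂(sphereMeasure n)
      have h1 : -m / 2 < (2 * A)⁻¹ * X := by linarith
      rw [inv_mul_eq_div, lt_div_iff₀ (by positivity)] at h1
      linarith)
  obtain ⟨v, s₁, s₂, s₃, ε, c, h1, h2, h3, h4, h5, h6, h7, h8, h9, h10, h11⟩ :=
    exists_superharmonic_flattening hs0 hpos husm hlap hlim hlt (by omega)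
  exact ⟨u, v, s₀, s₁, s₂, s₃, ε, c, hs₀, h1, h2, h3, h4, h5, hpos, husm, hG, h6, h7, h8, h9,
    h10, h11⟩

end ConformalFactor

/-! ### The capped metric and its scalar curvature. -/

section Cap

set_option linter.unusedSectionVars false

variable {n : ℕ} {M : Type*} [TopologicalSpace M] [ChartedSpace (Euc n) M]
  [IsManifold (𝓡 n) ∞ M] {g : C0Metric n M} {φ : OpenPartialHomeomorph M (Euc n)}
  {u v : Euc n → ℝ} {s₀ s₁ s₂ s₃ ε c : ℝ}

open Classical in
/-- The factor by which the metric is multiplied in order to replace `u` by `v` for `r ≥ s₁`. -/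
def capFactor (φ : OpenPartialHomeomorph M (Euc n)) (u v : Euc n → ℝ) (s₁ : ℝ) (x : M) : ℝ :=
  if x ∈ endRegion φ s₁ then (v (φ x) / u (φ x)) ^ (4 / ((n : ℝ) - 2)) else 1

namespace IsConformalCap

lemma capFactor_of_notMem {x : M} (hx : x ∉ endRegion φ s₁) : capFactor φ u v s₁ x = 1 :=
  if_neg hx

/-- The formula extends inwards past the sphere `r = s₁`, since `v = u` on the collar of width `ε`;
this makes the factor smooth across that sphere. -/
lemma capFactor_eq (h : IsConformalCap g φ u v s₀ s₁ s₂ s₃ ε c) {x : M} (hx : x ∈ φ.source)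
    (hxs : s₁ - ε < ‖φ x‖) :
    capFactor φ u v s₁ x = (v (φ x) / u (φ x)) ^ (4 / ((n : ℝ) - 2)) := by
  by_cases hxE : x ∈ endRegion φ s₁
  · exact if_pos hxE
  · have hlt : ‖φ x‖ < s₁ := not_le.1 fun hle => hxE ⟨hx, hle⟩
    have hu := h.u_pos (φ x) (by linarith [h.lt₀])
    rw [capFactor_of_notMem hxE, h.v_eq_u _ hxs (by linarith [h.ε_pos]), div_self hu.ne',
      Real.one_rpow]

lemma capFactor_pos (h : IsConformalCap g φ u v s₀ s₁ s₂ s₃ ε c) (x : M) :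
    0 < capFactor φ u v s₁ x := by
  by_cases hxE : x ∈ endRegion φ s₁
  · have hlt : s₀ < ‖φ x‖ := by linarith [h.lt₀, h.ε_pos, hxE.2]
    rw [h.capFactor_eq hxE.1 (by linarith [h.ε_pos, hxE.2])]
    exact Real.rpow_pos_of_pos (div_pos (h.v_pos _ hlt) (h.u_pos _ hlt)) _
  · rw [capFactor_of_notMem hxE]
    exact one_pos

lemma eventually_capFactor_eq_one (h : IsConformalCap g φ u v s₀ s₁ s₂ s₃ ε c) (hφ : IsAFEnd g φ)
    {x : M} (hx : x ∉ endRegion φ s₁) : capFactor φ u v s₁ =ᶠ[𝓝 x] 1 := by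
  have h1 : 1 < s₁ := by linarith [h.one_le, h.lt₀, h.ε_pos]
  filter_upwards [(hφ.isClosed_endRegion s₁ h1).isOpen_compl.mem_nhds hx] with z hz
  exact capFactor_of_notMem hz

lemma contMDiff_capFactor (h : IsConformalCap g φ u v s₀ s₁ s₂ s₃ ε c) (hφ : IsAFEnd g φ) :
    ContMDiff (𝓡 n) 𝓘(ℝ, ℝ) ∞ (capFactor φ u v s₁) := by
  intro x
  by_cases hxE : x ∈ endRegion φ s₁
  · have hs : s₁ - ε < ‖φ x‖ := by linarith [h.ε_pos, hxE.2]
    have hlt : s₀ < ‖φ x‖ := by linarith [h.lt₀, h.ε_pos, hxE.2]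
    have h1 : ContDiffAt ℝ ∞ (fun y => (v y / u y) ^ (4 / ((n : ℝ) - 2))) (φ x) :=
      ((h.v_smooth _ hlt).fun_div (h.u_smooth _ hlt) (h.u_pos _ hlt).ne').rpow_const_of_ne
        (div_pos (h.v_pos _ hlt) (h.u_pos _ hlt)).ne'
    have h2 : ContMDiffAt (𝓡 n) 𝓘(ℝ, ℝ) ∞
        ((fun y => (v y / u y) ^ (4 / ((n : ℝ) - 2))) ∘ φ) x :=
      (contMDiffAt_iff_contDiffAt.2 h1).comp x (contMDiffAt_of_mem_maximalAtlas hφ.mem_atlas hxE.1)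
    refine h2.congr_of_eventuallyEq ?_
    filter_upwards [φ.open_source.mem_nhds hxE.1,
      (φ.continuousAt hxE.1).eventually (mem_nhds_lt_norm hs)] with z hz1 hz2
    exact h.capFactor_eq hz1 hz2
  · exact contMDiffAt_const.congr_of_eventuallyEq (h.eventually_capFactor_eq_one hφ hxE)

/-- The modified metric. -/
def metric (h : IsConformalCap g φ u v s₀ s₁ s₂ s₃ ε c) (hφ : IsAFEnd g φ) : C0Metric n M :=
  scaleMetric g (capFactor φ u v s₁) (h.contMDiff_capFactor hφ).continuous h.capFactor_pos

lemma coordMetric_metric (h : IsConformalCap g φ u v s₀ s₁ s₂ s₃ ε c) (hφ : IsAFEnd g φ)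
    {y : Euc n} (hy : s₁ - ε < ‖y‖) : coordMetric (h.metric hφ) φ y
      = (v y ^ (4 / ((n : ℝ) - 2))) • (1 : Matrix (Fin n) (Fin n) ℝ) := by
  have hlt : s₀ < ‖y‖ := by linarith [h.lt₀]
  have hyT : y ∈ φ.target := by
    rw [hφ.target_eq]
    exact h.one_le.trans_lt hlt
  have hu := h.u_pos y hlt
  rw [metric, coordMetric_scaleMetric, h.coordMetric_eq y hlt,
    h.capFactor_eq (φ.map_target hyT) (by rwa [φ.right_inv hyT]), φ.right_inv hyT, smul_smul,
    ← Real.mul_rpow (div_pos (h.v_pos y hlt) hu).le hu.le, div_mul_cancel₀ _ hu.ne']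

lemma inner_metric (h : IsConformalCap g φ u v s₀ s₁ s₂ s₃ ε c) (hφ : IsAFEnd g φ) {x : M}
    (hx : x ∉ endRegion φ s₁) (w w' : TangentSpace (𝓡 n) x) :
    (h.metric hφ).inner x w w' = g.inner x w w' := by
  have h1 : (h.metric hφ).inner x w w' = capFactor φ u v s₁ x * g.inner x w w' := rfl
  rw [h1, capFactor_of_notMem hx, one_mul]

lemma hasSingularSet_metric (h : IsConformalCap g φ u v s₀ s₁ s₂ s₃ ε c) (hφ : IsAFEnd g φ)
    {S : Set M} {p : ENNReal} (hS : HasSingularSet p g S) (hSφ : Disjoint S φ.source) :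
    HasSingularSet p (h.metric hφ) S :=
  hasSingularSet_scaleMetric _ _ hS (fun _ hx => h.eventually_capFactor_eq_one hφ
    fun hxE => disjoint_left.1 hSφ hx hxE.1) fun x => h.contMDiff_capFactor hφ x

lemma scalarCoord_metric (h : IsConformalCap g φ u v s₀ s₁ s₂ s₃ ε c) (hφ : IsAFEnd g φ)
    (hn : 3 ≤ n) {y : Euc n} (hy : s₁ - ε < ‖y‖) :
    ∃ C : ℝ, 0 < C ∧ scalarCoord (coordMetric (h.metric hφ) φ) y = -(C * lap v y) := by
  have hlt : s₀ < ‖y‖ := by linarith [h.lt₀]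
  refine ⟨_, ?_, scalarCoord_conformal hn ((h.v_smooth y hlt).of_le two_le_infty) (h.v_pos y hlt) ?_⟩
  · have hn3 : (3 : ℝ) ≤ n := by exact_mod_cast hn
    have h1 : (0 : ℝ) < (n : ℝ) - 2 := by linarith
    have h2 : (0 : ℝ) < (n : ℝ) - 1 := by linarith
    have h3 := h.v_pos y hlt
    have := Real.rpow_pos_of_pos h3 (4 / ((n : ℝ) - 2))
    positivity
  · filter_upwards [mem_nhds_lt_norm hy] with z hz using h.coordMetric_metric hφ hz

open Classical in
/-- Charts which are `φ` where the metric is modified. -/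
def chart (φ : OpenPartialHomeomorph M (Euc n)) (s : ℝ) (x : M) :
    OpenPartialHomeomorph M (Euc n) :=
  if x ∈ φ.source ∧ s < ‖φ x‖ then φ else chartAt (Euc n) x

lemma chart_mem_maximalAtlas (hφ : φ ∈ IsManifold.maximalAtlas (𝓡 n) ∞ M) (s : ℝ) (x : M) :
    chart φ s x ∈ IsManifold.maximalAtlas (𝓡 n) ∞ M := by
  unfold chart
  split_ifs
  · exact hφ
  · exact IsManifold.chart_mem_maximalAtlas x

lemma mem_chart_source (φ : OpenPartialHomeomorph M (Euc n)) (s : ℝ) (x : M) :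
    x ∈ (chart φ s x).source := by
  unfold chart
  split_ifs with h
  · exact h.1
  · exact ChartedSpace.mem_chart_source x

lemma scalarCoord_pos (h : IsConformalCap g φ u v s₀ s₁ s₂ s₃ ε c) (hφ : IsAFEnd g φ)
    (hn : 3 ≤ n) {x : M} (hx : x ∈ φ.source) (hx₂ : s₂ ≤ ‖φ x‖) (hx₃ : ‖φ x‖ < s₃) :
    0 < scalarCoord (coordMetric (h.metric hφ) (chart φ (s₁ - ε) x)) (chart φ (s₁ - ε) x x) := by
  have hs : s₁ - ε < ‖φ x‖ := by linarith [h.lt₁, h.ε_pos]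
  rw [chart, if_pos ⟨hx, hs⟩]
  obtain ⟨C, hC, hCe⟩ := h.scalarCoord_metric hφ hn hs
  rw [hCe]
  have := h.lap_neg (φ x) hx₂ hx₃
  nlinarith

/-- Where the chart is `φ`, superharmonicity of `v` gives the sign; elsewhere the capped metric has
the same germ as `g`. -/
lemma scalarCoord_nonneg (h : IsConformalCap g φ u v s₀ s₁ s₂ s₃ ε c) (hφ : IsAFEnd g φ)
    (hn : 3 ≤ n) {x : M} (hx : 0 ≤ scalarCurv g x) :
    0 ≤ scalarCoord (coordMetric (h.metric hφ) (chart φ (s₁ - ε) x)) (chart φ (s₁ - ε) x x) := by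
  by_cases hxs : x ∈ φ.source ∧ s₁ - ε < ‖φ x‖
  · rw [chart, if_pos hxs]
    obtain ⟨C, hC, hCe⟩ := h.scalarCoord_metric hφ hn hxs.2
    rw [hCe]
    have := h.lap_nonpos (φ x) (by linarith [h.lt₀, hxs.2])
    nlinarith
  · rw [chart, if_neg hxs]
    have hxE : x ∉ endRegion φ s₁ := fun hxE => hxs ⟨hxE.1, by linarith [h.ε_pos, hxE.2]⟩
    rw [scalarCurv] at hx
    refine hx.trans_eq (scalarCoord_congr ?_)
    have h1 := ((chartAt (Euc n) x).continuousAt_symm (mem_chart_target _ x)).eventually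
      (by rw [(chartAt (Euc n) x).left_inv (ChartedSpace.mem_chart_source x)]
          exact h.eventually_capFactor_eq_one hφ hxE)
    filter_upwards [h1] with z hz
    rw [metric, coordMetric_scaleMetric, hz, Pi.one_apply, one_smul]

end IsConformalCap

end Cap

/-! ### The capped end in the quotient -/

section CappedEnd

set_option linter.unusedSectionVars false

variable {n : ℕ} {M : Type u} [TopologicalSpace M] {φ : OpenPartialHomeomorph M (Euc n)} {a L : ℝ}
  {N : Type*} [TopologicalSpace N] {pr : M → N}

/-- The image of `{r > t}`. -/
def outerImage (pr : M → N) (φ : OpenPartialHomeomorph M (Euc n)) (a L t : ℝ) : Set N :=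
  pr '' (glueDomain φ a L ∩ {x | x ∈ φ.source ∧ t < ‖φ x‖})

/-- The image of `{r ≥ t}`. -/
def closedOuterImage (pr : M → N) (φ : OpenPartialHomeomorph M (Euc n)) (a L t : ℝ) : Set N :=
  pr '' (glueDomain φ a L ∩ {x | x ∈ φ.source ∧ t ≤ ‖φ x‖})

lemma outerImage_subset (t : ℝ) : outerImage pr φ a L t ⊆ closedOuterImage pr φ a L t :=
  image_mono fun _ hx => ⟨hx.1, hx.2.1, hx.2.2.le⟩

lemma closedOuterImage_subset {t t' : ℝ} (h : t' < t) :
    closedOuterImage pr φ a L t ⊆ outerImage pr φ a L t' :=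
  image_mono fun _ hx => ⟨hx.1, hx.2.1, h.trans_le hx.2.2⟩

namespace IsGlueQuotient

lemma isOpen_outerImage (hq : IsGlueQuotient φ a L pr) (h : IsGlueable φ a L) (t : ℝ) :
    IsOpen (outerImage pr φ a L t) := by
  refine hq.isOpen_image _ inter_subset_left (h.isOpen_glueDomain.inter ?_)
  exact φ.isOpen_inter_preimage (isOpen_lt continuous_const continuous_norm :
    IsOpen {z : Euc n | t < ‖z‖})

lemma isClosed_closedOuterImage (hq : IsGlueQuotient φ a L pr) (h : IsGlueable φ a L) {t : ℝ}
    (ht : 1 < t) (hta : t ≤ a) : IsClosed (closedOuterImage pr φ a L t) := by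
  refine hq.isClosed_image h (h.isClosed_endRegion t ht) fun x hx y hxy => ?_
  rcases hxy with rfl | hxy
  · exact hx
  · exact ⟨hxy.2.1.1, hta.trans hxy.2.1.2⟩

/-- All identifications take place in `{r ≥ a}`, so `{r > t}` is saturated for `t < a` and the
radius still makes sense below `a` in the quotient. -/
lemma mem_outerImage_iff (hq : IsGlueQuotient φ a L pr) {t : ℝ} (hta : t < a) {x : M}
    (hx : x ∈ glueDomain φ a L) : pr x ∈ outerImage pr φ a L t ↔ x ∈ φ.source ∧ t < ‖φ x‖ := by
  constructor
  · rintro ⟨y, ⟨hyW, hy⟩, hyx⟩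
    rcases (hq.eq_iff y hyW x hx).1 hyx with rfl | hxy
    · exact hy
    · exact ⟨hxy.2.1.1, hta.trans_le hxy.2.1.2⟩
  · exact fun hxt => ⟨x, ⟨hx, hxt⟩, rfl⟩

lemma mem_closedOuterImage_iff (hq : IsGlueQuotient φ a L pr) {t : ℝ} (hta : t ≤ a) {x : M}
    (hx : x ∈ glueDomain φ a L) :
    pr x ∈ closedOuterImage pr φ a L t ↔ x ∈ φ.source ∧ t ≤ ‖φ x‖ := by
  constructor
  · rintro ⟨y, ⟨hyW, hy⟩, hyx⟩
    rcases (hq.eq_iff y hyW x hx).1 hyx with rfl | hxy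
    · exact hy
    · exact ⟨hxy.2.1.1, hta.trans hxy.2.1.2⟩
  · exact fun hxt => ⟨x, ⟨hx, hxt⟩, rfl⟩

lemma exists_norm_eq (h : IsGlueable φ a L) (hn : 0 < n) {r : ℝ} (hr : 1 < r) (hra : r ≤ a) :
    ∃ x ∈ glueDomain φ a L, x ∈ φ.source ∧ ‖φ x‖ = r := by
  have : Nonempty (Fin n) := ⟨⟨0, hn⟩⟩
  obtain ⟨z, hz⟩ := NormedSpace.sphere_nonempty (x := (0 : Euc n)).2 (by linarith : 0 ≤ r)
  have hz : ‖z‖ = r := by simpa using hz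
  have hzT : z ∈ φ.target := by rw [h.target_eq, mem_ofPred_eq, hz]; exact hr
  refine ⟨φ.symm z, symm_mem h (mem_cube_of_norm_le ?_) (hz ▸ hr), φ.map_target hzT, ?_⟩
  · rw [hz]; linarith [h.lt]
  · rw [φ.right_inv hzT, hz]

lemma nonempty_frontier_outerImage [ConnectedSpace M] (hq : IsGlueQuotient φ a L pr)
    (h : IsGlueable φ a L) (hn : 0 < n) {t : ℝ} (ht : 1 < t) (hta : t < a) :
    (frontier (outerImage pr φ a L t)).Nonempty := by
  have : ConnectedSpace N := hq.connectedSpace h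
  rw [nonempty_frontier_iff]
  obtain ⟨x, hxW, hxφ, hx⟩ := exists_norm_eq h hn h.one_lt le_rfl
  obtain ⟨y, hyW, hyφ, hy⟩ := exists_norm_eq h hn ht hta.le
  refine ⟨⟨pr x, (hq.mem_outerImage_iff hta hxW).2 ⟨hxφ, hx ▸ hta⟩⟩, fun hu => ?_⟩
  have h1 := (hq.mem_outerImage_iff hta hyW).1 (hu ▸ mem_univ _)
  exact absurd h1.2 (hy ▸ lt_irrefl _)

lemma disjoint_image_closure_outerImage (hq : IsGlueQuotient φ a L pr) (h : IsGlueable φ a L)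
    {S : Set M} (hS : Disjoint S φ.source) {t : ℝ} (ht : 1 < t) (hta : t ≤ a) :
    Disjoint (pr '' S) (closure (outerImage pr φ a L t)) := by
  refine Disjoint.mono_right (closure_minimal (outerImage_subset t)
    (hq.isClosed_closedOuterImage h ht hta)) ?_
  rw [disjoint_left]
  rintro _ ⟨x, hxS, rfl⟩ hx
  have hxφ := disjoint_left.1 hS hxS
  exact hxφ ((hq.mem_closedOuterImage_iff hta fun hx' => absurd hx' hxφ).1 hx).1

variable [ChartedSpace (Euc n) M] [IsManifold (𝓡 n) ∞ M] [ChartedSpace (Euc n) N]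
  [IsManifold (𝓡 n) ∞ N]

lemma smul_sub_latVec (L : ℝ) (x : Euc n) (k : Fin n → ℤ) :
    L • x - latVec L k = L • (x - WithLp.toLp 2 (fun i => (k i : ℝ))) := by
  rw [smul_sub, latVec]

lemma smul_mem_target (h : IsGlueable φ a L) {ρ : ℝ} (hρ : a ≤ L * ρ) {x : Euc n}
    (hx : x ∈ perforatedSpace n ρ) : L • x ∈ φ.target ∧ φ.symm (L • x) ∈ periodicPart φ a L := by
  have hL := h.L_pos
  have h1 : ∀ k : Fin n → ℤ, a < ‖L • x - latVec L k‖ := by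
    intro k
    rw [smul_sub_latVec, norm_smul, Real.norm_of_nonneg hL.le]
    exact hρ.trans_lt (mul_lt_mul_of_pos_left (hx k) hL)
  have h2 : L • x ∈ φ.target := by
    have := h1 0
    rw [latVec_zero, sub_zero] at this
    rw [h.target_eq]
    exact h.one_lt.trans this
  exact ⟨h2, φ.map_target h2, by rwa [φ.right_inv h2]⟩

/-- Dilation by `L` turns `ℤⁿ` into the lattice of the gluing and `ρ`-balls into balls of radius `L
ρ ≥ a`, so the perforated space lands in the periodic part, where the fibres of `pr` are the lattice
orbits. -/
lemma isTorusMinusBall (hq : IsGlueQuotient φ a L pr) (h : IsGlueable φ a L)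
    (hφ : φ ∈ IsManifold.maximalAtlas (𝓡 n) ∞ M)
    (het : IsSmoothEtale (n := n) pr (glueDomain φ a L)) {ρ : ℝ} (hρ0 : 0 < ρ) (hρ : ρ < 1 / 2)
    (haρ : a ≤ L * ρ) :
    IsTorusMinusBall n ((fun x => pr (φ.symm (L • x))) '' perforatedSpace n ρ) := by
  have hL := h.L_pos
  refine ⟨ρ, hρ0, hρ, fun x => pr (φ.symm (L • x)), ?_, rfl, ?_⟩
  · rintro ⟨x, hx⟩
    obtain ⟨hxT, hxP⟩ := smul_mem_target h haρ hx
    obtain ⟨e, hxe, he⟩ := het.exists_piece _ (IsGlueable.periodicPart_subset hxP)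
    let Φ₁ : PartialDiffeomorph (𝓡 n) (𝓡 n) (Euc n) (Euc n) ∞ :=
      { toPartialEquiv := (Homeomorph.smulOfNeZero L hL.ne').toEquiv.toPartialEquiv
        open_source := isOpen_univ
        open_target := isOpen_univ
        contMDiffOn_toFun := contMDiffOn_iff_contDiffOn.2 (contDiff_const_smul L).contDiffOn
        contMDiffOn_invFun := contMDiffOn_iff_contDiffOn.2 (contDiff_const_smul L⁻¹).contDiffOn }
    let Φ₂ : PartialDiffeomorph (𝓡 n) (𝓡 n) (Euc n) M ∞ :=
      { toPartialEquiv := φ.symm.toPartialEquiv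
        open_source := φ.open_target
        open_target := φ.open_source
        contMDiffOn_toFun := contMDiffOn_symm_of_mem_maximalAtlas hφ
        contMDiffOn_invFun := contMDiffOn_of_mem_maximalAtlas hφ }
    let Φ₃ : PartialDiffeomorph (𝓡 n) (𝓡 n) M N ∞ :=
      { toPartialEquiv := e.toPartialEquiv
        open_source := e.open_source
        open_target := e.open_target
        contMDiffOn_toFun := he.smooth
        contMDiffOn_invFun := he.smooth_symm }
    refine ⟨Φ₁.trans (Φ₂.trans Φ₃), ⟨mem_univ _, hxT, hxe⟩, fun z _ => ?_⟩
    have h1 : (Φ₁.trans (Φ₂.trans Φ₃)) z = e (φ.symm (L • z)) := rfl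
    rw [h1, he.coe_eq]
  · intro x hx y hy
    obtain ⟨hxT, hxP⟩ := smul_mem_target h haρ hx
    obtain ⟨hyT, hyP⟩ := smul_mem_target h haρ hy
    have hxa := IsGlueable.lt_norm_of_mem_periodicPart hxP
    have hya := IsGlueable.lt_norm_of_mem_periodicPart hyP
    refine (hq.eq_iff _ (IsGlueable.periodicPart_subset hxP) _
      (IsGlueable.periodicPart_subset hyP)).trans ?_
    have hiff : ∀ k : Fin n → ℤ, φ (φ.symm (L • x)) = φ (φ.symm (L • y)) + latVec L k ↔
        x - y = WithLp.toLp 2 (fun i => (k i : ℝ)) := by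
      intro k
      rw [φ.right_inv hxT, φ.right_inv hyT, ← sub_eq_iff_eq_add', ← smul_sub, latVec]
      exact smul_right_inj hL.ne'
    constructor
    · intro hr
      rcases hr.symm with heq | ⟨-, -, k, hk⟩
      · refine ⟨0, (hiff 0).1 ?_⟩
        rw [heq, latVec_zero, add_zero]
      · exact ⟨k, (hiff k).1 hk⟩
    · rintro ⟨k, hk⟩
      exact glueRel.symm (Or.inr ⟨⟨hyP.1, hya.le⟩, ⟨hxP.1, hxa.le⟩, k, (hiff k).2 hk⟩)

lemma isOpen_torusImage (hq : IsGlueQuotient φ a L pr) (h : IsGlueable φ a L) {ρ : ℝ}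
    (hρ : ρ < 1 / 2) (haρ : a ≤ L * ρ) :
    IsOpen ((fun x => pr (φ.symm (L • x))) '' perforatedSpace n ρ) := by
  have hL := h.L_pos
  -- The image is that of the periodic part for the larger radius `L ρ`; the condition `2 L ρ < L`
  -- is `ρ < 1/2`.
  have h' : IsGlueable φ (L * ρ) L :=
    ⟨h.target_eq, h.isClosed_endRegion, h.one_lt.trans_le haρ, by nlinarith⟩
  have heq : (fun x => pr (φ.symm (L • x))) '' perforatedSpace n ρ
      = pr '' periodicPart φ (L * ρ) L := by
    ext q
    constructor
    · rintro ⟨x, hx, rfl⟩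
      exact ⟨_, (smul_mem_target h' le_rfl hx).2, rfl⟩
    · rintro ⟨y, hy, rfl⟩
      refine ⟨L⁻¹ • φ y, fun k => ?_, ?_⟩
      · have h1 := hy.2 k
        rw [← smul_inv_smul₀ hL.ne' (φ y), smul_sub_latVec, norm_smul,
          Real.norm_of_nonneg hL.le] at h1
        exact lt_of_mul_lt_mul_left h1 hL.le
      · simp only [smul_inv_smul₀ hL.ne', φ.left_inv hy.1]
  rw [heq]
  refine hq.isOpen_image _ (fun x hx _ k _ => ?_) h'.isOpen_periodicPart
  exact haρ.trans_lt (hx.2 k)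

lemma torusImage_subset (h : IsGlueable φ a L) {ρ : ℝ} (haρ : a ≤ L * ρ) {t : ℝ} (hta : t ≤ a) :
    (fun x => pr (φ.symm (L • x))) '' perforatedSpace n ρ ⊆ outerImage pr φ a L t := by
  rintro _ ⟨x, hx, rfl⟩
  obtain ⟨-, hxP⟩ := smul_mem_target h haρ hx
  exact ⟨_, ⟨IsGlueable.periodicPart_subset hxP, hxP.1,
    hta.trans_lt (IsGlueable.lt_norm_of_mem_periodicPart hxP)⟩, rfl⟩

end IsGlueQuotient

end CappedEnd

/-! ### Completeness and the closing up -/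

section ClosingUp

set_option linter.unusedSectionVars false

variable {n : ℕ} {M : Type u} [TopologicalSpace M] {φ : OpenPartialHomeomorph M (Euc n)} {a L : ℝ}
  {N : Type*} [TopologicalSpace N] {pr : M → N}
  [ChartedSpace (Euc n) M] [IsManifold (𝓡 n) ∞ M] [ChartedSpace (Euc n) N]
  [IsManifold (𝓡 n) ∞ N] {g g' : C0Metric n M} {k : C0Metric n N}

namespace IsGlueQuotient

lemma isSmoothEtale [Nonempty M] (hq : IsGlueQuotient φ a L pr) (h : IsGlueable φ a L)
    (hpiece : ∀ e : OpenPartialHomeomorph M N, e.source ⊆ glueDomain φ a L → ⇑e = pr →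
      ContMDiffOn (𝓡 n) (𝓡 n) ∞ e e.source ∧ ContMDiffOn (𝓡 n) (𝓡 n) ∞ e.symm e.target) :
    IsSmoothEtale (n := n) pr (glueDomain φ a L) where
  surj := hq.surj
  exists_piece x hx := by
    obtain ⟨e, hxe, heW, he⟩ := hq.exists_local h hx
    exact ⟨e, hxe, heW, he, (hpiece e heW he).1, (hpiece e heW he).2⟩

/-- The unmodified part `{r ≥ s}ᶜ` embeds isometrically. The image of `{r > s'}ᶜ` is the closed set
with a margin, and that of `{r ≥ s'}` is compact and covers the rest. -/
lemma isCompleteMetric [Nonempty M] [RegularSpace N] (hq : IsGlueQuotient φ a L pr)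
    (h : IsGlueable φ a L)
    (hpiece : ∀ e : OpenPartialHomeomorph M N, e.source ⊆ glueDomain φ a L → ⇑e = pr →
      ContMDiffOn (𝓡 n) (𝓡 n) ∞ e e.source ∧ ContMDiffOn (𝓡 n) (𝓡 n) ∞ e.symm e.target)
    (hk : IsDescended g' k pr (glueDomain φ a L)) (hg : IsCompleteMetric g) {s s' : ℝ}
    (hs' : 1 < s') (hss' : s' < s) (hsa : s ≤ a)
    (hgg' : ∀ x ∉ endRegion φ s, ∀ v w : TangentSpace (𝓡 n) x, g'.inner x v w = g.inner x v w) :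
    IsCompleteMetric k := by
  have hsW : (endRegion φ s)ᶜ ⊆ glueDomain φ a L := compl_subset h hsa
  have hsub : (endRegion φ s)ᶜ ⊆ glueDomain φ a L ∩ {x | x ∈ φ.source ∧ a ≤ ‖φ x‖}ᶜ :=
    fun x hx => ⟨hsW hx, fun hxa => hx ⟨hxa.1, hsa.trans hxa.2⟩⟩
  obtain ⟨e, hes, hepr⟩ := hq.exists_openPartialHomeomorph
    (h.isClosed_endRegion s (hs'.trans hss')).isOpen_compl hsW (hq.injOn_compl.mono hsub)
  have heW : e.source ⊆ glueDomain φ a L := hes ▸ hsW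
  have hp : IsPiece (n := n) pr (glueDomain φ a L) e :=
    ⟨heW, hepr, (hpiece e heW hepr).1, (hpiece e heW hepr).2⟩
  have heT : e.target = pr '' (endRegion φ s)ᶜ := by
    rw [← e.image_source_eq_target, hes, hepr]; rfl
  set A : Set M := {x | x ∈ φ.source ∧ s' < ‖φ x‖}ᶜ with hA
  have hAc : IsClosed A := by
    rw [isClosed_compl_iff]
    exact φ.isOpen_inter_preimage (isOpen_lt continuous_const continuous_norm :
      IsOpen {z : Euc n | s' < ‖z‖})
  have hAs : A ⊆ e.source := by
    rw [hes]
    exact fun x hx hxs => hx ⟨hxs.1, hss'.trans_le hxs.2⟩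
  refine isCompleteMetric_of_isometric_outside_compact hg hp.smooth_symm (fun q hq v w => ?_)
    (D := pr '' A) (K := closedOuterImage pr φ a L s') ?_ ?_ (hq.isCompact_image h hs' (by linarith))
    ?_ ?_ ?_
  · rw [hk e hp q hq]
    refine hgg' _ ?_ _ _
    have h1 := e.map_target hq
    rwa [hes] at h1
  · have h1 := hq.isClosed_image h hAc fun x hx y hxy => by
      rcases hxy with rfl | hxy
      · exact hx
      · exact absurd ⟨hxy.1.1, (hss'.trans_le hsa).trans_le hxy.1.2⟩ hx
    rwa [inter_eq_self_of_subset_right (hAs.trans heW)] at h1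
  · rintro _ ⟨x, hx, rfl⟩
    rw [← hepr]
    exact e.map_source (hAs hx)
  · refine eq_univ_of_forall fun q => ?_
    obtain ⟨x, hx, rfl⟩ := hq.surj q
    by_cases hxA : x ∈ A
    · exact Or.inr ⟨x, hxA, rfl⟩
    · have hxA : x ∈ φ.source ∧ s' < ‖φ x‖ := by simpa [hA] using hxA
      exact Or.inl ⟨x, ⟨hx, hxA.1, hxA.2.le⟩, rfl⟩
  · rw [heT]
    exact (hq.compl_image_compl h hsa) ▸ hq.isCompact_image h (hs'.trans hss') hsa
  · have h1 : e.symm '' (pr '' A) = A := by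
      rw [← hepr, image_image]
      ext x
      constructor
      · rintro ⟨y, hy, rfl⟩
        change e.symm (e y) ∈ A
        rwa [e.left_inv (hAs hy)]
      · exact fun hx => ⟨x, hx, e.left_inv (hAs hx)⟩
    rw [h1]
    exact hAc

lemma isClosingUp (hq : IsGlueQuotient φ a L pr) (h : IsGlueable φ a L)
    (het : IsSmoothEtale (n := n) pr (glueDomain φ a L))
    (hk : IsDescended g' k pr (glueDomain φ a L)) {s : ℝ} (hs : 1 < s) (hsa : s ≤ a)
    (hgg' : ∀ x ∉ endRegion φ s, ∀ v w : TangentSpace (𝓡 n) x, g'.inner x v w = g.inner x v w)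
    (S : Set M) : IsClosingUp g φ S k (pr '' S) := by
  have hsW : (endRegion φ s)ᶜ ⊆ glueDomain φ a L := compl_subset h hsa
  refine ⟨s, hs, pr, fun x hx => ?_, ?_, fun x hx v w => ?_, ?_, rfl⟩
  · obtain ⟨e, hxe, he⟩ := het.exists_piece x (hsW hx)
    have h1 := he.smooth.contMDiffAt (e.open_source.mem_nhds hxe)
    rw [he.coe_eq] at h1
    exact h1.contMDiffWithinAt
  · have hsub : (endRegion φ s)ᶜ ⊆ glueDomain φ a L ∩ {x | x ∈ φ.source ∧ a ≤ ‖φ x‖}ᶜ :=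
      fun x hx => ⟨hsW hx, fun hxa => hx ⟨hxa.1, hsa.trans hxa.2⟩⟩
    exact hq.injOn_compl.mono hsub
  · rw [hk.inner_mfderiv het (hsW hx)]
    exact hgg' x hx v w
  · exact (hq.compl_image_compl h hsa) ▸ hq.isCompact_image h hs hsa

lemma hasSingularSet (hq : IsGlueQuotient φ a L pr) (h : IsGlueable φ a L)
    (het : IsSmoothEtale (n := n) pr (glueDomain φ a L))
    (hk : IsDescended g' k pr (glueDomain φ a L)) {S : Set M} {p : ENNReal}
    (hS : HasSingularSet p g' S) (hSφ : Disjoint S φ.source) : HasSingularSet p k (pr '' S) := by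
  have hSW : S ⊆ glueDomain φ a L := fun x hx hxφ => absurd hxφ (disjoint_left.1 hSφ hx)
  refine hk.hasSingularSet het hSW ?_ ?_ hS
  · rintro x hx ⟨y, hyS, hyx⟩
    exact hq.eq_of_notMem (hSW hyS) hx (fun hya => disjoint_left.1 hSφ hyS hya.1) hyx ▸ hyS
  · have h1 := hq.isClosed_image h hS.isClosed fun x hx y hxy => by
      rcases hxy with rfl | hxy
      · exact hx
      · exact absurd hxy.1.1 (disjoint_left.1 hSφ hx)
    rwa [inter_eq_self_of_subset_right hSW] at h1

end IsGlueQuotient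

end ClosingUp

end SingularAF

end

/-! ### Closing up the end. -/

theorem proposition3p3 {n : ℕ} (hn : 3 ≤ n) {p : ENNReal} (hp : (n : ENNReal) < p)
    {M : Type u} [TopologicalSpace M] [T2Space M] [SecondCountableTopology M] [ConnectedSpace M]
    [ChartedSpace (SingularAF.Euc n) M] [IsManifold (𝓡 n) ∞ M]
    (hM : SingularAF.IsOrientable n M)
    (g : SingularAF.C0Metric n M) (hg : SingularAF.IsCompleteMetric g)
    (φ : OpenPartialHomeomorph M (SingularAF.Euc n)) (hφ : SingularAF.IsAFEnd g φ)
    (S : Set M) (hS : SingularAF.HasSingularSet p g S) (hSφ : Disjoint S φ.source)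
    (hR : ∀ x ∈ Sᶜ, 0 ≤ SingularAF.scalarCurv g x)
    (hflat : SingularAF.IsConformallyFlatScalarFlatNearInfinity g φ)
    {m : ℝ} (hm : SingularAF.HasADMMass g φ m) (hm_neg : m < 0) :
    ∃ (N : Type u) (_ : TopologicalSpace N) (_ : T2Space N) (_ : SecondCountableTopology N)
      (_ : ConnectedSpace N) (_ : ChartedSpace (SingularAF.Euc n) N) (_ : IsManifold (𝓡 n) ∞ N)
      (h : SingularAF.C0Metric n N) (T U₀ U₁ U₂ : Set N),
      SingularAF.IsOrientable n N ∧
      SingularAF.IsCompleteMetric h ∧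
      SingularAF.IsClosingUp g φ S h T ∧
      (IsOpen U₀ ∧ IsOpen U₁ ∧ IsOpen U₂) ∧
      (U₀ ⊆ U₁ ∧ U₁ ⊆ U₂) ∧
      (SingularAF.IsBoundedFor h U₀ ∧ SingularAF.IsBoundedFor h U₁ ∧
        SingularAF.IsBoundedFor h U₂) ∧
      SingularAF.HasSingularSet p h T ∧
      Disjoint T (closure U₂) ∧
      (∀ x ∈ Tᶜ, 0 ≤ SingularAF.scalarCurv h x) ∧
      SingularAF.IsTorusMinusBall n U₀ ∧
      (frontier U₂).Nonempty ∧
      0 < SingularAF.setDist h (frontier U₂) U₁ ∧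
      ∀ x ∈ closure U₂ \ U₁, 0 < SingularAF.scalarCurv h x := by

  have hn0 : 0 < n := by omega
  obtain ⟨u, v, s₀, s₁, s₂, s₃, ε, c, hcap⟩ :=
    SingularAF.exists_isConformalCap hn hφ hflat hm hm_neg
  have hs₀ := hcap.one_le
  have hs₁ := hcap.lt₀
  have hs₂ := hcap.lt₁
  have hs₃ := hcap.lt₂
  have hε := hcap.ε_pos
  -- Any `L > 2 s₃` would do: the balls of radius `s₃` about the lattice points must be disjoint.
  set L : ℝ := 2 * s₃ + 1 with hL
  have h : SingularAF.IsGlueable φ s₃ L :=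
    ⟨hφ.target_eq, hφ.isClosed_endRegion, by linarith, by linarith⟩
  obtain ⟨x₀, hx₀, -⟩ := SingularAF.IsGlueQuotient.exists_norm_eq h hn0 h.one_lt le_rfl
  obtain ⟨N, topN, pr, hq⟩ := h.exists_quotient ⟨x₀, hx₀⟩
  have t2N : T2Space N := hq.t2Space h
  have scN : SecondCountableTopology N := hq.secondCountableTopology h
  have coN : ConnectedSpace N := hq.connectedSpace h
  obtain ⟨csN, manN, hpiece, hchart⟩ := (hq.isEtale h hφ.mem_atlas).exists_isManifold
    (SingularAF.IsConformalCap.chart φ (s₁ - ε))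
    (SingularAF.IsConformalCap.chart_mem_maximalAtlas hφ.mem_atlas _)
    (SingularAF.IsConformalCap.mem_chart_source φ _)
  -- With the Hausdorff property this makes `N` regular, so that the induced distance defines its
  -- topology.
  have : LocallyCompactSpace N := ChartedSpace.locallyCompactSpace (SingularAF.Euc n) N
  have het := hq.isSmoothEtale h hpiece
  obtain ⟨k, hk⟩ := SingularAF.exists_descended_metric het (hcap.metric hφ)
    (hq.isInvariantMetric h hφ.mem_atlas fun y hy => by
      rw [hcap.coordMetric_metric hφ (by linarith), hcap.v_const y hy])
  have hk : SingularAF.IsDescended (hcap.metric hφ) k pr (SingularAF.glueDomain φ s₃ L) := hk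
  have hscal : ∀ q : N, ∃ x ∈ SingularAF.glueDomain φ s₃ L, pr x = q ∧
      SingularAF.scalarCurv k q = SingularAF.scalarCoord (SingularAF.coordMetric (hcap.metric hφ)
        (SingularAF.IsConformalCap.chart φ (s₁ - ε) x))
        (SingularAF.IsConformalCap.chart φ (s₁ - ε) x x) := by
    intro q
    obtain ⟨x, hx, e, hxe, heW, hepr, rfl, hxc⟩ := hchart q
    exact ⟨x, hx, rfl, hk.scalarCurv_eq ⟨heW, hepr, (hpiece e heW hepr).1,
      (hpiece e heW hepr).2⟩ hxe
      (SingularAF.IsConformalCap.mem_chart_source φ _ x) hxc⟩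
  -- With `s₂ < t₂ < t₁ < s₃`, points of `closure U₂` outside `U₁` satisfy `t₂ ≤ r ≤ t₁`, inside the
  -- collar where `Δv < 0`.
  obtain ⟨t₂, hst₂, ht₂⟩ := exists_between hs₃
  obtain ⟨t₁, hst₁, ht₁⟩ := exists_between ht₂
  -- The lower bound keeps the rescaled torus away from the ball of radius `s₃`, the upper one keeps
  -- the removed ball embedded.
  obtain ⟨ρ, hρ₁, hρ₂⟩ : ∃ ρ, s₃ / L < ρ ∧ ρ < 1 / 2 := exists_between (by
    rw [div_lt_div_iff₀ h.L_pos two_pos]; linarith)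
  have hLρ : s₃ ≤ L * ρ := by
    rw [div_lt_iff₀ h.L_pos] at hρ₁
    linarith
  have hρ0 : 0 < ρ := lt_trans (div_pos (by linarith) h.L_pos) hρ₁
  have hclosure : closure (SingularAF.outerImage pr φ s₃ L t₂)
      ⊆ SingularAF.closedOuterImage pr φ s₃ L t₂ :=
    closure_minimal (SingularAF.outerImage_subset t₂)
      (hq.isClosed_closedOuterImage h (by linarith) ht₂.le)
  have hcompact : IsCompact (SingularAF.closedOuterImage pr φ s₃ L t₂) :=
    hq.isCompact_image h (by linarith) ht₂.le
  have hU₀ := SingularAF.IsGlueQuotient.torusImage_subset (pr := pr) h hLρ ht₁.le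
  have hU₁ : SingularAF.outerImage pr φ s₃ L t₁ ⊆ SingularAF.outerImage pr φ s₃ L t₂ :=
    (SingularAF.outerImage_subset t₁).trans (SingularAF.closedOuterImage_subset hst₁)
  have hU₂ : SingularAF.outerImage pr φ s₃ L t₂ ⊆ SingularAF.closedOuterImage pr φ s₃ L t₂ :=
    SingularAF.outerImage_subset t₂
  refine ⟨N, topN, t2N, scN, coN, csN, manN, k, pr '' S,
    (fun x => pr (φ.symm (L • x))) '' SingularAF.perforatedSpace n ρ,
    SingularAF.outerImage pr φ s₃ L t₁, SingularAF.outerImage pr φ s₃ L t₂,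
    hq.isOrientable h hφ.mem_atlas (by omega) het hM,
    hq.isCompleteMetric h hpiece hk hg (s := s₁) (s' := s₁ - ε) (by linarith) (by linarith)
      (by linarith) fun x hx => hcap.inner_metric hφ hx,
    hq.isClosingUp h het hk (s := s₁) (by linarith) (by linarith)
      (fun x hx => hcap.inner_metric hφ hx) S,
    ⟨hq.isOpen_torusImage h hρ₂ hLρ, hq.isOpen_outerImage h t₁, hq.isOpen_outerImage h t₂⟩,
    ⟨hU₀, hU₁⟩,
    ⟨SingularAF.isBoundedFor_of_isCompact k hcompact (hU₀.trans (hU₁.trans hU₂)),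
      SingularAF.isBoundedFor_of_isCompact k hcompact (hU₁.trans hU₂),
      SingularAF.isBoundedFor_of_isCompact k hcompact hU₂⟩,
    hq.hasSingularSet h het hk (hcap.hasSingularSet_metric hφ hS hSφ) hSφ,
    hq.disjoint_image_closure_outerImage h hSφ (by linarith) ht₂.le,
    fun q hqT => ?_,
    hq.isTorusMinusBall h hφ.mem_atlas het hρ0 hρ₂ hLρ,
    hq.nonempty_frontier_outerImage h hn0 (by linarith) ht₂, ?_, fun q hqU => ?_⟩
  · obtain ⟨x, hx, rfl, hxs⟩ := hscal q
    rw [hxs]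
    exact hcap.scalarCoord_nonneg hφ hn (hR x fun hxS => hqT (mem_image_of_mem pr hxS))
  · refine SingularAF.setDist_pos k (B := SingularAF.closedOuterImage pr φ s₃ L t₁)
      (hcompact.of_isClosed_subset isClosed_frontier (frontier_subset_closure.trans hclosure))
      (hq.isClosed_closedOuterImage h (by linarith) ht₁.le) ?_ (SingularAF.outerImage_subset t₁)
    rw [(hq.isOpen_outerImage h t₂).frontier_eq, disjoint_left]
    exact fun q hqf hqB => hqf.2 (SingularAF.closedOuterImage_subset hst₁ hqB)
  · obtain ⟨x, hx, rfl, hxs⟩ := hscal q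
    obtain ⟨hxφ, hx₂⟩ := (hq.mem_closedOuterImage_iff ht₂.le hx).1 (hclosure hqU.1)
    have hx₁ : ‖φ x‖ ≤ t₁ := not_lt.1 fun hlt =>
      hqU.2 ((hq.mem_outerImage_iff ht₁ hx).2 ⟨hxφ, hlt⟩)
    rw [hxs]
    exact hcap.scalarCoord_pos hφ hn hxφ (by linarith) (by linarith)
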